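/- Let $\mathcal K\subset\mathbb R^d$ be compact and convex, let $\phi$ be a mirror function and $f$ a potential on $\mathcal K$, and let $\alpha,\beta,\lambda,\mu\ge 0$. Write $\|u\|_A=\sqrt{\langle u,Au\rangle}$ for a positive definite matrix $A$. Suppose that $\phi$ is of Legendre type (differentiable and strictly convex on $\mathrm{int}\,\mathcal K$, with $\|\nabla\phi(x)\|\to\infty$ as $x$ tends to a boundary point of $\mathcal K$), that $f$ is convex and differentiable on $\mathrm{int}\,\mathcal K$, and that the following hold on $\mathrm{int}\,\mathcal K$. * (A1) $\phi$ is self-concordant with parameter $\alpha$: it is three times differentiable and $|\nabla^3\phi(x)[u,u,u]|\le 2\alpha\|u\|_{\nabla^2\phi(x)}^3$ for all $x$ and all $u\in\mathbb R^d$. * (A2) $f$ is $\mu$-relatively convex and $\lambda$-relatively smooth with respect to $\phi$: the functions $f-\mu\phi$ and $\lambda\phi-f$ are convex. * (A3) $f$ is $\beta$-relatively Lipschitz with respect to $\phi$: $\|\nabla f(x)\|_{\nabla^2\phi(x)^{-1}}\le\beta$ for all $x$. Let $\phi^*(y)=\sup_{x\in\mathrm{int}\,\mathcal K}\,(\langle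 x,y\rangle-\phi(x))$. For a step size $h>0$ and $x\in\mathrm{int}\,\mathcal K$, let $\mathcal P_x$ be the law of $$\nabla\phi^*\big(\nabla\phi(x)-h\nabla f(x)+\sqrt{2h\nabla^2\phi(x)}\;\xi\big),\qquad \xi\sim\mathcal N(0,I_d),$$ with density $$p_x(z)=\frac{\det\nabla^2\phi(z)}{(4h\pi)^{d/2}\sqrt{\det\nabla^2\phi(x)}}\exp\Big(-\frac{\|\nabla\phi(z)-\nabla\phi(x)+h\nabla f(x)\|^2_{\nabla^2\phi(x)^{-1}}}{4h}\Big).$$ Let $\pi\propto e^{-f}$ be the target density on $\mathcal K$, and let $\mathcal T_x$ be the Metropolis-adjusted kernel: a proposal $z\sim\mathcal P_x$ is accepted with probability $\min\{1,\frac{\pi(z)p_z(x)}{\pi(x)p_x(z)}\}$, and otherwise the chain stays at $x$. Let $d_{\mathrm{TV}}(\mu_1,\mu_2)=\sup_A\,(\mu_1(A)-\mu_2(A))$ over measurable sets $A$. Put $\bar\alpha=\max\{1,\alpha\}$ and $\gamma=\frac\lambda2+\alpha\beta$. For $\varepsilon\in(0,1)$ let $N_\varepsilon=1+\sqrt{2\log(8/\varepsilon)}+2\log(8/\varepsilon)$,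 $I_\varepsilon=\sqrt{2\log(8/\varepsilon)}$, $$C_1(\varepsilon)=\Big(\big(\tfrac{\varepsilon}{24}\big)^{2/3}\tfrac1{6N_\varepsilon}\Big)^3,\quad C_2(\varepsilon)=\tfrac{\varepsilon}{16}\cdot\tfrac1{6N_\varepsilon},\quad C_3(\varepsilon)=\Big(\big(\tfrac{\varepsilon}{72}\big)^2\tfrac1{6\sqrt2\,I_\varepsilon}\Big)^{2/3},\quad C_4(\varepsilon)=\tfrac{\varepsilon}{16}\cdot\tfrac1{6\sqrt2\,I_\varepsilon},$$ $$b(\varepsilon;d,\alpha,\beta,\lambda)=\min\Big\{1,\frac{C_1(\varepsilon)}{\alpha^2d^3},\frac{C_2(\varepsilon)}{d\gamma},\frac{C_3(\varepsilon)}{\beta^{2/3}\alpha^{4/3}},\frac{C_4(\varepsilon)}{\beta^{2/3}\gamma^{2/3}},\frac{\varepsilon}{4\beta^2}\Big\},$$ where a quotient with denominator $0$ is $+\infty$. Then the following hold. 1. For all $h\in(0,1)$ and all $x,y\in\mathrm{int}\,\mathcal K$ with $\|x-y\|_{\nabla^2\phi(y)}\le\frac{\sqrt h}{10\bar\alpha}$,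 $$d_{\mathrm{TV}}(\mathcal P_x,\mathcal P_y)\le\frac12\sqrt{\frac{hd}{20}+\frac1{80}+\frac92h\beta^2}.$$ 2. For all $\varepsilon\in(0,1)$, all $h\in(0,b(\varepsilon;d,\alpha,\beta,\lambda)]$ and all $x\in\mathrm{int}\,\mathcal K$, $$d_{\mathrm{TV}}(\mathcal T_x,\mathcal P_x)\le\frac\varepsilon2.$$ -/

import Mathlib

open MeasureTheory ProbabilityTheory Filter Topology
open scoped ENNReal Matrix

noncomputable section

namespace MirrorLangevin

variable {d : ℕ}

/-! ### Local norms and derivatives -/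

/-- `‖u‖_A = √⟨u, A u⟩`. -/
def localNorm (A : Matrix (Fin d) (Fin d) ℝ) (u : EuclideanSpace ℝ (Fin d)) : ℝ :=
  √(inner ℝ u (Matrix.toEuclideanCLM (𝕜 := ℝ) A u))

/-- The Hessian matrix `∇²ψ(x)`. -/
def hess (ψ : EuclideanSpace ℝ (Fin d) → ℝ) (x : EuclideanSpace ℝ (Fin d)) :
    Matrix (Fin d) (Fin d) ℝ :=
  Matrix.of fun i j =>
    iteratedFDeriv ℝ 2 ψ x ![EuclideanSpace.single i 1, EuclideanSpace.single j 1]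

/-! ### Function classes

Functions on `K` are represented by total functions on `ℝᵈ`. All conditions below only involve the
values on the interior of `K`, since a mirror function may be infinite on the boundary. -/

/-- `φ` is of Legendre type on `K`: differentiable and strictly convex on the interior, with
gradients that become unbounded at the boundary. -/
structure IsLegendre (K : Set (EuclideanSpace ℝ (Fin d)))
    (φ : EuclideanSpace ℝ (Fin d) → ℝ) : Prop where
  differentiable : DifferentiableOn ℝ φ (interior K)
  strictConvex : StrictConvexOn ℝ (interior K) φ
  gradient_unbounded : ∀ z ∈ frontier K,
    Tendsto (fun x => ‖gradient φ x‖) (𝓝[interior K] z) atTop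

/-- `φ` is self-concordant with parameter `α`: it is three times differentiable, strictly convex,
and `|∇³φ(x)[u,u,u]| ≤ 2 α ‖u‖³` in the norm of `∇²φ(x)`. -/
structure IsSelfConcordant (K : Set (EuclideanSpace ℝ (Fin d)))
    (φ : EuclideanSpace ℝ (Fin d) → ℝ) (α : ℝ) : Prop where
  nonneg : 0 ≤ α
  differentiable : ∀ k < 3, DifferentiableOn ℝ (iteratedFDeriv ℝ k φ) (interior K)
  strictConvex : StrictConvexOn ℝ (interior K) φ
  bound : ∀ x ∈ interior K, ∀ u : EuclideanSpace ℝ (Fin d),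
    |iteratedFDeriv ℝ 3 φ x (fun _ => u)| ≤ 2 * α * localNorm (hess φ x) u ^ 3

/-- `g` is a differentiable convex function that is `μ`-relatively convex with respect to `ψ`. -/
structure IsRelConvex (K : Set (EuclideanSpace ℝ (Fin d)))
    (g ψ : EuclideanSpace ℝ (Fin d) → ℝ) (μ : ℝ) : Prop where
  nonneg : 0 ≤ μ
  differentiable : DifferentiableOn ℝ g (interior K)
  convex : ConvexOn ℝ (interior K) g
  rel : ConvexOn ℝ (interior K) (fun x => g x - μ * ψ x)

/-- `g` is a differentiable convex function that is `lam`-relatively smooth with respect to `ψ`. -/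
structure IsRelSmooth (K : Set (EuclideanSpace ℝ (Fin d)))
    (g ψ : EuclideanSpace ℝ (Fin d) → ℝ) (lam : ℝ) : Prop where
  nonneg : 0 ≤ lam
  differentiable : DifferentiableOn ℝ g (interior K)
  convex : ConvexOn ℝ (interior K) g
  rel : ConvexOn ℝ (interior K) (fun x => lam * ψ x - g x)

/-- `g` is `β`-relatively Lipschitz with respect to `ψ`: the norm of `∇g(x)` with respect to
`∇²ψ(x)⁻¹` is at most `β`. -/
structure IsRelLipschitz (K : Set (EuclideanSpace ℝ (Fin d)))
    (g ψ : EuclideanSpace ℝ (Fin d) → ℝ) (β : ℝ) : Prop where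
  differentiable : DifferentiableOn ℝ g (interior K)
  bound : ∀ x ∈ interior K, localNorm (hess ψ x)⁻¹ (gradient g x) ≤ β

/-! ### The Markov kernels -/

/-- The convex conjugate `φ*(y) = sup_x ⟨x, y⟩ - φ(x)`, over the interior of `K`. -/
def convexConj (K : Set (EuclideanSpace ℝ (Fin d))) (φ : EuclideanSpace ℝ (Fin d) → ℝ)
    (y : EuclideanSpace ℝ (Fin d)) : ℝ :=
  ⨆ x : interior K, (inner ℝ (x : EuclideanSpace ℝ (Fin d)) y - φ x)

/-- The proposal `P_x`, the law of `∇φ*(∇φ(x) - h ∇f(x) + √(2 h ∇²φ(x)) ξ)` with `ξ ∼ N(0, I)`: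
the image under `∇φ*` of the normal distribution with mean `∇φ(x) - h ∇f(x)` and covariance
`2 h ∇²φ(x)`. -/
def proposal (K : Set (EuclideanSpace ℝ (Fin d))) (φ f : EuclideanSpace ℝ (Fin d) → ℝ) (h : ℝ)
    (x : EuclideanSpace ℝ (Fin d)) : Measure (EuclideanSpace ℝ (Fin d)) :=
  (multivariateGaussian (gradient φ x - h • gradient f x) ((2 * h) • hess φ x)).map
    (gradient (convexConj K φ))

/-- The density `p_x(z)` of the proposal `P_x` at `z`. -/
def proposalDensity (φ f : EuclideanSpace ℝ (Fin d) → ℝ) (h : ℝ)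
    (x z : EuclideanSpace ℝ (Fin d)) : ℝ :=
  (hess φ z).det / ((4 * h * Real.pi) ^ ((d : ℝ) / 2) * √(hess φ x).det) *
    Real.exp (-(localNorm (hess φ x)⁻¹ (gradient φ z - gradient φ x + h • gradient f x) ^ 2
      / (4 * h)))

/-- The density `π ∝ exp (-f)` of the target distribution on `K`. -/
def targetDensity (K : Set (EuclideanSpace ℝ (Fin d))) (f : EuclideanSpace ℝ (Fin d) → ℝ) :
    EuclideanSpace ℝ (Fin d) → ℝ :=
  K.indicator fun x => Real.exp (-f x) / ∫ y in K, Real.exp (-f y)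

/-- The probability of accepting the proposal `z` from `x`. -/
def acceptProb (K : Set (EuclideanSpace ℝ (Fin d))) (φ f : EuclideanSpace ℝ (Fin d) → ℝ) (h : ℝ)
    (x z : EuclideanSpace ℝ (Fin d)) : ℝ :=
  min 1 (targetDensity K f z * proposalDensity φ f h z x /
    (targetDensity K f x * proposalDensity φ f h x z))

/-- The Metropolis-adjusted kernel `T_x`: a proposal `z ∼ P_x` is accepted with probability
`acceptProb K φ f h x z`, and otherwise the chain remains at `x`. -/
def metropolis (K : Set (EuclideanSpace ℝ (Fin d))) (φ f : EuclideanSpace ℝ (Fin d) → ℝ) (h : ℝ)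
    (x : EuclideanSpace ℝ (Fin d)) : Measure (EuclideanSpace ℝ (Fin d)) :=
  (proposal K φ f h x).withDensity (fun z => ENNReal.ofReal (acceptProb K φ f h x z)) +
    (1 - ∫⁻ z, ENNReal.ofReal (acceptProb K φ f h x z) ∂(proposal K φ f h x)) • Measure.dirac x

/-- The total variation distance `sup_A μ(A) - ν(A)` over measurable sets `A`. -/
def tvDist {Ω : Type*} [MeasurableSpace Ω] (μ ν : Measure Ω) : ℝ :=
  ⨆ A : {A : Set Ω // MeasurableSet A}, (μ.real A - ν.real A)

/-! ### The step size bound -/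

/-- `N_ε = 1 + √(2 log (8/ε)) + 2 log (8/ε)`. -/
def constN (ε : ℝ) : ℝ := 1 + √(2 * Real.log (8 / ε)) + 2 * Real.log (8 / ε)

/-- `I_ε = √(2 log (8/ε))`. -/
def constI (ε : ℝ) : ℝ := √(2 * Real.log (8 / ε))

def constC₁ (ε : ℝ) : ℝ := ((ε / 24) ^ (2 / 3 : ℝ) * (1 / (6 * constN ε))) ^ 3

def constC₂ (ε : ℝ) : ℝ := ε / 16 * (1 / (6 * constN ε))

def constC₃ (ε : ℝ) : ℝ := ((ε / 72) ^ 2 * (1 / (6 * √2 * constI ε))) ^ (2 / 3 : ℝ)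

def constC₄ (ε : ℝ) : ℝ := ε / 16 * (1 / (6 * √2 * constI ε))

/-- The quotient `c / t` of nonnegative reals, with `c / 0 = ∞` for `c > 0`. -/
def extDiv (c t : ℝ) : ℝ≥0∞ := ENNReal.ofReal c / ENNReal.ofReal t

/-- The maximal step size `b(ε; d, α, β, lam)`, where `γ = lam / 2 + α β`. The minimum is at most
`1`, and entries with a vanishing denominator are infinite. -/
def stepBound (ε : ℝ) (d : ℕ) (α β lam : ℝ) : ℝ :=
  (min 1 <| min (extDiv (constC₁ ε) (α ^ 2 * (d : ℝ) ^ 3)) <|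
    min (extDiv (constC₂ ε) (d * (lam / 2 + α * β))) <|
    min (extDiv (constC₃ ε) (β ^ (2 / 3 : ℝ) * α ^ (4 / 3 : ℝ))) <|
    min (extDiv (constC₄ ε) (β ^ (2 / 3 : ℝ) * (lam / 2 + α * β) ^ (2 / 3 : ℝ)))
      (extDiv ε (4 * β ^ 2))).toReal

end MirrorLangevin

end

/-!
# Total variation bounds for the Metropolis-adjusted mirror Langevin algorithm

The map `∇φ*` is the inverse of `∇φ` (`MirrorLangevin.gradient_convexConj`): the blow-up of `∇φ` at
the boundary forces `φ - ⟨·, y⟩` to attain its minimum in the interior of `K`, for every `y`. Hence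
the proposal `P_x` is the image, under one and the same homeomorphism onto the interior of `K`, of
the normal distribution with mean `∇φ(x) - h ∇f(x)` and covariance `2 h ∇²φ(x)`.

Both bounds rest on the comparison of the Hessians `H_x = ∇²φ(x)` at nearby points. The definition
of self-concordance bounds `∇³φ` on the diagonal; Banach's inequality for symmetric trilinear forms
(`abs_trilinear_le`) gives `|∇³φ[w,v,v]| ≤ 2 α ‖w‖ ‖v‖²` with the same constant. Integrating along
the segment from `x` to `z`, with `r = ‖z - x‖_{H_x}` and `α r < 1`, one gets
`(1 - α r)² H_x ≤ H_z ≤ (1 - α r)⁻² H_x` (`SelfConcordantOn.hess_line_compare`), and with it the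
bounds for `∇φ(z) - ∇φ(x)` and for its linearization error `∇φ(z) - ∇φ(x) - H_x (z - x)`.

*Nearby proposals.* Total variation does not increase under `∇φ*`, so it is enough to compare two
normal distributions. Pinsker's inequality reduces this to relative entropy, which is half of
the sum of the squared distance of the means in the dual norm and of `∑ (t - 1 - log t)` over the
eigenvalues `t` of the whitened covariance (`MirrorLangevin.multivariateGaussian_real_sub_le`).

*Metropolis adjustment.* The distance between `T_x` and `P_x` is at most the probability of
rejection. Outside an event of probability at most `ε / 8` the noise satisfies
`‖ξ‖² ≤ 2 d N_ε`, and then the acceptance probability is at least `1 - 3 ε / 8`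
(`MirrorLangevin.le_acceptProb`, `MirrorLangevin.loss_le`). Write `D = ∇φ(z) - ∇φ(x)`. The
logarithm of the acceptance ratio contains `f(x) - f(z)`, which is at least
`-½ ⟨∇f(x) + ∇f(z), z - x⟩ - (λ / 2) ⟨D, z - x⟩` by convexity and relative smoothness
(`MirrorLangevin.sub_ge_of_relSmooth`), and the cross terms
`½ ⟨H_x⁻¹ D, ∇f(x)⟩ + ½ ⟨H_z⁻¹ D, ∇f(z)⟩` of the proposal densities. The inner products
cancel up to the linearization errors, which leaves quantities of the size of `h β²`,
`d α r`, `γ r²` and `(‖D‖² / h) α r`; the constraints on the step size bound each of them by a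
multiple of `ε`.
-/

/-! ### Third order calculus under mere differentiability -/

section Calculus

variable {E : Type*} [NormedAddCommGroup E] [NormedSpace ℝ E] {U : Set E} {φ : E → ℝ}

/-- Three times differentiable functions are twice continuously differentiable; the third derivative
need not be continuous. -/
theorem contDiffOn_two_of_differentiableOn_iteratedFDeriv (hU : IsOpen U)
    (hd : ∀ k < 3, DifferentiableOn ℝ (iteratedFDeriv ℝ k φ) U) : ContDiffOn ℝ 2 φ U := by
  have key : ∀ m : ℕ, m < 3 → DifferentiableOn ℝ (fun x => iteratedFDerivWithin ℝ m φ U x) U :=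
    fun m hm => (hd m hm).congr fun x hx => iteratedFDerivWithin_of_isOpen m hU hx
  refine (contDiffOn_nat_iff_continuousOn_differentiableOn (n := 2) hU.uniqueDiffOn).2
    ⟨fun m hm => (key m (by omega)).continuousOn, fun m hm => key m (by omega)⟩

theorem iteratedFDeriv_two_comm (hU : IsOpen U)
    (hd : ∀ k < 3, DifferentiableOn ℝ (iteratedFDeriv ℝ k φ) U) {x : E} (hx : x ∈ U) (u v : E) :
    iteratedFDeriv ℝ 2 φ x ![u, v] = iteratedFDeriv ℝ 2 φ x ![v, u] := by
  have h := (contDiffOn_two_of_differentiableOn_iteratedFDeriv hU hd).contDiffAt (hU.mem_nhds hx)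
  exact (h.isSymmSndFDerivAt (by simp)).iteratedFDeriv_cons

theorem hasFDerivAt_iteratedFDeriv_two_apply (hU : IsOpen U)
    (hd : ∀ k < 3, DifferentiableOn ℝ (iteratedFDeriv ℝ k φ) U) {x : E} (hx : x ∈ U) (u v : E) :
    HasFDerivAt (fun y => iteratedFDeriv ℝ 2 φ y ![u, v])
      ((ContinuousMultilinearMap.apply ℝ (fun _ : Fin 2 => E) ℝ ![u, v]).comp
        (fderiv ℝ (iteratedFDeriv ℝ 2 φ) x)) x := by
  have h := ((hd 2 (by norm_num)).differentiableAt (hU.mem_nhds hx)).hasFDerivAt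
  exact (ContinuousMultilinearMap.apply ℝ (fun _ : Fin 2 => E) ℝ ![u, v]).hasFDerivAt.comp x h

theorem hasDerivAt_iteratedFDeriv_two_line (hU : IsOpen U)
    (hd : ∀ k < 3, DifferentiableOn ℝ (iteratedFDeriv ℝ k φ) U) {x w : E} {t : ℝ}
    (hx : x + t • w ∈ U) (u v : E) :
    HasDerivAt (fun s : ℝ => iteratedFDeriv ℝ 2 φ (x + s • w) ![u, v])
      (iteratedFDeriv ℝ 3 φ (x + t • w) ![w, u, v]) t := by
  have h := hasFDerivAt_iteratedFDeriv_two_apply hU hd hx u v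
  have hl : HasDerivAt (fun s : ℝ => x + s • w) w t := by
    simpa using ((hasDerivAt_id t).smul_const w).const_add x
  exact h.comp_hasDerivAt t hl

theorem iteratedFDeriv_three_comm_right (hU : IsOpen U)
    (hd : ∀ k < 3, DifferentiableOn ℝ (iteratedFDeriv ℝ k φ) U) {x : E} (hx : x ∈ U) (w u v : E) :
    iteratedFDeriv ℝ 3 φ x ![w, u, v] = iteratedFDeriv ℝ 3 φ x ![w, v, u] := by
  have h1 := hasFDerivAt_iteratedFDeriv_two_apply hU hd hx u v
  have h2 := hasFDerivAt_iteratedFDeriv_two_apply hU hd hx v u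
  have h3 : (fun y => iteratedFDeriv ℝ 2 φ y ![u, v]) =ᶠ[𝓝 x]
      fun y => iteratedFDeriv ℝ 2 φ y ![v, u] := by
    filter_upwards [hU.mem_nhds hx] with y hy using iteratedFDeriv_two_comm hU hd hy u v
  exact congrArg (fun L : E →L[ℝ] ℝ => L w) (h1.unique (h2.congr_of_eventuallyEq h3))

/-- No continuity of the third derivative is needed: this is the symmetry of the second derivative
of the differentiable map `fderiv ℝ φ`. -/
theorem iteratedFDeriv_three_comm_left (hU : IsOpen U)
    (hd : ∀ k < 3, DifferentiableOn ℝ (iteratedFDeriv ℝ k φ) U) {x : E} (hx : x ∈ U) (w u v : E) :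
    iteratedFDeriv ℝ 3 φ x ![w, u, v] = iteratedFDeriv ℝ 3 φ x ![u, w, v] := by
  have h1 : ∀ᶠ y in 𝓝 x,
      HasFDerivAt (iteratedFDeriv ℝ 1 φ) (fderiv ℝ (iteratedFDeriv ℝ 1 φ) y) y := by
    filter_upwards [hU.mem_nhds hx] with y hy
    exact ((hd 1 (by norm_num)).differentiableAt (hU.mem_nhds hy)).hasFDerivAt
  have h := ((hd 2 (by norm_num)).differentiableAt (hU.mem_nhds hx)).hasFDerivAt
  have h2 := ((continuousMultilinearCurryLeftEquiv ℝ (fun _ : Fin 2 => E) ℝ).comp_hasFDerivAt_iff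
    (F := E →L[ℝ] E [×1]→L[ℝ] ℝ)).2 h
  exact congrArg (fun M => M ![v]) (second_derivative_symmetric_of_eventually h1 h2 w u)

theorem hasDerivAt_fderiv_line (hU : IsOpen U)
    (hd : ∀ k < 3, DifferentiableOn ℝ (iteratedFDeriv ℝ k φ) U) {x w : E} {t : ℝ}
    (hx : x + t • w ∈ U) (v : E) :
    HasDerivAt (fun s : ℝ => fderiv ℝ φ (x + s • w) v)
      (iteratedFDeriv ℝ 2 φ (x + t • w) ![w, v]) t := by
  have h0 := (contDiffOn_two_of_differentiableOn_iteratedFDeriv hU hd).contDiffAt (hU.mem_nhds hx)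
  have h1 : DifferentiableAt ℝ (fderiv ℝ φ) (x + t • w) :=
    (h0.fderiv_right (m := 1) (by norm_num)).differentiableAt (by norm_num)
  have hl : HasDerivAt (fun s : ℝ => x + s • w) w t := by
    simpa using ((hasDerivAt_id t).smul_const w).const_add x
  have h2 : HasDerivAt (fun s : ℝ => fderiv ℝ φ (x + s • w))
    (fderiv ℝ (fderiv ℝ φ) (x + t • w) w) t := h1.hasFDerivAt.comp_hasDerivAt t hl
  rw [iteratedFDeriv_two_apply]
  exact (ContinuousLinearMap.apply ℝ ℝ v).hasFDerivAt.comp_hasDerivAt t h2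

theorem hasDerivAt_line {x w : E} {t : ℝ} (h : DifferentiableAt ℝ φ (x + t • w)) :
    HasDerivAt (fun s : ℝ => φ (x + s • w)) (fderiv ℝ φ (x + t • w) w) t := by
  have hl : HasDerivAt (fun s : ℝ => x + s • w) w t := by
    simpa using ((hasDerivAt_id t).smul_const w).const_add x
  exact h.hasFDerivAt.comp_hasDerivAt t hl

end Calculus

/-! ### A sharp polarization inequality for cubic forms -/

/-- Triple-angle parametrization of the unit circle. -/
theorem exists_triple_angle {c s : ℝ} (hcs : c ^ 2 + s ^ 2 = 1) :
    ∃ x y : ℝ, x ^ 2 + y ^ 2 = 1 ∧ c = x ^ 3 - 3 * x * y ^ 2 ∧ s = 3 * x ^ 2 * y - y ^ 3 := by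
  have hz1 : ‖(⟨c, s⟩ : ℂ)‖ = 1 := by
    rw [Complex.norm_def, Complex.normSq_mk, show c * c + s * s = 1 by nlinarith, Real.sqrt_one]
  have h1 := Complex.norm_mul_cos_arg ⟨c, s⟩
  have h2 := Complex.norm_mul_sin_arg ⟨c, s⟩
  rw [hz1, one_mul] at h1 h2
  generalize Complex.arg ⟨c, s⟩ = θ at h1 h2
  change _ = c at h1
  change _ = s at h2
  have h3 := Real.cos_three_mul (θ / 3)
  have h4 := Real.sin_three_mul (θ / 3)
  have h5 := Real.sin_sq_add_cos_sq (θ / 3)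
  rw [show 3 * (θ / 3) = θ by ring] at h3 h4
  refine ⟨Real.cos (θ / 3), Real.sin (θ / 3), by rw [add_comm]; exact h5, ?_, ?_⟩
  · rw [← h1, h3]
    linear_combination (3 * Real.cos (θ / 3)) * h5
  · rw [← h2, h4]
    linear_combination (-3 * Real.sin (θ / 3)) * h5

/-- If a binary cubic form with coefficients `A, 3B, 3C, D` is bounded by `M` on the unit circle,
then its polarization at `(1,0), (1,0), (c,s)` is bounded by the same `M`. -/
theorem abs_cubic_polar_le {A B C D M : ℝ}
    (h : ∀ a b : ℝ, a ^ 2 + b ^ 2 = 1 →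
      |a ^ 3 * A + 3 * a ^ 2 * b * B + 3 * a * b ^ 2 * C + b ^ 3 * D| ≤ M)
    {c s : ℝ} (hcs : c ^ 2 + s ^ 2 = 1) : |c * A + s * B| ≤ M := by
  obtain ⟨x, y, hxy, hc, hs⟩ := exists_triple_angle hcs
  obtain ⟨r, hr⟩ : ∃ r : ℝ, r ^ 2 = 3 := ⟨√3, Real.sq_sqrt (by norm_num)⟩
  have b₀ := h x y hxy
  have b₁ := h (x / 2 - r / 2 * y) (r / 2 * x + y / 2) (by
    linear_combination hxy + (x ^ 2 + y ^ 2) / 4 * hr)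
  have b₂ := h (-(x / 2) - r / 2 * y) (r / 2 * x - y / 2) (by
    linear_combination hxy + (x ^ 2 + y ^ 2) / 4 * hr)
  -- The polarization is a signed average of the values at the angle of `(x, y)`, shifted by
  -- multiples of `π / 3`.
  have hsum : (3 * x ^ 2 - y ^ 2) ^ 2 / 9 + 4 * y ^ 2 * (y - r * x) ^ 2 / 9
      + 4 * y ^ 2 * (y + r * x) ^ 2 / 9 = 1 := by
    linear_combination (8 / 9 * x ^ 2 * y ^ 2) * hr + (x ^ 2 + y ^ 2 + 1) * hxy
  have hrep : ∀ P₀ P₁ P₂ : ℝ,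
      P₀ = x ^ 3 * A + 3 * x ^ 2 * y * B + 3 * x * y ^ 2 * C + y ^ 3 * D →
      P₁ = (x / 2 - r / 2 * y) ^ 3 * A + 3 * (x / 2 - r / 2 * y) ^ 2 * (r / 2 * x + y / 2) * B +
        3 * (x / 2 - r / 2 * y) * (r / 2 * x + y / 2) ^ 2 * C + (r / 2 * x + y / 2) ^ 3 * D →
      P₂ = (-(x / 2) - r / 2 * y) ^ 3 * A + 3 * (-(x / 2) - r / 2 * y) ^ 2 * (r / 2 * x - y / 2) * B
        + 3 * (-(x / 2) - r / 2 * y) * (r / 2 * x - y / 2) ^ 2 * C + (r / 2 * x - y / 2) ^ 3 * D →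
      c * A + s * B = (3 * x ^ 2 - y ^ 2) ^ 2 / 9 * P₀ - 4 * y ^ 2 * (y - r * x) ^ 2 / 9 * P₁
        + 4 * y ^ 2 * (y + r * x) ^ 2 / 9 * P₂ := by
    intro P₀ P₁ P₂ h₀ h₁ h₂
    have h1 : c * A + s * B = (c * A + s * B) * (x ^ 2 + y ^ 2) ^ 2 := by rw [hxy]; ring
    rw [h1, hc, hs, h₀, h₁, h₂]
    linear_combination (-(-x*y^6*A + (1/3)*x^2*y^5*B + (-1/3)*y^7*B + (2/3)*x^3*y^4*C
      + (2/9)*x^2*y^5*D + (-5/3)*x^3*y^4*A + (-2/9)*x*y^6*r^2*A + (7/3)*x^4*y^3*B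
      + (1/3)*x^2*y^5*r^2*B + (-1/9)*x^4*y^3*r^2*D + (-1/9)*x^5*y^2*A + (-1/3)*x^3*y^4*r^2*A
      + (2/3)*x^4*y^3*r^2*B + (-1/3)*x^5*y^2*r^2*C + (-1/3)*x^4*y^3*D - x^5*y^2*C)) * hr
  rw [hrep _ _ _ rfl rfl rfl]
  generalize x ^ 3 * A + 3 * x ^ 2 * y * B + 3 * x * y ^ 2 * C + y ^ 3 * D = P₀ at b₀ ⊢
  generalize (x / 2 - r / 2 * y) ^ 3 * A + 3 * (x / 2 - r / 2 * y) ^ 2 * (r / 2 * x + y / 2) * B +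
        3 * (x / 2 - r / 2 * y) * (r / 2 * x + y / 2) ^ 2 * C + (r / 2 * x + y / 2) ^ 3 * D = P₁
    at b₁ ⊢
  generalize (-(x / 2) - r / 2 * y) ^ 3 * A +
        3 * (-(x / 2) - r / 2 * y) ^ 2 * (r / 2 * x - y / 2) * B
        + 3 * (-(x / 2) - r / 2 * y) * (r / 2 * x - y / 2) ^ 2 * C + (r / 2 * x - y / 2) ^ 3 * D
    = P₂ at b₂ ⊢
  have p₀ : 0 ≤ (3 * x ^ 2 - y ^ 2) ^ 2 / 9 := by positivity
  have p₁ : 0 ≤ 4 * y ^ 2 * (y - r * x) ^ 2 / 9 := by positivity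
  have p₂ : 0 ≤ 4 * y ^ 2 * (y + r * x) ^ 2 / 9 := by positivity
  generalize (3 * x ^ 2 - y ^ 2) ^ 2 / 9 = a₀ at *
  generalize 4 * y ^ 2 * (y - r * x) ^ 2 / 9 = a₁ at *
  generalize 4 * y ^ 2 * (y + r * x) ^ 2 / 9 = a₂ at *
  rw [show M = a₀ * M + a₁ * M + a₂ * M by rw [← add_mul, ← add_mul, hsum, one_mul]]
  rw [abs_le] at b₀ b₁ b₂ ⊢
  have l₀ := mul_le_mul_of_nonneg_left b₀.1 p₀
  have u₀ := mul_le_mul_of_nonneg_left b₀.2 p₀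
  have l₁ := mul_le_mul_of_nonneg_left b₁.1 p₁
  have u₁ := mul_le_mul_of_nonneg_left b₁.2 p₁
  have l₂ := mul_le_mul_of_nonneg_left b₂.1 p₂
  have u₂ := mul_le_mul_of_nonneg_left b₂.2 p₂
  constructor <;> linarith

/-- Banach's inequality: a bound for a symmetric trilinear form `T` on the diagonal, in the norm of
a positive definite form `Q`, holds off the diagonal with the same constant. -/
theorem abs_trilinear_le {E : Type*} [AddCommGroup E] [Module ℝ E]
    {Q : E → E → ℝ} {T : E → E → E → ℝ} {M : ℝ}
    (hQadd : ∀ x y u, Q (x + y) u = Q x u + Q y u) (hQsmul : ∀ (c : ℝ) x u, Q (c • x) u = c * Q x u)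
    (hQcomm : ∀ x y, Q x y = Q y x) (hQpos : ∀ x, x ≠ 0 → 0 < Q x x)
    (hTadd : ∀ x y u v, T (x + y) u v = T x u v + T y u v)
    (hTsmul : ∀ (c : ℝ) x u v, T (c • x) u v = c * T x u v)
    (hTleft : ∀ x y z, T x y z = T y x z) (hTright : ∀ x y z, T x y z = T x z y)
    (hM : 0 ≤ M) (hT : ∀ u, |T u u u| ≤ M * √(Q u u) ^ 3) (w v : E) :
    |T w v v| ≤ M * √(Q w w) * Q v v := by
  have hQ0 : ∀ u, Q 0 u = 0 := fun u => by simpa using hQsmul 0 0 u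
  have hT0 : ∀ u v, T 0 u v = 0 := fun u v => by simpa using hTsmul 0 0 u v
  have hQnn : ∀ x, 0 ≤ Q x x := fun x => by
    rcases eq_or_ne x 0 with rfl | hx
    · rw [hQ0]
    · exact (hQpos x hx).le
  -- the case of unit vectors
  have unit : ∀ w v, Q w w = 1 → Q v v = 1 → |T w v v| ≤ M := by
    intro w v hw hv
    set c := Q v w with hc
    -- `w = c • v + s • e` with `e` orthogonal to `v`, which reduces the claim to a binary form
    set z := w + (-c) • v with hz
    set s := √(Q z z) with hs
    set e := s⁻¹ • z with he
    have hQadd' : ∀ x y u, Q u (x + y) = Q u x + Q u y := fun x y u => by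
      rw [hQcomm, hQadd, hQcomm x, hQcomm y]
    have hQsmul' : ∀ (c : ℝ) x u, Q u (c • x) = c * Q u x := fun c x u => by
      rw [hQcomm, hQsmul, hQcomm x]
    have hzz : Q z z = 1 - c ^ 2 := by
      simp only [hz, hQadd, hQadd', hQsmul, hQsmul', hw, hv, hQcomm w v, ← hc]; ring
    have hvz : Q v z = 0 := by
      simp only [hz, hQadd', hQsmul', hv, ← hc]; ring
    have hss : s ^ 2 = Q z z := Real.sq_sqrt (hQnn z)
    have hve : Q v e = 0 := by rw [he, hQsmul', hvz, mul_zero]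
    have hee : Q e e ≤ 1 := by
      rw [he, hQsmul, hQsmul', ← hss]
      rcases eq_or_ne s 0 with h0 | h0
      · rw [h0]; norm_num
      · exact le_of_eq (by field_simp)
    have hse : s • e = z := by
      rcases eq_or_ne s 0 with h0 | h0
      · have : z = 0 := by
          by_contra hne
          have := hQpos z hne
          rw [← hss, h0] at this; norm_num at this
        rw [h0, this, zero_smul]
      · rw [he, smul_smul, mul_inv_cancel₀ h0, one_smul]
    have hwe : w = c • v + s • e := by
      rw [hse, hz, neg_smul]; abel
    have hTadd2 : ∀ x y u v, T u (x + y) v = T u x v + T u y v := fun x y u v => by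
      rw [hTleft, hTadd, hTleft x, hTleft y]
    have hTsmul2 : ∀ (c : ℝ) x u v, T u (c • x) v = c * T u x v := fun c x u v => by
      rw [hTleft, hTsmul, hTleft x]
    have hTadd3 : ∀ x y u v, T u v (x + y) = T u v x + T u v y := fun x y u v => by
      rw [hTright, hTadd2, hTright u x, hTright u y]
    have hTsmul3 : ∀ (c : ℝ) x u v, T u v (c • x) = c * T u v x := fun c x u v => by
      rw [hTright, hTsmul2, hTright u x]
    have hcs : c ^ 2 + s ^ 2 = 1 := by rw [hss, hzz]; ring
    have main := abs_cubic_polar_le (A := T v v v) (B := T e v v) (C := T e e v) (D := T e e e)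
      (M := M) (fun a b hab => ?_) hcs
    · rw [hwe, hTadd, hTsmul, hTsmul]; exact main
    · have h1 := hT (a • v + b • e)
      have h2 : Q (a • v + b • e) (a • v + b • e) ≤ 1 := by
        simp only [hQadd, hQadd', hQsmul, hQsmul', hv, hQcomm e v, hve]
        nlinarith [mul_le_mul_of_nonneg_left hee (sq_nonneg b)]
      have h3 : √(Q (a • v + b • e) (a • v + b • e)) ^ 3 ≤ 1 :=
        pow_le_one₀ (Real.sqrt_nonneg _) (Real.sqrt_le_one.2 h2)
      have h4 : T (a • v + b • e) (a • v + b • e) (a • v + b • e) =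
          a ^ 3 * T v v v + 3 * a ^ 2 * b * T e v v + 3 * a * b ^ 2 * T e e v +
            b ^ 3 * T e e e := by
        simp only [hTadd, hTadd2, hTadd3, hTsmul, hTsmul2, hTsmul3]
        rw [hTleft v e v, hTright v v e, hTleft v e v, hTright e v e, hTleft v e e,
          hTright e v e]
        ring
      rw [h4] at h1
      exact h1.trans (mul_le_of_le_one_right hM h3)
  rcases eq_or_ne w 0 with rfl | hw
  · rw [hT0, abs_zero]; have := hQnn v; positivity
  rcases eq_or_ne v 0 with rfl | hv
  · rw [hTleft, hT0, abs_zero]; have := hQnn 0; positivity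
  have hw' := hQpos w hw
  have hv' := hQpos v hv
  set p := √(Q w w) with hp
  set q := √(Q v v) with hq
  have hp0 : 0 < p := Real.sqrt_pos.2 hw'
  have hq0 : 0 < q := Real.sqrt_pos.2 hv'
  have hpp : p ^ 2 = Q w w := Real.sq_sqrt hw'.le
  have hqq : q ^ 2 = Q v v := Real.sq_sqrt hv'.le
  have h := unit (p⁻¹ • w) (q⁻¹ • v)
    (by rw [hQsmul, hQcomm, hQsmul, ← hpp]; field_simp)
    (by rw [hQsmul, hQcomm, hQsmul, ← hqq]; field_simp)
  rw [hTsmul, hTleft, hTsmul, hTleft, hTright, hTleft, hTsmul, hTleft] at h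
  have h5 : p⁻¹ * (q⁻¹ * (q⁻¹ * T w v v)) = T w v v / (p * q ^ 2) := by field_simp
  rw [h5, abs_div, abs_of_pos (by positivity : 0 < p * q ^ 2), div_le_iff₀ (by positivity)] at h
  rw [← hqq]; linarith

/-! ### First-order characterization of convexity -/

section FirstOrder

variable {E : Type*} [NormedAddCommGroup E] [NormedSpace ℝ E] {U : Set E} {φ : E → ℝ}

theorem ConvexOn.add_fderiv_le (hφ : ConvexOn ℝ U φ) {x y : E} (hx : x ∈ U) (hy : y ∈ U)
    (hd : DifferentiableAt ℝ φ x) : φ x + fderiv ℝ φ x (y - x) ≤ φ y := by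
  have hg : ConvexOn ℝ (Set.Icc 0 1) (fun t : ℝ => φ (x + t • (y - x))) := by
    refine ⟨convex_Icc 0 1, fun s hs t ht a b ha hb hab => ?_⟩
    have hm : ∀ t ∈ Set.Icc (0 : ℝ) 1, x + t • (y - x) ∈ U := fun t ht =>
      hφ.1.add_smul_sub_mem hx hy ht
    have h := hφ.2 (hm s hs) (hm t ht) ha hb hab
    refine le_trans (le_of_eq (congrArg φ ?_)) h
    obtain rfl : b = 1 - a := by linarith
    simp only [smul_eq_mul]; module
  have h0 : HasDerivAt (fun t : ℝ => φ (x + t • (y - x))) (fderiv ℝ φ x (y - x)) 0 := by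
    have := hasDerivAt_line (φ := φ) (x := x) (w := y - x) (t := 0) (by simpa using hd)
    simpa using this
  have h1 := hg.le_slope_of_hasDerivAt (x := 0) (y := 1) (by simp) (by simp) one_pos h0
  simp only [slope_def_field, one_smul, zero_smul, add_zero, sub_zero, div_one] at h1
  rw [add_sub_cancel] at h1
  linarith

theorem ConvexOn.fderiv_monotone (hφ : ConvexOn ℝ U φ) {x y : E} (hx : x ∈ U) (hy : y ∈ U)
    (hdx : DifferentiableAt ℝ φ x) (hdy : DifferentiableAt ℝ φ y) :
    fderiv ℝ φ x (y - x) ≤ fderiv ℝ φ y (y - x) := by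
  have h1 := hφ.add_fderiv_le hx hy hdx
  have h2 := hφ.add_fderiv_le hy hx hdy
  rw [show x - y = -(y - x) by abel, map_neg] at h2
  linarith

theorem StrictConvexOn.add_fderiv_lt (hφ : StrictConvexOn ℝ U φ) {x y : E} (hx : x ∈ U)
    (hy : y ∈ U) (hxy : x ≠ y) (hd : DifferentiableAt ℝ φ x) :
    φ x + fderiv ℝ φ x (y - x) < φ y := by
  have hm : (1 / 2 : ℝ) • x + (1 / 2 : ℝ) • y ∈ U :=
    hφ.1 hx hy (by norm_num) (by norm_num) (by norm_num)
  have h1 := hφ.2 hx hy hxy (by norm_num : (0 : ℝ) < 1 / 2)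
    (by norm_num : (0 : ℝ) < 1 / 2) (by norm_num)
  have h2 := hφ.convexOn.add_fderiv_le hx hm hd
  rw [show (1 / 2 : ℝ) • x + (1 / 2 : ℝ) • y - x = (1 / 2 : ℝ) • (y - x) by module, map_smul] at h2
  simp only [smul_eq_mul] at h1 h2
  linarith

theorem StrictConvexOn.fderiv_strictMonotone (hφ : StrictConvexOn ℝ U φ) {x y : E} (hx : x ∈ U)
    (hy : y ∈ U) (hxy : x ≠ y) (hdx : DifferentiableAt ℝ φ x) (hdy : DifferentiableAt ℝ φ y) :
    fderiv ℝ φ x (y - x) < fderiv ℝ φ y (y - x) := by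
  have h1 := hφ.add_fderiv_lt hx hy hxy hdx
  have h2 := hφ.add_fderiv_lt hy hx hxy.symm hdy
  rw [show x - y = -(y - x) by abel, map_neg] at h2
  linarith

theorem le_of_hasDerivAt_nonneg {F F' : ℝ → ℝ} {a b : ℝ} (hab : a ≤ b)
    (h : ∀ t ∈ Set.Icc a b, HasDerivAt F (F' t) t) (h0 : ∀ t ∈ Set.Icc a b, 0 ≤ F' t) :
    F a ≤ F b := by
  have hm : MonotoneOn F (Set.Icc a b) := by
    refine monotoneOn_of_deriv_nonneg (convex_Icc a b)
      (fun t ht => (h t ht).continuousAt.continuousWithinAt) (fun t ht => ?_) (fun t ht => ?_)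
    · exact (h t (interior_subset ht)).differentiableAt.differentiableWithinAt
    · rw [(h t (interior_subset ht)).deriv]; exact h0 t (interior_subset ht)
  exact hm (Set.left_mem_Icc.2 hab) (Set.right_mem_Icc.2 hab) hab

end FirstOrder

/-! ### Self-concordant functions on open convex sets -/

/-- A strictly convex, three times differentiable function on an open convex set, with
`|D³φ(x)[u,u,u]| ≤ 2 α (D²φ(x)[u,u]) ^ (3/2)`. -/
structure SelfConcordantOn {E : Type*} [NormedAddCommGroup E] [NormedSpace ℝ E] (U : Set E)
    (φ : E → ℝ) (α : ℝ) : Prop where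
  isOpen : IsOpen U
  nonneg : 0 ≤ α
  diff : ∀ k < 3, DifferentiableOn ℝ (iteratedFDeriv ℝ k φ) U
  strictConvex : StrictConvexOn ℝ U φ
  bound : ∀ x ∈ U, ∀ u : E, |iteratedFDeriv ℝ 3 φ x ![u, u, u]| ≤
    2 * α * √(iteratedFDeriv ℝ 2 φ x ![u, u]) ^ 3

namespace SelfConcordantOn

variable {E : Type*} [NormedAddCommGroup E] [NormedSpace ℝ E] {U : Set E} {φ : E → ℝ} {α : ℝ}

theorem differentiableAt (h : SelfConcordantOn U φ α) {x : E} (hx : x ∈ U) :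
    DifferentiableAt ℝ φ x :=
  ((contDiffOn_two_of_differentiableOn_iteratedFDeriv h.isOpen h.diff).contDiffAt
    (h.isOpen.mem_nhds hx)).differentiableAt (by norm_num)

theorem eventually_line_mem (h : SelfConcordantOn U φ α) {x : E} (hx : x ∈ U) (u : E) :
    ∃ δ > 0, ∀ t ∈ Set.Icc (0 : ℝ) δ, x + t • u ∈ U := by
  have hc : ContinuousAt (fun t : ℝ => x + t • u) 0 := by fun_prop
  have h0 : ∀ᶠ t : ℝ in 𝓝 0, x + t • u ∈ U :=
    hc.eventually (by simpa using h.isOpen.mem_nhds hx)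
  obtain ⟨ε, hε, hball⟩ := Metric.eventually_nhds_iff.1 h0
  refine ⟨ε / 2, by positivity, fun t ht => hball ?_⟩
  rw [Real.dist_eq, sub_zero, abs_of_nonneg ht.1]
  linarith [ht.2]

theorem hess_nonneg (h : SelfConcordantOn U φ α) {x : E} (hx : x ∈ U) (u : E) :
    0 ≤ iteratedFDeriv ℝ 2 φ x ![u, u] := by
  obtain ⟨δ, hδ, hmem⟩ := h.eventually_line_mem hx u
  have hd := hasDerivAt_fderiv_line h.isOpen h.diff (x := x) (w := u) (t := 0)
    (by simpa using hx) u
  simp only [zero_smul, add_zero] at hd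
  have hs : Tendsto (slope (fun s : ℝ => fderiv ℝ φ (x + s • u) u) 0) (𝓝[>] 0)
      (𝓝 (iteratedFDeriv ℝ 2 φ x ![u, u])) :=
    (hasDerivAt_iff_tendsto_slope.1 hd).mono_left
      (nhdsWithin_mono _ fun t (ht : 0 < t) => ne_of_gt ht)
  refine ge_of_tendsto hs ?_
  filter_upwards [Ioc_mem_nhdsGT hδ] with t ht
  have hy := hmem t ⟨ht.1.le, ht.2⟩
  have hm := h.strictConvex.convexOn.fderiv_monotone hx hy (h.differentiableAt hx)
    (h.differentiableAt hy)
  simp only [add_sub_cancel_left, map_smul, smul_eq_mul] at hm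
  rw [slope_def_field]
  simp only [zero_smul, add_zero, sub_zero]
  exact div_nonneg (sub_nonneg.2 (le_of_mul_le_mul_left hm ht.1)) ht.1.le

/-- The Hessian of a self-concordant function is positive definite: a zero of `D²φ[u,u]` spreads
along the line in direction `u` by Grönwall's inequality, against strict convexity. -/
theorem hess_pos (h : SelfConcordantOn U φ α) {x : E} (hx : x ∈ U) {u : E} (hu : u ≠ 0) :
    0 < iteratedFDeriv ℝ 2 φ x ![u, u] := by
  refine lt_of_le_of_ne (h.hess_nonneg hx u) fun hzero => ?_
  obtain ⟨δ, hδ, hmem⟩ := h.eventually_line_mem hx u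
  set p : ℝ → ℝ := fun t => iteratedFDeriv ℝ 2 φ (x + t • u) ![u, u] with hp
  have hpd : ∀ t ∈ Set.Icc 0 δ, HasDerivAt p (iteratedFDeriv ℝ 3 φ (x + t • u) ![u, u, u]) t :=
    fun t ht => hasDerivAt_iteratedFDeriv_two_line h.isOpen h.diff (hmem t ht) u u
  have hpc : ContinuousOn p (Set.Icc 0 δ) := fun t ht => (hpd t ht).continuousAt.continuousWithinAt
  obtain ⟨C, hC⟩ := isCompact_Icc.exists_bound_of_continuousOn
    (f := fun t => 2 * α * √(p t)) (s := Set.Icc 0 δ) (by fun_prop)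
  have hp0 : ∀ t ∈ Set.Icc 0 δ, p t = 0 := by
    refine eq_zero_of_abs_deriv_le_mul_abs_self_of_eq_zero_right (K := C) hpc
      (fun t ht => (hpd t (Set.Ico_subset_Icc_self ht)).hasDerivWithinAt) ?_ fun t ht => ?_
    · simp [hp, ← hzero]
    · have ht' := Set.Ico_subset_Icc_self ht
      have h1 := h.bound _ (hmem t ht') u
      have h2 := hC t ht'
      have h3 : 0 ≤ p t := h.hess_nonneg (hmem t ht') u
      have h4 : √(p t) ^ 3 = √(p t) * p t := by
        rw [pow_succ', Real.sq_sqrt h3]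
      rw [Real.norm_eq_abs, Real.norm_eq_abs, abs_of_nonneg h3]
      refine h1.trans ?_
      change 2 * α * √(p t) ^ 3 ≤ _
      rw [h4, ← mul_assoc]
      exact mul_le_mul_of_nonneg_right ((le_abs_self _).trans h2) h3
  have hδ' : δ ∈ Set.Icc 0 δ := ⟨hδ.le, le_rfl⟩
  have hne : x ≠ x + δ • u := by
    simp [hδ.ne', hu]
  have hm := h.strictConvex.fderiv_strictMonotone hx (hmem δ hδ') hne (h.differentiableAt hx)
    (h.differentiableAt (hmem δ hδ'))
  simp only [add_sub_cancel_left, map_smul, smul_eq_mul] at hm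
  have hm' := lt_of_mul_lt_mul_left hm hδ.le
  have hmono := le_of_hasDerivAt_nonneg (F := fun t => -(fderiv ℝ φ (x + t • u) u))
    (F' := fun t => -(p t)) hδ.le
    (fun t ht => (hasDerivAt_fderiv_line h.isOpen h.diff (hmem t ht) u).neg)
    (fun t ht => by simp [hp0 t ht])
  simp only [zero_smul, add_zero] at hmono
  linarith

/-- `|D³φ(x)[w,v,v]| ≤ 2 α ‖w‖ ‖v‖²` in the norm of `D²φ(x)`. -/
theorem abs_third_le (h : SelfConcordantOn U φ α) {x : E} (hx : x ∈ U) (w v : E) :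
    |iteratedFDeriv ℝ 3 φ x ![w, v, v]| ≤
      2 * α * √(iteratedFDeriv ℝ 2 φ x ![w, w]) * iteratedFDeriv ℝ 2 φ x ![v, v] := by
  refine abs_trilinear_le (Q := fun u v => iteratedFDeriv ℝ 2 φ x ![u, v])
    (T := fun w u v => iteratedFDeriv ℝ 3 φ x ![w, u, v])
    (fun a b u => (iteratedFDeriv ℝ 2 φ x).cons_add ![u] a b)
    (fun c a u => (iteratedFDeriv ℝ 2 φ x).cons_smul ![u] c a)
    (fun a b => iteratedFDeriv_two_comm h.isOpen h.diff hx a b)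
    (fun a ha => h.hess_pos hx ha)
    (fun a b u v => (iteratedFDeriv ℝ 3 φ x).cons_add ![u, v] a b)
    (fun c a u v => (iteratedFDeriv ℝ 3 φ x).cons_smul ![u, v] c a)
    (fun a b c => iteratedFDeriv_three_comm_left h.isOpen h.diff hx a b c)
    (fun a b c => iteratedFDeriv_three_comm_right h.isOpen h.diff hx a b c)
    (by have := h.nonneg; positivity) (h.bound x hx) w v

theorem hess_cauchySchwarz (h : SelfConcordantOn U φ α) {x : E} (hx : x ∈ U) (w v : E) :
    |iteratedFDeriv ℝ 2 φ x ![w, v]| ≤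
      √(iteratedFDeriv ℝ 2 φ x ![w, w]) * √(iteratedFDeriv ℝ 2 φ x ![v, v]) := by
  set Q : E → E → ℝ := fun u v => iteratedFDeriv ℝ 2 φ x ![u, v] with hQ
  have hadd : ∀ a b u, Q (a + b) u = Q a u + Q b u :=
    fun a b u => (iteratedFDeriv ℝ 2 φ x).cons_add ![u] a b
  have hsmul : ∀ (c : ℝ) a u, Q (c • a) u = c * Q a u :=
    fun c a u => (iteratedFDeriv ℝ 2 φ x).cons_smul ![u] c a
  have hcomm : ∀ a b, Q a b = Q b a := iteratedFDeriv_two_comm h.isOpen h.diff hx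
  have hnn : ∀ a, 0 ≤ Q a a := h.hess_nonneg hx
  change |Q w v| ≤ √(Q w w) * √(Q v v)
  rw [← Real.sqrt_mul (hnn w)]
  refine Real.abs_le_sqrt ?_
  rcases eq_or_ne v 0 with rfl | hv
  · have : Q w 0 = 0 := by rw [hcomm]; simpa using hsmul 0 0 w
    rw [this]; nlinarith [mul_nonneg (hnn w) (hnn 0)]
  have hvv : 0 < Q v v := h.hess_pos hx hv
  have h1 := hnn (Q v v • w + (-(Q w v)) • v)
  rw [hadd, hsmul, hsmul, hcomm w, hcomm v (_ + _), hadd, hadd, hsmul, hsmul, hsmul, hsmul,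
    hcomm v w] at h1
  have h2 : 0 ≤ Q v v * (Q w w * Q v v - Q w v ^ 2) := by nlinarith
  nlinarith [nonneg_of_mul_nonneg_right h2 hvv]

end SelfConcordantOn

/-- The local norm `√(D²φ(x)[u,u])`. -/
noncomputable def hessNorm {E : Type*} [NormedAddCommGroup E] [NormedSpace ℝ E] (φ : E → ℝ)
    (x u : E) : ℝ :=
  √(iteratedFDeriv ℝ 2 φ x ![u, u])

theorem hessNorm_nonneg {E : Type*} [NormedAddCommGroup E] [NormedSpace ℝ E] (φ : E → ℝ)
    (x u : E) : 0 ≤ hessNorm φ x u :=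
  Real.sqrt_nonneg _

theorem hessNorm_zero {E : Type*} [NormedAddCommGroup E] [NormedSpace ℝ E] (φ : E → ℝ) (x : E) :
    hessNorm φ x 0 = 0 := by
  have := (iteratedFDeriv ℝ 2 φ x).map_coord_zero (m := ![0, 0]) 0 rfl
  rw [hessNorm, this, Real.sqrt_zero]

/-- If `|F'| ≤ G'` on an interval, the increments of `F` are bounded by those of `G`. -/
theorem abs_sub_le_of_hasDerivAt {F F' G G' : ℝ → ℝ} {a b : ℝ} (hab : a ≤ b)
    (hF : ∀ t ∈ Set.Icc a b, HasDerivAt F (F' t) t) (hG : ∀ t ∈ Set.Icc a b, HasDerivAt G (G' t) t)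
    (h : ∀ t ∈ Set.Icc a b, |F' t| ≤ G' t) : |F b - F a| ≤ G b - G a := by
  have h1 := le_of_hasDerivAt_nonneg (F := fun t => G t - F t) hab
    (fun t ht => (hG t ht).sub (hF t ht)) fun t ht => by linarith [(abs_le.1 (h t ht)).2]
  have h2 := le_of_hasDerivAt_nonneg (F := fun t => G t + F t) hab
    (fun t ht => (hG t ht).add (hF t ht)) fun t ht => by linarith [(abs_le.1 (h t ht)).1]
  rw [abs_le]
  constructor <;> linarith

theorem hasDerivAt_div_one_sub_mul {s t : ℝ} (h : 1 - s * t ≠ 0) :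
    HasDerivAt (fun t : ℝ => t / (1 - s * t)) (1 / (1 - s * t) ^ 2) t := by
  have h1 : HasDerivAt (fun t : ℝ => 1 - s * t) (-s) t := by
    simpa using ((hasDerivAt_id t).const_mul s).const_sub 1
  refine ((hasDerivAt_id t).div h1 h).congr_deriv ?_
  simp only [id]
  congr 1
  ring

namespace SelfConcordantOn

variable {E : Type*} [NormedAddCommGroup E] [NormedSpace ℝ E] {U : Set E} {φ : E → ℝ} {α : ℝ}

theorem hessNorm_sq (h : SelfConcordantOn U φ α) {x : E} (hx : x ∈ U) (u : E) :
    hessNorm φ x u ^ 2 = iteratedFDeriv ℝ 2 φ x ![u, u] :=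
  Real.sq_sqrt (h.hess_nonneg hx u)

theorem hessNorm_pos (h : SelfConcordantOn U φ α) {x : E} (hx : x ∈ U) {u : E} (hu : u ≠ 0) :
    0 < hessNorm φ x u :=
  Real.sqrt_pos.2 (h.hess_pos hx hu)

theorem line_mem (h : SelfConcordantOn U φ α) {x w : E} (hx : x ∈ U) (hw : x + w ∈ U) {t : ℝ}
    (ht : t ∈ Set.Icc (0 : ℝ) 1) : x + t • w ∈ U := by
  have := h.strictConvex.1.add_smul_sub_mem hx hw ht
  rwa [add_sub_cancel_left] at this

/-- Along a segment in direction `w`, the function `t ↦ 1 / ‖w‖` is `α`-Lipschitz in the local norm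
at the moving point. -/
theorem abs_inv_hessNorm_line_le (h : SelfConcordantOn U φ α) {x w : E} (hx : x ∈ U)
    (hxw : x + w ∈ U) (hw : w ≠ 0) {t : ℝ} (ht : t ∈ Set.Icc (0 : ℝ) 1) :
    |(hessNorm φ (x + t • w) w)⁻¹ - (hessNorm φ x w)⁻¹| ≤ α * t := by
  have hsub : ∀ s ∈ Set.Icc 0 t, s ∈ Set.Icc (0 : ℝ) 1 := fun s hs => ⟨hs.1, hs.2.trans ht.2⟩
  have key := abs_sub_le_of_hasDerivAt (F := fun s => (hessNorm φ (x + s • w) w)⁻¹)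
    (F' := fun s => -(iteratedFDeriv ℝ 3 φ (x + s • w) ![w, w, w] / (2 * hessNorm φ (x + s • w) w))
      / hessNorm φ (x + s • w) w ^ 2) (G := fun s => α * s) (G' := fun _ => α) ht.1
    (fun s hs => ?_) (fun s _ => by simpa using (hasDerivAt_id s).const_mul α) fun s hs => ?_
  · simpa using key
  · have hm := h.line_mem hx hxw (hsub s hs)
    exact ((hasDerivAt_iteratedFDeriv_two_line h.isOpen h.diff hm w w).sqrt
      (h.hess_pos hm hw).ne').inv (h.hessNorm_pos hm hw).ne'
  · have hm := h.line_mem hx hxw (hsub s hs)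
    have hp := h.hessNorm_pos hm hw
    have hb := h.bound _ hm w
    change |_| ≤ 2 * α * hessNorm φ (x + s • w) w ^ 3 at hb
    rw [abs_div, abs_neg, abs_div, abs_of_pos (pow_pos hp 2), abs_of_pos (mul_pos two_pos hp),
      div_div, div_le_iff₀ (by positivity)]
    linarith

theorem hessNorm_line_le (h : SelfConcordantOn U φ α) {x w : E} (hx : x ∈ U)
    (hxw : x + w ∈ U) {t : ℝ} (ht : t ∈ Set.Icc (0 : ℝ) 1) (hs : α * hessNorm φ x w < 1) :
    hessNorm φ (x + t • w) w ≤ hessNorm φ x w / (1 - α * hessNorm φ x w * t) := by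
  rcases eq_or_ne w 0 with rfl | hw
  · rw [smul_zero, add_zero, hessNorm_zero, zero_div]
  have hr := h.hessNorm_pos hx hw
  have hp := h.hessNorm_pos (h.line_mem hx hxw ht) hw
  have hα := h.nonneg
  have h1 := (abs_le.1 (h.abs_inv_hessNorm_line_le hx hxw hw ht)).1
  have h2 : 0 < 1 - α * hessNorm φ x w * t := by
    nlinarith [mul_nonneg (mul_nonneg hα hr.le) (sub_nonneg.2 ht.2), ht.1]
  rw [le_div_iff₀ h2]
  have h3 : (hessNorm φ x w)⁻¹ - α * t ≤ (hessNorm φ (x + t • w) w)⁻¹ := by linarith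
  have h4 := mul_le_mul_of_nonneg_left h3 (mul_pos hr hp).le
  have e1 : hessNorm φ x w * (hessNorm φ x w)⁻¹ = 1 := mul_inv_cancel₀ hr.ne'
  have e2 : hessNorm φ (x + t • w) w * (hessNorm φ (x + t • w) w)⁻¹ = 1 := mul_inv_cancel₀ hp.ne'
  calc _ = hessNorm φ x w * hessNorm φ (x + t • w) w * ((hessNorm φ x w)⁻¹ - α * t) := by
        linear_combination (-hessNorm φ (x + t • w) w) * e1
    _ ≤ _ := h4
    _ = _ := by linear_combination (hessNorm φ x w) * e2

theorem le_hessNorm_line (h : SelfConcordantOn U φ α) {x w : E} (hx : x ∈ U)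
    (hxw : x + w ∈ U) {t : ℝ} (ht : t ∈ Set.Icc (0 : ℝ) 1) :
    hessNorm φ x w / (1 + α * hessNorm φ x w * t) ≤ hessNorm φ (x + t • w) w := by
  rcases eq_or_ne w 0 with rfl | hw
  · rw [smul_zero, add_zero, hessNorm_zero, zero_div]
  have hr := h.hessNorm_pos hx hw
  have hp := h.hessNorm_pos (h.line_mem hx hxw ht) hw
  have hα := h.nonneg
  have h1 := (abs_le.1 (h.abs_inv_hessNorm_line_le hx hxw hw ht)).2
  have ht0 := ht.1
  rw [div_le_iff₀ (by positivity)]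
  have h3 : (hessNorm φ (x + t • w) w)⁻¹ ≤ (hessNorm φ x w)⁻¹ + α * t := by linarith
  have h4 := mul_le_mul_of_nonneg_left h3 (mul_pos hr hp).le
  have e1 : hessNorm φ x w * (hessNorm φ x w)⁻¹ = 1 := mul_inv_cancel₀ hr.ne'
  have e2 : hessNorm φ (x + t • w) w * (hessNorm φ (x + t • w) w)⁻¹ = 1 := mul_inv_cancel₀ hp.ne'
  calc _ = hessNorm φ x w * hessNorm φ (x + t • w) w * (hessNorm φ (x + t • w) w)⁻¹ := by
        linear_combination (-hessNorm φ x w) * e2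
    _ ≤ _ := h4
    _ = _ := by linear_combination (hessNorm φ (x + t • w) w) * e1

/-- Comparison of Hessians at two points of a segment, in the multiplicative form. -/
theorem hess_line_compare (h : SelfConcordantOn U φ α) {x w : E} (hx : x ∈ U)
    (hxw : x + w ∈ U) {t : ℝ} (ht : t ∈ Set.Icc (0 : ℝ) 1) (hs : α * hessNorm φ x w < 1) (v : E) :
    (1 - α * hessNorm φ x w * t) ^ 2 * iteratedFDeriv ℝ 2 φ x ![v, v] ≤
        iteratedFDeriv ℝ 2 φ (x + t • w) ![v, v] ∧
      (1 - α * hessNorm φ x w * t) ^ 2 * iteratedFDeriv ℝ 2 φ (x + t • w) ![v, v] ≤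
        iteratedFDeriv ℝ 2 φ x ![v, v] := by
  have hα := h.nonneg
  have hr := hessNorm_nonneg φ x w
  set r := hessNorm φ x w with hr'
  have hsub : ∀ s ∈ Set.Icc 0 t, s ∈ Set.Icc (0 : ℝ) 1 := fun s hs => ⟨hs.1, hs.2.trans ht.2⟩
  have hpos : ∀ s ∈ Set.Icc (0 : ℝ) 1, 0 < 1 - α * r * s := fun s hs' => by
    nlinarith [mul_nonneg (mul_nonneg hα hr) (sub_nonneg.2 hs'.2), hs'.1]
  have hq : ∀ s ∈ Set.Icc 0 t, HasDerivAt (fun s => iteratedFDeriv ℝ 2 φ (x + s • w) ![v, v])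
      (iteratedFDeriv ℝ 3 φ (x + s • w) ![w, v, v]) s := fun s hs' =>
    hasDerivAt_iteratedFDeriv_two_line h.isOpen h.diff (h.line_mem hx hxw (hsub s hs')) v v
  have hl : ∀ s : ℝ, HasDerivAt (fun s => 1 - α * r * s) (-(α * r)) s := fun s => by
    simpa using ((hasDerivAt_id s).const_mul (α * r)).const_sub 1
  have hb : ∀ s ∈ Set.Icc 0 t, |iteratedFDeriv ℝ 3 φ (x + s • w) ![w, v, v]| * (1 - α * r * s) ≤
      2 * (α * r) * iteratedFDeriv ℝ 2 φ (x + s • w) ![v, v] := fun s hs' => by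
    have hm := h.line_mem hx hxw (hsub s hs')
    have h1 := h.abs_third_le hm w v
    have h2 := h.hessNorm_line_le hx hxw (hsub s hs') hs
    have h3 := h.hess_nonneg hm v
    rw [le_div_iff₀ (hpos s (hsub s hs'))] at h2
    change _ ≤ 2 * α * hessNorm φ (x + s • w) w * _ at h1
    calc _ ≤ 2 * α * hessNorm φ (x + s • w) w * iteratedFDeriv ℝ 2 φ (x + s • w) ![v, v] *
          (1 - α * r * s) := mul_le_mul_of_nonneg_right h1 (hpos s (hsub s hs')).le
      _ = 2 * α * iteratedFDeriv ℝ 2 φ (x + s • w) ![v, v] *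
          (hessNorm φ (x + s • w) w * (1 - α * r * s)) := by ring
      _ ≤ 2 * α * iteratedFDeriv ℝ 2 φ (x + s • w) ![v, v] * r :=
          mul_le_mul_of_nonneg_left h2 (by positivity)
      _ = _ := by ring
  constructor
  · have hne := (hpos t ht).ne'
    have key := le_of_hasDerivAt_nonneg
      (F := fun s => iteratedFDeriv ℝ 2 φ (x + s • w) ![v, v] / (1 - α * r * s) ^ 2) ht.1
      (fun s hs' => (hq s hs').div ((hl s).pow 2) (pow_ne_zero 2 (hpos s (hsub s hs')).ne'))
      fun s hs' => by
        have h1 := (abs_le.1 (le_refl |iteratedFDeriv ℝ 3 φ (x + s • w) ![w, v, v]|)).1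
        have h2 := hb s hs'
        have h3 := hpos s (hsub s hs')
        refine div_nonneg ?_ (by positivity)
        norm_num
        nlinarith [mul_le_mul_of_nonneg_right h1 h3.le]
    simp only [zero_smul, add_zero, mul_zero, sub_zero, one_pow, div_one] at key
    rw [le_div_iff₀ (pow_pos (hpos t ht) 2)] at key
    linarith
  · have key := le_of_hasDerivAt_nonneg
      (F := fun s => -(iteratedFDeriv ℝ 2 φ (x + s • w) ![v, v] * (1 - α * r * s) ^ 2)) ht.1
      (fun s hs' => ((hq s hs').mul ((hl s).pow 2)).neg)
      fun s hs' => by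
        have h1 := le_abs_self (iteratedFDeriv ℝ 3 φ (x + s • w) ![w, v, v])
        have h2 := hb s hs'
        have h3 := hpos s (hsub s hs')
        norm_num
        nlinarith [mul_le_mul_of_nonneg_right h1 h3.le]
    simp only [zero_smul, add_zero, mul_zero, sub_zero, one_pow, mul_one] at key
    linarith

theorem hessNorm_line_le_div (h : SelfConcordantOn U φ α) {x w : E} (hx : x ∈ U)
    (hxw : x + w ∈ U) {t : ℝ} (ht : t ∈ Set.Icc (0 : ℝ) 1) (hs : α * hessNorm φ x w < 1) (v : E) :
    hessNorm φ (x + t • w) v ≤ hessNorm φ x v / (1 - α * hessNorm φ x w * t) := by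
  have hα := h.nonneg
  have hr := hessNorm_nonneg φ x w
  have hpos : 0 < 1 - α * hessNorm φ x w * t := by
    nlinarith [mul_nonneg (mul_nonneg hα hr) (sub_nonneg.2 ht.2), ht.1]
  have h1 := (h.hess_line_compare hx hxw ht hs v).2
  rw [← h.hessNorm_sq hx, ← h.hessNorm_sq (h.line_mem hx hxw ht), ← mul_pow] at h1
  rw [le_div_iff₀ hpos, mul_comm]
  exact le_of_sq_le_sq h1 (hessNorm_nonneg _ _ _)

theorem abs_fderiv_sub_le (h : SelfConcordantOn U φ α) {x w : E} (hx : x ∈ U)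
    (hxw : x + w ∈ U) (hs : α * hessNorm φ x w < 1) (v : E) :
    |fderiv ℝ φ (x + w) v - fderiv ℝ φ x v| ≤
      hessNorm φ x w / (1 - α * hessNorm φ x w) * hessNorm φ x v := by
  have hα := h.nonneg
  have hr := hessNorm_nonneg φ x w
  have hpos : ∀ s ∈ Set.Icc (0 : ℝ) 1, 0 < 1 - α * hessNorm φ x w * s := fun s hs' => by
    nlinarith [mul_nonneg (mul_nonneg hα hr) (sub_nonneg.2 hs'.2), hs'.1]
  have key := abs_sub_le_of_hasDerivAt (F := fun t => fderiv ℝ φ (x + t • w) v)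
    (G := fun t => hessNorm φ x w * hessNorm φ x v * (t / (1 - α * hessNorm φ x w * t)))
    zero_le_one
    (fun t ht => hasDerivAt_fderiv_line h.isOpen h.diff (h.line_mem hx hxw ht) v)
    (fun t ht => (hasDerivAt_div_one_sub_mul (hpos t ht).ne').const_mul _) fun t ht => ?_
  · simp only [one_smul, zero_smul, add_zero, mul_one, zero_div, mul_zero, sub_zero] at key
    refine key.trans (le_of_eq (by ring))
  · refine (h.hess_cauchySchwarz (h.line_mem hx hxw ht) w v).trans ?_
    have h1 := h.hessNorm_line_le_div hx hxw ht hs w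
    have h2 := h.hessNorm_line_le_div hx hxw ht hs v
    have h3 := mul_le_mul h1 h2 (hessNorm_nonneg _ _ _) (div_nonneg hr (hpos t ht).le)
    refine h3.trans (le_of_eq ?_)
    have := (hpos t ht).ne'
    field_simp

/-- Second order remainder of the gradient of a self-concordant function. -/
theorem abs_fderiv_sub_sub_le (h : SelfConcordantOn U φ α) {x w : E} (hx : x ∈ U)
    (hxw : x + w ∈ U) (hs : α * hessNorm φ x w < 1) (v : E) :
    |fderiv ℝ φ (x + w) v - fderiv ℝ φ x v - iteratedFDeriv ℝ 2 φ x ![w, v]| ≤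
      2 * α * hessNorm φ x w ^ 2 / (1 - α * hessNorm φ x w) ^ 3 * hessNorm φ x v := by
  have hα := h.nonneg
  have hr := hessNorm_nonneg φ x w
  have hv := hessNorm_nonneg φ x v
  have hs0 : 0 < 1 - α * hessNorm φ x w := by linarith
  have hpos : ∀ s ∈ Set.Icc (0 : ℝ) 1, 1 - α * hessNorm φ x w ≤ 1 - α * hessNorm φ x w * s :=
    fun s hs' => by nlinarith [mul_nonneg (mul_nonneg hα hr) (sub_nonneg.2 hs'.2), hs'.1]
  have hcrude : ∀ t ∈ Set.Icc (0 : ℝ) 1, ∀ v, hessNorm φ (x + t • w) v ≤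
      hessNorm φ x v / (1 - α * hessNorm φ x w) := fun t ht v =>
    (h.hessNorm_line_le_div hx hxw ht hs v).trans
      (div_le_div_of_nonneg_left (hessNorm_nonneg _ _ _) hs0 (hpos t ht))
  set K := 2 * α * hessNorm φ x w ^ 2 / (1 - α * hessNorm φ x w) ^ 3 * hessNorm φ x v with hK
  have hK0 : 0 ≤ K := by positivity
  have third : ∀ t ∈ Set.Icc (0 : ℝ) 1, |iteratedFDeriv ℝ 3 φ (x + t • w) ![w, w, v]| ≤ K := by
    intro t ht
    have hm := h.line_mem hx hxw ht
    rw [iteratedFDeriv_three_comm_right h.isOpen h.diff hm,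
      iteratedFDeriv_three_comm_left h.isOpen h.diff hm]
    refine (h.abs_third_le hm v w).trans ?_
    change 2 * α * hessNorm φ (x + t • w) v * _ ≤ _
    rw [← h.hessNorm_sq hm]
    have h1 := hcrude t ht v
    have h2 := pow_le_pow_left₀ (hessNorm_nonneg _ _ _) (hcrude t ht w) 2
    calc _ = 2 * α * (hessNorm φ (x + t • w) v * hessNorm φ (x + t • w) w ^ 2) := by ring
      _ ≤ 2 * α * (hessNorm φ x v / (1 - α * hessNorm φ x w) *
          (hessNorm φ x w / (1 - α * hessNorm φ x w)) ^ 2) :=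
        mul_le_mul_of_nonneg_left (mul_le_mul h1 h2 (sq_nonneg _) (by positivity)) (by positivity)
      _ = K := by rw [hK]; field_simp
  have second : ∀ t ∈ Set.Icc (0 : ℝ) 1, |iteratedFDeriv ℝ 2 φ (x + t • w) ![w, v] -
      iteratedFDeriv ℝ 2 φ x ![w, v]| ≤ K := by
    intro t ht
    have hsub : ∀ s ∈ Set.Icc 0 t, s ∈ Set.Icc (0 : ℝ) 1 := fun s hs => ⟨hs.1, hs.2.trans ht.2⟩
    have key := abs_sub_le_of_hasDerivAt (F := fun t => iteratedFDeriv ℝ 2 φ (x + t • w) ![w, v])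
      (G := fun t => K * t) (G' := fun _ => K) ht.1
      (fun s hs' => hasDerivAt_iteratedFDeriv_two_line h.isOpen h.diff
        (h.line_mem hx hxw (hsub s hs')) w v)
      (fun s _ => by simpa using (hasDerivAt_id s).const_mul K) fun s hs' => third s (hsub s hs')
    simp only [zero_smul, add_zero, mul_zero, sub_zero] at key
    exact key.trans (mul_le_of_le_one_right hK0 ht.2)
  have key := abs_sub_le_of_hasDerivAt
    (F := fun t => fderiv ℝ φ (x + t • w) v - iteratedFDeriv ℝ 2 φ x ![w, v] * t)
    (G := fun t => K * t) (G' := fun _ => K) zero_le_one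
    (fun t ht => (hasDerivAt_fderiv_line h.isOpen h.diff (h.line_mem hx hxw ht) v).sub
      ((hasDerivAt_id t).const_mul _))
    (fun s _ => by simpa using (hasDerivAt_id s).const_mul K)
    fun t ht => by rw [mul_one]; exact second t ht
  simp only [one_smul, zero_smul, add_zero, mul_one, mul_zero, sub_zero] at key
  rwa [sub_right_comm]

theorem le_fderiv_sub (h : SelfConcordantOn U φ α) {x w : E} (hx : x ∈ U) (hxw : x + w ∈ U) :
    hessNorm φ x w ^ 2 / (1 + α * hessNorm φ x w) ≤ fderiv ℝ φ (x + w) w - fderiv ℝ φ x w := by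
  have hα := h.nonneg
  have hr := hessNorm_nonneg φ x w
  have hpos : ∀ s ∈ Set.Icc (0 : ℝ) 1, 0 < 1 - -(α * hessNorm φ x w) * s := fun s hs' => by
    nlinarith [mul_nonneg (mul_nonneg hα hr) hs'.1]
  have key := le_of_hasDerivAt_nonneg (F := fun t => fderiv ℝ φ (x + t • w) w -
      hessNorm φ x w ^ 2 * (t / (1 - -(α * hessNorm φ x w) * t))) zero_le_one
    (fun t ht => (hasDerivAt_fderiv_line h.isOpen h.diff (h.line_mem hx hxw ht) w).sub
      ((hasDerivAt_div_one_sub_mul (hpos t ht).ne').const_mul _)) fun t ht => ?_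
  · simp only [one_smul, zero_smul, add_zero, mul_one, zero_div, mul_zero, sub_zero,
      sub_neg_eq_add] at key
    rw [mul_one_div] at key
    linarith
  · have h1 := h.le_hessNorm_line hx hxw ht
    have h0 := hpos t ht
    have e : 1 - -(α * hessNorm φ x w) * t = 1 + α * hessNorm φ x w * t := by ring
    rw [e] at h0 ⊢
    have h2 := pow_le_pow_left₀ (div_nonneg hr h0.le) h1 2
    rw [div_pow, h.hessNorm_sq (h.line_mem hx hxw ht)] at h2
    rw [mul_one_div]
    linarith

end SelfConcordantOn

/-! ### Legendre functions: the gradient is a bijection, inverse to the gradient of the conjugate -/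

section Legendre

variable {E : Type*} [NormedAddCommGroup E] [InnerProductSpace ℝ E] [FiniteDimensional ℝ E]
  {K : Set E} {φ : E → ℝ}

/-- Near a boundary point `z` the derivative of a convex function whose gradient blows up at `z`
becomes large in the direction from an interior point to `z`. -/
theorem exists_one_le_fderiv_of_tendsto_gradient (hKc : Convex ℝ K)
    (hφ : ConvexOn ℝ (interior K) φ) (hd : DifferentiableOn ℝ φ (interior K)) {x₀ z : E}
    (hx₀ : x₀ ∈ interior K) (hz : z ∈ closure K)
    (hgrad : Tendsto (fun x => ‖gradient φ x‖) (𝓝[interior K] z) atTop) {m : ℝ}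
    (hm : ∀ x ∈ interior K, m ≤ φ x) :
    ∃ t ∈ Set.Ioo (0 : ℝ) 1, 1 ≤ fderiv ℝ φ (z + t • (x₀ - z)) (z - x₀) := by
  obtain ⟨r, hr, hball⟩ := Metric.nhds_basis_closedBall.mem_iff.1 (isOpen_interior.mem_nhds hx₀)
  obtain ⟨M, hM⟩ := (isCompact_closedBall x₀ r).exists_bound_of_continuousOn
    (hd.continuousOn.mono hball)
  have hmem : ∀ t ∈ Set.Ioc (0 : ℝ) 1, z + t • (x₀ - z) ∈ interior K := fun t ht =>
    hKc.add_smul_sub_mem_interior' hz hx₀ ht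
  have hlim : Tendsto (fun t : ℝ => z + t • (x₀ - z)) (𝓝[>] 0) (𝓝[interior K] z) := by
    refine tendsto_nhdsWithin_iff.2 ⟨?_, ?_⟩
    · have : ContinuousAt (fun t : ℝ => z + t • (x₀ - z)) 0 := by fun_prop
      simpa using this.tendsto.mono_left nhdsWithin_le_nhds
    · filter_upwards [Ioc_mem_nhdsGT one_pos] with t ht using hmem t ht
  obtain ⟨t, ht1, ht⟩ := (((hgrad.comp hlim).eventually_ge_atTop ((M - m + 1) / r)).and
    (Ioo_mem_nhdsGT (one_pos (α := ℝ)))).exists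
  refine ⟨t, ht, ?_⟩
  have hxt := hmem t ⟨ht.1, ht.2.le⟩
  set x := z + t • (x₀ - z) with hx
  simp only [Function.comp_apply] at ht1
  rw [div_le_iff₀ hr] at ht1
  set g := gradient φ x with hg
  -- Compare with the point of the ball around `x₀` in the direction of the gradient.
  have hu : x₀ + (r * ‖g‖⁻¹) • g ∈ Metric.closedBall x₀ r := by
    rw [mem_closedBall_iff_norm, add_sub_cancel_left, norm_smul, Real.norm_eq_abs,
      abs_of_nonneg (by positivity), mul_assoc]
    exact mul_le_of_le_one_right hr.le inv_mul_le_one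
  have h1 := hφ.add_fderiv_le hxt (hball hu) (hd.differentiableAt (isOpen_interior.mem_nhds hxt))
  have h2 := (le_abs_self _).trans (hM _ hu)
  have h3 := hm x hxt
  have h4 : x₀ + (r * ‖g‖⁻¹) • g - x = (r * ‖g‖⁻¹) • g + (-(1 - t)) • (z - x₀) := by
    rw [hx]; module
  have h5 : (r * ‖g‖⁻¹) * fderiv ℝ φ x g = r * ‖g‖ := by
    rw [← inner_gradient_left, ← hg, real_inner_self_eq_norm_sq]
    rcases eq_or_ne ‖g‖ 0 with h0 | h0
    · rw [h0]; ring
    · field_simp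
  rw [h4, map_add, map_smul, map_smul, smul_eq_mul, smul_eq_mul, h5] at h1
  have h6 : 1 ≤ (1 - t) * fderiv ℝ φ x (z - x₀) := by linarith
  nlinarith [ht.1, ht.2]

/-- A minimizing sequence cannot approach a boundary point `z`: by convexity the values on the
segment from `z` to an interior point would tend to the infimum at `z`, although they increase
towards `z` with slope at least `1`. -/
theorem ConvexOn.exists_forall_le_of_tendsto_gradient (hK : IsCompact K) (hKc : Convex ℝ K)
    (hne : (interior K).Nonempty) (hφ : ConvexOn ℝ (interior K) φ)
    (hd : DifferentiableOn ℝ φ (interior K))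
    (hgrad : ∀ z ∈ frontier K, Tendsto (fun x => ‖gradient φ x‖) (𝓝[interior K] z) atTop) :
    ∃ x ∈ interior K, ∀ y ∈ interior K, φ x ≤ φ y := by
  obtain ⟨x₀, hx₀⟩ := hne
  have hda : ∀ x ∈ interior K, DifferentiableAt ℝ φ x := fun x hx =>
    hd.differentiableAt (isOpen_interior.mem_nhds hx)
  have hbdd : BddBelow (φ '' interior K) := by
    obtain ⟨R, hR⟩ := hK.isBounded.subset_closedBall x₀
    refine ⟨φ x₀ - ‖fderiv ℝ φ x₀‖ * R, ?_⟩
    rintro _ ⟨x, hx, rfl⟩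
    have h1 := hφ.add_fderiv_le hx₀ hx (hda x₀ hx₀)
    have h2 := (fderiv ℝ φ x₀).le_opNorm (x - x₀)
    have h3 := mem_closedBall_iff_norm.1 (hR (interior_subset hx))
    have h4 := mul_le_mul_of_nonneg_left h3 (norm_nonneg (fderiv ℝ φ x₀))
    have h5 := neg_abs_le (fderiv ℝ φ x₀ (x - x₀))
    rw [Real.norm_eq_abs] at h2
    linarith
  set m := sInf (φ '' interior K) with hm
  have hmle : ∀ x ∈ interior K, m ≤ φ x := fun x hx => csInf_le hbdd ⟨x, hx, rfl⟩
  obtain ⟨v, -, hv, hvmem⟩ := exists_seq_tendsto_sInf (⟨_, x₀, hx₀, rfl⟩ :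
    (φ '' interior K).Nonempty) hbdd
  choose u hu huv using hvmem
  obtain ⟨z, hz, σ, hσ, hlim⟩ := hK.tendsto_subseq fun n => interior_subset (hu n)
  have hval : Tendsto (fun n => φ (u (σ n))) atTop (𝓝 m) := by
    simp only [huv]; exact hv.comp hσ.tendsto_atTop
  by_cases hzi : z ∈ interior K
  · refine ⟨z, hzi, fun y hy => ?_⟩
    have h1 := ((hda z hzi).continuousAt.tendsto.comp hlim)
    rw [tendsto_nhds_unique h1 hval]
    exact hmle y hy
  exfalso
  have hzf : z ∈ frontier K := ⟨subset_closure hz, hzi⟩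
  have hmem : ∀ t ∈ Set.Ioc (0 : ℝ) 1, z + t • (x₀ - z) ∈ interior K := fun t ht =>
    hKc.add_smul_sub_mem_interior' (subset_closure hz) hx₀ ht
  have hupper : ∀ t ∈ Set.Ioc (0 : ℝ) 1, φ (z + t • (x₀ - z)) ≤ (1 - t) * m + t * φ x₀ := by
    intro t ht
    have h1 : Tendsto (fun n => u (σ n) + t • (x₀ - u (σ n))) atTop (𝓝 (z + t • (x₀ - z))) :=
      hlim.add ((tendsto_const_nhds.sub hlim).const_smul t)
    have h2 := (hda _ (hmem t ht)).continuousAt.tendsto.comp h1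
    have h3 : Tendsto (fun n => (1 - t) * φ (u (σ n)) + t * φ x₀) atTop
        (𝓝 ((1 - t) * m + t * φ x₀)) := (hval.const_mul _).add_const _
    refine le_of_tendsto_of_tendsto' h2 h3 fun n => ?_
    have h4 := hφ.2 (hu (σ n)) hx₀ (sub_nonneg.2 ht.2) ht.1.le (by ring)
    simp only [smul_eq_mul] at h4
    refine le_trans (le_of_eq (congrArg φ ?_)) h4
    module
  obtain ⟨t, ht, hslope⟩ := exists_one_le_fderiv_of_tendsto_gradient hKc hφ hd hx₀
    (subset_closure hz) (hgrad z hzf) hmle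
  have ht' : t ∈ Set.Ioc (0 : ℝ) 1 := ⟨ht.1, ht.2.le⟩
  have hlower : ∀ s ∈ Set.Ioo (0 : ℝ) t, m + (t - s) ≤ m + s * (φ x₀ - m) := by
    intro s hs
    have hs' : s ∈ Set.Ioc (0 : ℝ) 1 := ⟨hs.1, (hs.2.trans ht.2).le⟩
    have h1 := hφ.add_fderiv_le (hmem t ht') (hmem s hs') (hda _ (hmem t ht'))
    rw [show z + s • (x₀ - z) - (z + t • (x₀ - z)) = (t - s) • (z - x₀) by module, map_smul,
      smul_eq_mul] at h1
    have h2 := hupper s hs'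
    have h3 := hmle _ (hmem t ht')
    nlinarith [mul_le_mul_of_nonneg_left hslope (sub_nonneg.2 hs.2.le)]
  have hc : 0 ≤ φ x₀ - m := sub_nonneg.2 (hmle x₀ hx₀)
  have hs0 : 0 < t / (2 * (φ x₀ - m + 1)) := by have := ht.1; positivity
  have hs1 : t / (2 * (φ x₀ - m + 1)) < t := by
    rw [div_lt_iff₀ (by positivity)]
    nlinarith [ht.1, mul_nonneg ht.1.le hc]
  have h := hlower _ ⟨hs0, hs1⟩
  have e : t / (2 * (φ x₀ - m + 1)) * (φ x₀ - m + 1) = t / 2 := by field_simp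
  linarith [ht.1]

/-- The gradient is onto: the point with gradient `y` minimizes `φ - ⟨·, y⟩`. -/
theorem exists_gradient_eq (hK : IsCompact K) (hKc : Convex ℝ K)
    (hne : (interior K).Nonempty) (hφ : ConvexOn ℝ (interior K) φ)
    (hd : DifferentiableOn ℝ φ (interior K))
    (hgrad : ∀ z ∈ frontier K, Tendsto (fun x => ‖gradient φ x‖) (𝓝[interior K] z) atTop) (y : E) :
    ∃ x ∈ interior K, gradient φ x = y := by
  set L : E →L[ℝ] ℝ := InnerProductSpace.toDual ℝ E y with hL
  set ψ : E → ℝ := fun x => φ x - L x with hψ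
  have hda : ∀ x ∈ interior K, HasFDerivAt ψ (fderiv ℝ φ x - L) x := fun x hx =>
    (hd.differentiableAt (isOpen_interior.mem_nhds hx)).hasFDerivAt.sub L.hasFDerivAt
  have hg : ∀ x ∈ interior K, gradient ψ x = gradient φ x - y := fun x hx => by
    rw [gradient, (hda x hx).fderiv, map_sub, hL, LinearIsometryEquiv.symm_apply_apply, gradient]
  have hψc : ConvexOn ℝ (interior K) ψ := by
    refine hφ.sub ⟨hφ.1, fun a _ b _ s t _ _ _ => ?_⟩
    simp
  have hψg : ∀ z ∈ frontier K, Tendsto (fun x => ‖gradient ψ x‖) (𝓝[interior K] z) atTop := by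
    intro z hz
    have h1 := tendsto_atTop_add_const_right _ (-‖y‖) (hgrad z hz)
    refine tendsto_atTop_mono' _ ?_ h1
    filter_upwards [self_mem_nhdsWithin] with x hx
    rw [hg x hx]
    linarith [norm_sub_norm_le (gradient φ x) y]
  obtain ⟨x, hx, hmin⟩ := hψc.exists_forall_le_of_tendsto_gradient hK hKc hne
    (fun x hx => (hda x hx).differentiableAt.differentiableWithinAt) hψg
  refine ⟨x, hx, ?_⟩
  have hloc : IsLocalMin ψ x := by
    filter_upwards [isOpen_interior.mem_nhds hx] with w hw using hmin w hw
  have h0 : gradient ψ x = 0 := by rw [gradient, hloc.fderiv_eq_zero, map_zero]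
  rw [hg x hx] at h0
  exact sub_eq_zero.1 h0

theorem StrictConvexOn.gradient_injOn (hφ : StrictConvexOn ℝ (interior K) φ)
    (hd : DifferentiableOn ℝ φ (interior K)) : Set.InjOn (gradient φ) (interior K) := by
  intro x hx y hy hxy
  by_contra hne
  have h := hφ.fderiv_strictMonotone hx hy hne (hd.differentiableAt (isOpen_interior.mem_nhds hx))
    (hd.differentiableAt (isOpen_interior.mem_nhds hy))
  rw [← inner_gradient_left, ← inner_gradient_left, hxy] at h
  exact lt_irrefl _ h

end Legendre

namespace MirrorLangevin

variable {d : ℕ} {K : Set (EuclideanSpace ℝ (Fin d))} {φ : EuclideanSpace ℝ (Fin d) → ℝ}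

theorem convexConj_eq (hφ : ConvexOn ℝ (interior K) φ) (hd : DifferentiableOn ℝ φ (interior K))
    {x : EuclideanSpace ℝ (Fin d)} (hx : x ∈ interior K) :
    IsLUB (Set.range fun w : interior K => inner ℝ (w : EuclideanSpace ℝ (Fin d)) (gradient φ x)
      - φ w) (inner ℝ x (gradient φ x) - φ x) ∧
    convexConj K φ (gradient φ x) = inner ℝ x (gradient φ x) - φ x := by
  have h : IsLUB (Set.range fun w : interior K =>
      inner ℝ (w : EuclideanSpace ℝ (Fin d)) (gradient φ x) - φ w)
      (inner ℝ x (gradient φ x) - φ x) := by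
    refine IsGreatest.isLUB ⟨⟨⟨x, hx⟩, rfl⟩, ?_⟩
    rintro _ ⟨w, rfl⟩
    have h1 := hφ.add_fderiv_le hx w.2 (hd.differentiableAt (isOpen_interior.mem_nhds hx))
    rw [← inner_gradient_left, inner_sub_right, real_inner_comm, real_inner_comm x] at h1
    dsimp only
    linarith
  have : Nonempty (interior K) := ⟨⟨x, hx⟩⟩
  exact ⟨h, h.ciSup_eq⟩

/-- For a mirror function, `∇φ*` is the continuous inverse of `∇φ`. The inverse is continuous
because `K` is compact and `∇φ` is unbounded at the boundary; the differentiability of `φ*` then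
follows from the inequality of Fenchel and Young. -/
theorem gradient_convexConj (hK : IsCompact K) (hKc : Convex ℝ K) (hne : (interior K).Nonempty)
    (hL : IsLegendre K φ) (hcont : ContinuousOn (gradient φ) (interior K)) :
    Continuous (gradient (convexConj K φ)) ∧
    (∀ y, gradient (convexConj K φ) y ∈ interior K ∧
      gradient φ (gradient (convexConj K φ) y) = y) ∧
    ∀ x ∈ interior K, gradient (convexConj K φ) (gradient φ x) = x := by
  have hconv := hL.strictConvex.convexOn
  have hinj := hL.strictConvex.gradient_injOn hL.differentiable
  choose g hgK hg using exists_gradient_eq hK hKc hne hconv hL.differentiable hL.gradient_unbounded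
  have hgcont : Continuous g := by
    rw [continuous_iff_continuousAt]
    intro y
    refine hK.tendsto_nhds_of_unique_mapClusterPt
      (Eventually.of_forall fun y' => interior_subset (hgK y')) fun z hz hcl => ?_
    by_cases hzi : z ∈ interior K
    · have h1 := hcl.continuousAt_comp (hcont.continuousAt (isOpen_interior.mem_nhds hzi))
      have h2 : gradient φ ∘ g = id := funext hg
      rw [h2, mapClusterPt_id_iff] at h1
      have h3 : gradient φ z = y := eq_of_nhds_neBot h1
      exact hinj hzi (hgK y) (by rw [hg, h3])
    · exfalso
      have h1 := (hL.gradient_unbounded z ⟨subset_closure hz, hzi⟩).eventually_ge_atTop (‖y‖ + 1)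
      rw [eventually_nhdsWithin_iff] at h1
      have h2 := hcl.frequently h1
      have h3 : ∀ᶠ y' in 𝓝 y, ‖y'‖ < ‖y‖ + 1 :=
        continuous_norm.continuousAt.eventually_lt continuousAt_const (by linarith)
      obtain ⟨y', h4, h5⟩ := (h2.and_eventually h3).exists
      have h6 := h4 (hgK y')
      rw [hg] at h6
      linarith
  have hconj : ∀ y, convexConj K φ y = inner ℝ (g y) y - φ (g y) := fun y => by
    have := (convexConj_eq hconv hL.differentiable (hgK y)).2
    rwa [hg] at this
  have hle : ∀ y w, inner ℝ (g w) y - φ (g w) ≤ convexConj K φ y := fun y w => by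
    have h := (convexConj_eq hconv hL.differentiable (hgK y))
    rw [h.2.symm] at h
    rw [← hg y]
    refine h.1.1 ⟨⟨g w, hgK w⟩, ?_⟩
    rw [hg]
  have hgrad : gradient (convexConj K φ) = g := by
    refine gradient_eq fun y => ?_
    rw [hasGradientAt_iff_isLittleO]
    rw [Asymptotics.isLittleO_iff]
    intro c hc
    have h1 : ∀ᶠ y' in 𝓝 y, ‖g y' - g y‖ < c := by
      have := Metric.tendsto_nhds.1 (hgcont.tendsto y) c hc
      simpa [dist_eq_norm] using this
    filter_upwards [h1] with y' hy'
    have h2 := hle y' y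
    have h3 := hle y y'
    rw [hconj y] at h3 ⊢
    rw [hconj y'] at h2 ⊢
    have h4 : inner ℝ (g y') y' - φ (g y') - (inner ℝ (g y) y - φ (g y)) - inner ℝ (g y) (y' - y)
        ≤ inner ℝ (g y' - g y) (y' - y) := by
      simp only [inner_sub_left, inner_sub_right] at *
      linarith
    have h5 : 0 ≤ inner ℝ (g y') y' - φ (g y') - (inner ℝ (g y) y - φ (g y))
        - inner ℝ (g y) (y' - y) := by
      simp only [inner_sub_right] at *
      linarith
    rw [Real.norm_eq_abs, abs_of_nonneg h5]
    refine h4.trans ((real_inner_le_norm _ _).trans ?_)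
    exact mul_le_mul_of_nonneg_right hy'.le (norm_nonneg _)
  rw [hgrad]
  exact ⟨hgcont, fun y => ⟨hgK y, hg y⟩, fun x hx => hinj (hgK _) hx (hg _)⟩

end MirrorLangevin

/-! ### Pinsker's inequality -/

/-- The scalar inequality behind Pinsker's inequality. -/
theorem three_mul_sub_one_sq_le {t : ℝ} (ht : 0 < t) :
    3 * (t - 1) ^ 2 ≤ (2 * t + 4) * (t * Real.log t - t + 1) := by
  set F : ℝ → ℝ := fun t => (2 * t + 4) * (t * Real.log t - t + 1) - 3 * (t - 1) ^ 2 with hF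
  have hF' : ∀ s : ℝ, 0 < s → HasDerivAt F (4 * ((s + 1) * Real.log s - 2 * (s - 1))) s := by
    intro s hs
    have h1 : HasDerivAt (fun t : ℝ => 2 * t + 4) 2 s := by
      simpa using ((hasDerivAt_id s).const_mul 2).add_const 4
    have h2 : HasDerivAt (fun t : ℝ => t * Real.log t - t + 1) (Real.log s + 1 - 1) s :=
      ((Real.hasDerivAt_mul_log hs.ne').sub (hasDerivAt_id s)).add_const 1
    have h3 : HasDerivAt (fun t : ℝ => 3 * (t - 1) ^ 2) (3 * (2 * (s - 1))) s := by
      simpa using (((hasDerivAt_id s).sub_const 1).pow 2).const_mul 3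
    refine ((h1.mul h2).sub h3).congr_deriv ?_
    ring
  have hG' : ∀ s : ℝ, 0 < s → HasDerivAt (fun s : ℝ => (s + 1) * Real.log s - 2 * (s - 1))
      (Real.log s - (1 - s⁻¹)) s := by
    intro s hs
    have h1 : HasDerivAt (fun t : ℝ => t + 1) 1 s := (hasDerivAt_id s).add_const 1
    have h2 : HasDerivAt (fun t : ℝ => 2 * (t - 1)) 2 s := by
      simpa using ((hasDerivAt_id s).sub_const 1).const_mul 2
    refine ((h1.mul (Real.hasDerivAt_log hs.ne')).sub h2).congr_deriv ?_
    field_simp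
    ring
  have hlog : ∀ s : ℝ, 0 < s → 0 ≤ Real.log s - (1 - s⁻¹) := fun s hs =>
    sub_nonneg.2 (Real.one_sub_inv_le_log_of_pos hs)
  suffices h : 0 ≤ F t by simp only [hF] at h; linarith
  have hF1 : F 1 = 0 := by simp [hF]
  rcases le_total 1 t with h1 | h1
  · have hpos : ∀ s ∈ Set.Icc 1 t, 0 < s := fun s hs => one_pos.trans_le hs.1
    have := le_of_hasDerivAt_nonneg h1 (fun s hs => hF' s (hpos s hs)) fun s hs => by
      have h2 := le_of_hasDerivAt_nonneg hs.1 (fun u hu => hG' u (one_pos.trans_le hu.1))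
        fun u hu => hlog u (one_pos.trans_le hu.1)
      simp only [Real.log_one, mul_zero, sub_self] at h2
      linarith
    rwa [hF1] at this
  · have hpos : ∀ s ∈ Set.Icc t 1, 0 < s := fun s hs => ht.trans_le hs.1
    have := le_of_hasDerivAt_nonneg (F := fun s => - F s) h1
      (fun s hs => (hF' s (hpos s hs)).neg) fun s hs => by
      have h2 := le_of_hasDerivAt_nonneg hs.2 (fun u hu => hG' u ((hpos s hs).trans_le hu.1))
        fun u hu => hlog u ((hpos s hs).trans_le hu.1)
      simp only [Real.log_one, mul_zero, sub_self] at h2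
      linarith
    simp only [hF1, neg_zero] at this
    linarith

/-- Pinsker's inequality, for a measure with a positive density with respect to another one. -/
theorem measureReal_sub_le_of_integral_log_le {Ω : Type*} [MeasurableSpace Ω] {μ ν : Measure Ω}
    [IsProbabilityMeasure μ] [IsProbabilityMeasure ν] {t : Ω → ℝ} (ht : Measurable t)
    (hpos : ∀ x, 0 < t x) (hν : ν = μ.withDensity fun x => ENNReal.ofReal (t x))
    (hint : Integrable (fun x => Real.log (t x)) ν) {κ : ℝ} (hκ : 0 < κ)
    (hle : ∫ x, Real.log (t x) ∂ν ≤ κ / 2) {A : Set Ω} (hA : MeasurableSet A) :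
    ν.real A - μ.real A ≤ 1 / 2 * √κ := by
  have hint_iff : ∀ g : Ω → ℝ, Integrable g ν ↔ Integrable (fun x => t x * g x) μ := fun g => by
    rw [hν, integrable_withDensity_iff_integrable_smul' ht.ennreal_ofReal
      (Eventually.of_forall fun _ => ENNReal.ofReal_lt_top)]
    simp only [ENNReal.toReal_ofReal (hpos _).le, smul_eq_mul]
  have hintegral : ∀ g : Ω → ℝ, ∫ x, g x ∂ν = ∫ x, t x * g x ∂μ := fun g => by
    rw [hν, integral_withDensity_eq_integral_toReal_smul ht.ennreal_ofReal
      (Eventually.of_forall fun _ => ENNReal.ofReal_lt_top)]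
    simp only [ENNReal.toReal_ofReal (hpos _).le, smul_eq_mul]
  have ht1 : Integrable t μ := by
    have := (hint_iff fun _ => 1).1 (integrable_const _)
    simpa using this
  have htint : ∫ x, t x ∂μ = 1 := by
    have := hintegral fun _ => 1
    simpa using this.symm
  have hAν : ν.real A = ∫ x in A, t x ∂μ := by
    rw [measureReal_def, hν, withDensity_apply _ hA, ← ofReal_integral_eq_lintegral_ofReal
      ht1.integrableOn (Eventually.of_forall fun x => (hpos x).le),
      ENNReal.toReal_ofReal (integral_nonneg fun x => (hpos x).le)]
  have hs1 : Integrable (fun x => t x - 1) μ := ht1.sub (integrable_const _)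
  have hA1 : ν.real A - μ.real A = ∫ x in A, (t x - 1) ∂μ := by
    rw [integral_sub ht1.integrableOn (integrable_const _), hAν]
    simp
  have hA0 : ∫ x in A, (t x - 1) ∂μ + ∫ x in Aᶜ, (t x - 1) ∂μ = 0 := by
    rw [integral_add_compl hA hs1, integral_sub ht1 (integrable_const _), htint]
    simp
  have habs : ∫ x in A, (t x - 1) ∂μ ≤ 1 / 2 * ∫ x, |t x - 1| ∂μ := by
    have h1 : ∫ x in A, (t x - 1) ∂μ ≤ ∫ x in A, |t x - 1| ∂μ :=
      integral_mono hs1.integrableOn hs1.abs.integrableOn fun x => le_abs_self _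
    have h2 : -∫ x in Aᶜ, (t x - 1) ∂μ ≤ ∫ x in Aᶜ, |t x - 1| ∂μ := by
      rw [← integral_neg]
      exact integral_mono hs1.integrableOn.neg hs1.abs.integrableOn fun x => neg_le_abs _
    have h3 := integral_add_compl hA hs1.abs
    linarith
  -- AM-GM in place of Cauchy-Schwarz, with the optimal weight `η = √κ / 2`.
  set η : ℝ := √κ / 2 with hη
  have hη0 : 0 < η := by positivity
  have hpt : ∀ x, |t x - 1| ≤ η / 6 * (2 * t x + 4) + 1 / (2 * η) *
      (t x * Real.log (t x) - t x + 1) := by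
    intro x
    have h1 := three_mul_sub_one_sq_le (hpos x)
    set k := t x * Real.log (t x) - t x + 1
    have h2 : 0 < 2 * t x + 4 := by linarith [hpos x]
    have hk : 0 ≤ k := nonneg_of_mul_nonneg_right (le_trans (by positivity) h1) h2
    refine abs_le_of_sq_le_sq ?_ (by positivity)
    have e : η / 6 * (2 * t x + 4) * (1 / (2 * η) * k) = (2 * t x + 4) * k / 12 := by
      field_simp; ring
    nlinarith [sq_nonneg (η / 6 * (2 * t x + 4) - 1 / (2 * η) * k)]
  have hlogint : Integrable (fun x => t x * Real.log (t x)) μ := (hint_iff _).1 hint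
  have hsub : Integrable (fun x => t x * Real.log (t x) - t x) μ := hlogint.sub ht1
  have hI1 : Integrable (fun x => η / 6 * (2 * t x + 4)) μ :=
    ((ht1.const_mul 2).add (integrable_const _)).const_mul _
  have hI2 : Integrable (fun x => 1 / (2 * η) * (t x * Real.log (t x) - t x + 1)) μ :=
    (hsub.add (integrable_const _)).const_mul _
  have hfin := integral_mono hs1.abs (hI1.add hI2) hpt
  have e1 : ∫ x, η / 6 * (2 * t x + 4) ∂μ = η := by
    rw [integral_const_mul, integral_add (ht1.const_mul 2) (integrable_const _),
      integral_const_mul, htint]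
    simp; ring
  have e2 : ∫ x, 1 / (2 * η) * (t x * Real.log (t x) - t x + 1) ∂μ =
      1 / (2 * η) * ∫ x, Real.log (t x) ∂ν := by
    rw [integral_const_mul, integral_add hsub (integrable_const _),
      integral_sub hlogint ht1, htint, hintegral]
    simp
  simp only [Pi.add_apply] at hfin
  rw [integral_add hI1 hI2, e1, e2] at hfin
  have h4 : 1 / (2 * η) * ∫ x, Real.log (t x) ∂ν ≤ 1 / (2 * η) * (κ / 2) :=
    mul_le_mul_of_nonneg_left hle (by positivity)
  have h5 : 1 / (2 * η) * (κ / 2) = η := by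
    have : κ = (2 * η) ^ 2 := by rw [hη, mul_div_cancel₀ _ two_ne_zero, Real.sq_sqrt hκ.le]
    rw [this]; field_simp
  rw [hA1]
  linarith

/-! ### The standard Gaussian measure -/

section StdGaussian

variable {E : Type*} [NormedAddCommGroup E] [InnerProductSpace ℝ E]

/-- The density of the standard Gaussian measure with respect to the volume. -/
noncomputable def stdGaussianPDF (x : E) : ℝ :=
  (2 * Real.pi) ^ (-(Module.finrank ℝ E : ℝ) / 2) * Real.exp (-(1 / 2) * ‖x‖ ^ 2)

theorem stdGaussianPDF_pos (x : E) : 0 < stdGaussianPDF x := by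
  unfold stdGaussianPDF; positivity

variable [MeasurableSpace E] [BorelSpace E]

@[fun_prop]
theorem measurable_stdGaussianPDF : Measurable (stdGaussianPDF (E := E)) := by
  unfold stdGaussianPDF; fun_prop

variable [FiniteDimensional ℝ E]

theorem integrable_exp_neg_mul_norm_sq {b : ℝ} (hb : 0 < b) :
    Integrable (fun x : E => Real.exp (-b * ‖x‖ ^ 2)) := by
  have := (GaussianFourier.integrable_cexp_neg_mul_sq_norm_add (V := E)
    (show 0 < (b : ℂ).re from hb) 0 0).norm
  refine this.congr (Eventually.of_forall fun x => ?_)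
  simp only [Complex.norm_exp, zero_mul, add_zero]
  norm_cast

theorem lintegral_stdGaussianPDF : ∫⁻ x : E, ENNReal.ofReal (stdGaussianPDF x) = 1 := by
  have h := GaussianFourier.integral_rexp_neg_mul_sq_norm (V := E) (b := 1 / 2) (by norm_num)
  rw [← ofReal_integral_eq_lintegral_ofReal _ (Eventually.of_forall fun x =>
    (stdGaussianPDF_pos x).le)]
  · unfold stdGaussianPDF
    rw [integral_const_mul, h, show Real.pi / (1 / 2) = 2 * Real.pi by ring,
      ← Real.rpow_add (by positivity)]
    simp [neg_div]
  · exact (integrable_exp_neg_mul_norm_sq (by norm_num)).const_mul _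

theorem stdGaussian_eq_withDensity :
    stdGaussian E = volume.withDensity fun x => ENNReal.ofReal (stdGaussianPDF x) := by
  have hfin : IsFiniteMeasure (volume.withDensity fun x : E => ENNReal.ofReal (stdGaussianPDF x)) :=
    isFiniteMeasure_withDensity (by rw [lintegral_stdGaussianPDF]; exact ENNReal.one_ne_top)
  refine Measure.ext_of_charFun ?_
  ext t
  rw [charFun_stdGaussian, charFun_apply, integral_withDensity_eq_integral_toReal_smul
    (by fun_prop) (Eventually.of_forall fun _ => ENNReal.ofReal_lt_top)]
  have h := GaussianFourier.integral_cexp_neg_mul_sq_norm_add (V := E) (b := 1 / 2)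
    (by norm_num) Complex.I t
  have e : ∀ x : E,
      (ENNReal.ofReal (stdGaussianPDF x)).toReal • Complex.exp (inner ℝ x t * Complex.I) =
      ((2 * Real.pi : ℝ) ^ (-(Module.finrank ℝ E : ℝ) / 2) : ℝ) *
        Complex.exp (-(1 / 2) * ‖x‖ ^ 2 + Complex.I * inner ℝ t x) := fun x => by
    rw [ENNReal.toReal_ofReal (stdGaussianPDF_pos x).le, stdGaussianPDF, Complex.exp_add,
      real_inner_comm t x, mul_comm Complex.I]
    simp only [Complex.real_smul]
    push_cast
    ring
  simp_rw [e]
  rw [integral_const_mul, h]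
  have h2 : ((2 * Real.pi : ℝ) ^ (-(Module.finrank ℝ E : ℝ) / 2) : ℝ) *
      ((Real.pi : ℂ) / (1 / 2)) ^ (Module.finrank ℝ E / 2 : ℂ) = 1 := by
    have e3 : ((Real.pi : ℂ) / (1 / 2)) ^ (Module.finrank ℝ E / 2 : ℂ) =
        (((2 * Real.pi : ℝ) ^ ((Module.finrank ℝ E : ℝ) / 2) : ℝ) : ℂ) := by
      rw [Complex.ofReal_cpow (by positivity)]
      push_cast
      congr 1
      ring
    rw [e3, ← Complex.ofReal_mul, ← Real.rpow_add (by positivity)]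
    simp [neg_div]
  rw [← mul_assoc, h2, one_mul, Complex.I_sq]
  congr 1
  ring

/-- An invertible affine image of the standard Gaussian measure has an explicit density with respect
to the standard Gaussian measure itself. -/
theorem map_affine_stdGaussian_eq_withDensity (a : E) (L L' : E →L[ℝ] E) (hL' : ∀ x, L' (L x) = x)
    (hdet : LinearMap.det (L : E →ₗ[ℝ] E) ≠ 0) :
    (stdGaussian E).map (fun x => a + L x) = (stdGaussian E).withDensity fun z =>
      ENNReal.ofReal (|(LinearMap.det (L : E →ₗ[ℝ] E))⁻¹| *
        Real.exp (1 / 2 * ‖z‖ ^ 2 - 1 / 2 * ‖L' (z - a)‖ ^ 2)) := by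
  set D := |(LinearMap.det (L : E →ₗ[ℝ] E))⁻¹| with hD
  have hT : Measurable fun x : E => a + L x := by fun_prop
  have hvol : (volume : Measure E).map (fun x => a + L x) = ENNReal.ofReal D • volume := by
    have h1 := Measure.map_linearMap_addHaar_eq_smul_addHaar (volume : Measure E) hdet
    have h2 : (fun x : E => a + L x) = (fun x => a + x) ∘ (L : E →ₗ[ℝ] E) := rfl
    rw [h2, ← Measure.map_map (measurable_const_add a)
      (by exact L.continuous.measurable), h1, Measure.map_smul, map_add_left_eq_self]
  have hG : Measurable fun z : E => ENNReal.ofReal (stdGaussianPDF (L' (z - a))) := by fun_prop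
  rw [stdGaussian_eq_withDensity, ← withDensity_mul _ (by fun_prop) (by fun_prop)]
  ext s hs
  rw [Measure.map_apply hT hs, withDensity_apply _ (hT hs), withDensity_apply _ hs]
  have h3 : ∀ x : E, ENNReal.ofReal (stdGaussianPDF x) =
      ENNReal.ofReal (stdGaussianPDF (L' ((a + L x) - a))) := fun x => by
    rw [add_sub_cancel_left, hL']
  rw [lintegral_congr h3]
  rw [← setLIntegral_map hs hG hT, hvol, Measure.restrict_smul, lintegral_smul_measure,
    smul_eq_mul, ← lintegral_const_mul _ hG]
  refine lintegral_congr fun z => ?_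
  rw [Pi.mul_apply, ← ENNReal.ofReal_mul (abs_nonneg _),
    ← ENNReal.ofReal_mul (stdGaussianPDF_pos z).le]
  congr 1
  have e : Real.exp (-(1 / 2) * ‖L' (z - a)‖ ^ 2) = Real.exp (-(1 / 2) * ‖z‖ ^ 2) *
      Real.exp (1 / 2 * ‖z‖ ^ 2 - 1 / 2 * ‖L' (z - a)‖ ^ 2) := by
    rw [← Real.exp_add]; congr 1; ring
  rw [stdGaussianPDF, stdGaussianPDF, e]
  ring

theorem integrable_sq_dual_stdGaussian (ℓ : StrongDual ℝ E) :
    Integrable (fun x => ℓ x ^ 2) (stdGaussian E) :=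
  (IsGaussian.memLp_dual (stdGaussian E) ℓ 2 (by norm_num)).integrable_sq

theorem integral_sq_dual_stdGaussian (ℓ : StrongDual ℝ E) :
    ∫ x, ℓ x ^ 2 ∂(stdGaussian E) = ‖ℓ‖ ^ 2 := by
  rw [← variance_dual_stdGaussian, variance_of_integral_eq_zero ℓ.continuous.aemeasurable
    (integral_strongDual_stdGaussian ℓ)]

/-- The second moment of an affine image of the standard Gaussian measure. -/
theorem integral_norm_sq_affine_stdGaussian {ι : Type*} [Fintype ι] (b : OrthonormalBasis ι ℝ E)
    (a : E) (L : E →L[ℝ] E) :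
    Integrable (fun x => ‖a + L x‖ ^ 2) (stdGaussian E) ∧
    ∫ x, ‖a + L x‖ ^ 2 ∂(stdGaussian E) = ‖a‖ ^ 2 + ∑ i, ‖L.adjoint (b i)‖ ^ 2 := by
  set ℓ₀ : StrongDual ℝ E := InnerProductSpace.toDual ℝ E (L.adjoint a) with hℓ₀
  set ℓ : ι → StrongDual ℝ E := fun i => InnerProductSpace.toDual ℝ E (L.adjoint (b i)) with hℓ
  have e : ∀ x, ‖a + L x‖ ^ 2 = ‖a‖ ^ 2 + 2 * ℓ₀ x + ∑ i, ℓ i x ^ 2 := fun x => by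
    rw [norm_add_sq_real, ← b.sum_sq_inner_right (L x)]
    simp only [hℓ₀, hℓ, InnerProductSpace.toDual_apply_apply,
      ContinuousLinearMap.adjoint_inner_left]
  have i1 : Integrable (fun x => ‖a‖ ^ 2 + 2 * ℓ₀ x) (stdGaussian E) :=
    (integrable_const _).add ((IsGaussian.integrable_dual (stdGaussian E) ℓ₀).const_mul 2)
  have i2 : Integrable (fun x => ∑ i, ℓ i x ^ 2) (stdGaussian E) :=
    integrable_finsetSum _ fun i _ => integrable_sq_dual_stdGaussian (ℓ i)
  simp_rw [e]
  refine ⟨i1.add i2, ?_⟩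
  rw [integral_add i1 i2, integral_add (integrable_const _)
    ((IsGaussian.integrable_dual (stdGaussian E) ℓ₀).const_mul 2), integral_const_mul,
    integral_strongDual_stdGaussian, integral_finsetSum _ fun i _ =>
      integrable_sq_dual_stdGaussian (ℓ i)]
  simp_rw [integral_sq_dual_stdGaussian]
  simp [hℓ]

/-- Relative entropy bound on the distance between an affine image of the standard Gaussian measure
and the standard Gaussian measure. -/
theorem measureReal_map_affine_stdGaussian_sub_le {ι : Type*} [Fintype ι]
    (b : OrthonormalBasis ι ℝ E) (a : E) (L L' : E →L[ℝ] E) (hL' : ∀ x, L' (L x) = x)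
    (hdet : LinearMap.det (L : E →ₗ[ℝ] E) ≠ 0) {κ : ℝ} (hκ : 0 < κ)
    (hle : ‖a‖ ^ 2 + (∑ i, ‖L.adjoint (b i)‖ ^ 2 - Fintype.card ι
      - Real.log (LinearMap.det (L : E →ₗ[ℝ] E) ^ 2)) ≤ κ) {A : Set E} (hA : MeasurableSet A) :
    ((stdGaussian E).map fun x => a + L x).real A - (stdGaussian E).real A ≤ 1 / 2 * √κ := by
  have hT : Measurable fun x : E => a + L x := by fun_prop
  set D := LinearMap.det (L : E →ₗ[ℝ] E) with hD
  have hD' : 0 < |D⁻¹| := abs_pos.2 (inv_ne_zero hdet)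
  have : IsProbabilityMeasure ((stdGaussian E).map fun x => a + L x) :=
    Measure.isProbabilityMeasure_map hT.aemeasurable
  have hlog : ∀ x, Real.log (|D⁻¹| * Real.exp (1 / 2 * ‖a + L x‖ ^ 2 -
      1 / 2 * ‖L' (a + L x - a)‖ ^ 2)) =
      (1 / 2 * ‖a + L x‖ ^ 2 - 1 / 2 * ‖0 + ContinuousLinearMap.id ℝ E x‖ ^ 2) +
        -(1 / 2) * Real.log (D ^ 2) := fun x => by
    rw [Real.log_mul hD'.ne' (Real.exp_ne_zero _), Real.log_exp, add_sub_cancel_left, hL',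
      Real.log_abs, Real.log_inv, Real.log_pow, zero_add, ContinuousLinearMap.id_apply]
    push_cast; ring
  obtain ⟨i1, e1⟩ := integral_norm_sq_affine_stdGaussian b a L
  obtain ⟨i2, e2⟩ := integral_norm_sq_affine_stdGaussian b 0 (ContinuousLinearMap.id ℝ E)
  have i3 : Integrable (fun x => 1 / 2 * ‖a + L x‖ ^ 2 -
      1 / 2 * ‖0 + ContinuousLinearMap.id ℝ E x‖ ^ 2) (stdGaussian E) :=
    (i1.const_mul (1 / 2)).sub (i2.const_mul (1 / 2))
  have i4 : Integrable (fun x => (1 / 2 * ‖a + L x‖ ^ 2 -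
      1 / 2 * ‖0 + ContinuousLinearMap.id ℝ E x‖ ^ 2) + -(1 / 2) * Real.log (D ^ 2))
      (stdGaussian E) := i3.add (integrable_const _)
  have hm : Measurable fun z : E => |D⁻¹| *
      Real.exp (1 / 2 * ‖z‖ ^ 2 - 1 / 2 * ‖L' (z - a)‖ ^ 2) := by fun_prop
  refine measureReal_sub_le_of_integral_log_le hm
    (fun z => by positivity) (map_affine_stdGaussian_eq_withDensity a L L' hL' hdet) ?_ hκ ?_ hA
  · rw [integrable_map_measure hm.log.aestronglyMeasurable hT.aemeasurable]
    exact i4.congr (Eventually.of_forall fun x => (hlog x).symm)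
  · rw [integral_map hT.aemeasurable hm.log.aestronglyMeasurable]
    simp_rw [hlog]
    rw [integral_add i3 (integrable_const _), integral_sub (i1.const_mul _) (i2.const_mul _),
      integral_const_mul, integral_const_mul, e1, e2]
    have e3 : ∀ i, ‖(ContinuousLinearMap.id ℝ E).adjoint (b i)‖ = 1 := fun i => by
      rw [ContinuousLinearMap.adjoint_id]; simp
    simp only [e3, norm_zero, integral_const, probReal_univ, one_pow, Finset.sum_const,
      Finset.card_univ, nsmul_eq_mul, mul_one, one_smul]
    linarith

/-- Chernoff bound for the squared norm of a standard Gaussian vector. -/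
theorem stdGaussian_real_le_norm_sq (R : ℝ) :
    (stdGaussian E).real {x | R ≤ ‖x‖ ^ 2} ≤
      Real.exp (-R / 4) * 2 ^ ((Module.finrank ℝ E : ℝ) / 2) := by
  have hp : ∀ x : E, stdGaussianPDF x * Real.exp (1 / 4 * ‖x‖ ^ 2) =
      (2 * Real.pi) ^ (-(Module.finrank ℝ E : ℝ) / 2) * Real.exp (-(1 / 4) * ‖x‖ ^ 2) := fun x => by
    rw [stdGaussianPDF, mul_assoc, ← Real.exp_add]
    congr 2; ring
  have hint : Integrable (fun x : E => Real.exp (1 / 4 * ‖x‖ ^ 2)) (stdGaussian E) := by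
    rw [stdGaussian_eq_withDensity, integrable_withDensity_iff_integrable_smul' (by fun_prop)
      (Eventually.of_forall fun _ => ENNReal.ofReal_lt_top)]
    simp only [ENNReal.toReal_ofReal (stdGaussianPDF_pos _).le, smul_eq_mul, hp]
    exact (integrable_exp_neg_mul_norm_sq (by norm_num)).const_mul _
  have h := measure_ge_le_exp_mul_mgf (μ := stdGaussian E) (X := fun x => ‖x‖ ^ 2) (t := 1 / 4) R
    (by norm_num) hint
  refine h.trans (le_of_eq ?_)
  rw [show -(1 / 4) * R = -R / 4 by ring]
  congr 1
  rw [mgf, stdGaussian_eq_withDensity, integral_withDensity_eq_integral_toReal_smul (by fun_prop)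
    (Eventually.of_forall fun _ => ENNReal.ofReal_lt_top)]
  simp only [ENNReal.toReal_ofReal (stdGaussianPDF_pos _).le, smul_eq_mul, hp]
  rw [integral_const_mul, GaussianFourier.integral_rexp_neg_mul_sq_norm (by norm_num),
    show Real.pi / (1 / 4) = (2 * Real.pi) * 2 by ring,
    Real.mul_rpow (x := 2 * Real.pi) (y := 2) (by positivity) (by norm_num),
    ← mul_assoc, ← Real.rpow_add (by positivity)]
  simp [neg_div]

end StdGaussian

/-! ### Positive definite matrices and their local norms -/

namespace MirrorLangevin

open scoped MatrixOrder

variable {d : ℕ} {A B : Matrix (Fin d) (Fin d) ℝ}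

local notation "𝓛" => Matrix.toEuclideanCLM (𝕜 := ℝ)

theorem toEuclideanCLM_mul_apply (A B : Matrix (Fin d) (Fin d) ℝ) (v : EuclideanSpace ℝ (Fin d)) :
    𝓛 (A * B) v = 𝓛 A (𝓛 B v) := by
  rw [map_mul]; rfl

theorem adjoint_toEuclideanCLM (A : Matrix (Fin d) (Fin d) ℝ) : (𝓛 A).adjoint = 𝓛 Aᵀ := by
  have h := map_star (Matrix.toEuclideanCLM (n := Fin d) (𝕜 := ℝ)) A
  rw [ContinuousLinearMap.star_eq_adjoint, Matrix.star_eq_conjTranspose,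
    Matrix.conjTranspose_eq_transpose_of_trivial] at h
  exact h.symm

theorem inner_toEuclideanCLM_comm (hA : A.IsHermitian) (u v : EuclideanSpace ℝ (Fin d)) :
    inner ℝ (𝓛 A u) v = inner ℝ u (𝓛 A v) := by
  have h : Aᵀ = A := by
    rw [← Matrix.conjTranspose_eq_transpose_of_trivial]; exact hA
  rw [← ContinuousLinearMap.adjoint_inner_right, adjoint_toEuclideanCLM, h]

theorem det_toEuclideanCLM (A : Matrix (Fin d) (Fin d) ℝ) :
    LinearMap.det (𝓛 A : EuclideanSpace ℝ (Fin d) →ₗ[ℝ] EuclideanSpace ℝ (Fin d)) = A.det := by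
  rw [Matrix.coe_toEuclideanCLM_eq_toEuclideanLin]
  exact LinearMap.det_toLpLin 2 A

theorem _root_.Matrix.PosDef.isUnit_det (hA : A.PosDef) : IsUnit A.det :=
  hA.det_pos.ne'.isUnit

theorem inv_mul_apply (hA : IsUnit A.det) (v : EuclideanSpace ℝ (Fin d)) : 𝓛 A⁻¹ (𝓛 A v) = v := by
  rw [← toEuclideanCLM_mul_apply, Matrix.nonsing_inv_mul _ hA, map_one]; rfl

theorem mul_inv_apply (hA : IsUnit A.det) (v : EuclideanSpace ℝ (Fin d)) : 𝓛 A (𝓛 A⁻¹ v) = v := by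
  rw [← toEuclideanCLM_mul_apply, Matrix.mul_nonsing_inv _ hA, map_one]; rfl

theorem posDef_of_inner_pos (hA : A.IsHermitian)
    (h : ∀ v : EuclideanSpace ℝ (Fin d), v ≠ 0 → 0 < inner ℝ v (𝓛 A v)) : A.PosDef := by
  refine Matrix.PosDef.of_dotProduct_mulVec_pos hA fun x hx => ?_
  have h1 := h (WithLp.toLp 2 x) (by simpa using hx)
  rw [Matrix.inner_toEuclideanCLM] at h1
  simpa using h1

theorem inner_pos_of_posDef (hA : A.PosDef) {v : EuclideanSpace ℝ (Fin d)} (hv : v ≠ 0) :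
    0 < inner ℝ v (𝓛 A v) := by
  rw [Matrix.inner_toEuclideanCLM]
  have := hA.dotProduct_mulVec_pos (x := v.ofLp) (by simpa using hv)
  simpa using this

theorem localNorm_nonneg (A : Matrix (Fin d) (Fin d) ℝ) (u : EuclideanSpace ℝ (Fin d)) :
    0 ≤ localNorm A u :=
  Real.sqrt_nonneg _

theorem localNorm_sq (hA : A.PosDef) (u : EuclideanSpace ℝ (Fin d)) :
    localNorm A u ^ 2 = inner ℝ u (𝓛 A u) := by
  refine Real.sq_sqrt ?_
  rcases eq_or_ne u 0 with rfl | hu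
  · simp
  · exact (inner_pos_of_posDef hA hu).le

theorem sqrt_posDef (hA : A.PosDef) : CFC.sqrt A * CFC.sqrt A = A ∧ (CFC.sqrt A).IsHermitian ∧
    IsUnit (CFC.sqrt A).det := by
  have h1 : CFC.sqrt A * CFC.sqrt A = A := CFC.sqrt_mul_sqrt_self A hA.posSemidef.nonneg
  have h2 : (CFC.sqrt A).IsHermitian := (CFC.sqrt_nonneg A).isSelfAdjoint
  refine ⟨h1, h2, isUnit_iff_ne_zero.2 fun h0 => ?_⟩
  have h3 := congrArg Matrix.det h1
  rw [Matrix.det_mul, h0, zero_mul] at h3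
  exact hA.det_pos.ne h3

theorem norm_sqrt_apply (hA : A.PosDef) (v : EuclideanSpace ℝ (Fin d)) :
    ‖𝓛 (CFC.sqrt A) v‖ = localNorm A v := by
  obtain ⟨h1, h2, -⟩ := sqrt_posDef hA
  rw [localNorm, ← Real.sqrt_sq (norm_nonneg _), ← real_inner_self_eq_norm_sq,
    inner_toEuclideanCLM_comm h2, ← toEuclideanCLM_mul_apply, h1]

theorem norm_sqrt_inv_apply (hA : A.PosDef) (v : EuclideanSpace ℝ (Fin d)) :
    ‖𝓛 (CFC.sqrt A)⁻¹ v‖ = localNorm A⁻¹ v := by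
  obtain ⟨h1, h2, -⟩ := sqrt_posDef hA
  rw [localNorm, ← Real.sqrt_sq (norm_nonneg _), ← real_inner_self_eq_norm_sq,
    inner_toEuclideanCLM_comm h2.inv, ← toEuclideanCLM_mul_apply, ← Matrix.mul_inv_rev, h1]

theorem abs_inner_le_localNorm (hA : A.PosDef) (g v : EuclideanSpace ℝ (Fin d)) :
    |inner ℝ g v| ≤ localNorm A⁻¹ g * localNorm A v := by
  obtain ⟨-, h2, h3⟩ := sqrt_posDef hA
  rw [← norm_sqrt_apply hA, ← norm_sqrt_inv_apply hA]
  refine le_trans (le_of_eq ?_) (abs_real_inner_le_norm _ _)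
  rw [inner_toEuclideanCLM_comm h2.inv, inv_mul_apply h3]

/-- The norm of `A⁻¹` is dual to the norm of `A`. -/
theorem localNorm_inv_le (hA : A.PosDef) {g : EuclideanSpace ℝ (Fin d)} {c : ℝ} (hc : 0 ≤ c)
    (h : ∀ v, inner ℝ g v ≤ c * localNorm A v) : localNorm A⁻¹ g ≤ c := by
  have h1 := h (𝓛 A⁻¹ g)
  have h2 : localNorm A (𝓛 A⁻¹ g) = localNorm A⁻¹ g := by
    rw [localNorm, mul_inv_apply hA.isUnit_det, real_inner_comm, localNorm]
  rw [h2, ← localNorm_sq hA.inv, sq] at h1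
  rcases (localNorm_nonneg A⁻¹ g).eq_or_lt with h3 | h3
  · rwa [← h3]
  · exact le_of_mul_le_mul_right h1 h3

/-- The trace of a symmetric matrix between `c • 1` and `C • 1`, compared with the logarithm of its
determinant through the function `t ↦ t - 1 - log t` of its eigenvalues. -/
theorem trace_sub_log_det_le {W : Matrix (Fin d) (Fin d) ℝ} (hW : W.IsHermitian) {c C b : ℝ}
    (hc : 0 < c)
    (hl : ∀ v : EuclideanSpace ℝ (Fin d), c * ‖v‖ ^ 2 ≤ inner ℝ v (𝓛 W v))
    (hu : ∀ v : EuclideanSpace ℝ (Fin d), inner ℝ v (𝓛 W v) ≤ C * ‖v‖ ^ 2)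
    (hb : ∀ t, c ≤ t → t ≤ C → t - 1 - Real.log t ≤ b) :
    W.trace - d - Real.log W.det ≤ d * b ∧ W.det ≤ C ^ d := by
  have heig : ∀ i, inner ℝ (hW.eigenvectorBasis i) (𝓛 W (hW.eigenvectorBasis i)) =
      hW.eigenvalues i := fun i => by
    rw [Matrix.inner_toEuclideanCLM, hW.eigenvalues_eq]
    simp
  have hlo : ∀ i, c ≤ hW.eigenvalues i := fun i => by
    have := hl (hW.eigenvectorBasis i)
    rwa [heig, OrthonormalBasis.norm_eq_one, one_pow, mul_one] at this
  have hup : ∀ i, hW.eigenvalues i ≤ C := fun i => by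
    have := hu (hW.eigenvectorBasis i)
    rwa [heig, OrthonormalBasis.norm_eq_one, one_pow, mul_one] at this
  have htr : W.trace = ∑ i, hW.eigenvalues i := by
    simpa using hW.trace_eq_sum_eigenvalues
  have hdet : W.det = ∏ i, hW.eigenvalues i := by
    simpa using hW.det_eq_prod_eigenvalues
  constructor
  · rw [htr, hdet, Real.log_prod (fun i _ => (hc.trans_le (hlo i)).ne')]
    have h1 : ∑ i, (hW.eigenvalues i - 1 - Real.log (hW.eigenvalues i)) ≤ ∑ _i : Fin d, b :=
      Finset.sum_le_sum fun i _ => hb _ (hlo i) (hup i)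
    simpa [Finset.sum_sub_distrib] using h1
  · rw [hdet]
    calc ∏ i, hW.eigenvalues i ≤ ∏ _i : Fin d, C :=
          Finset.prod_le_prod (fun i _ => (hc.trans_le (hlo i)).le) fun i _ => hup i
      _ = C ^ d := by simp

theorem sum_norm_sq_adjoint (M : Matrix (Fin d) (Fin d) ℝ) :
    ∑ i, ‖(𝓛 M).adjoint (EuclideanSpace.basisFun (Fin d) ℝ i)‖ ^ 2 = (M * Mᵀ).trace := by
  rw [adjoint_toEuclideanCLM, Matrix.trace]
  refine Finset.sum_congr rfl fun i _ => ?_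
  rw [EuclideanSpace.real_norm_sq_eq]
  simp [Matrix.mul_apply, Matrix.ofLp_toEuclideanCLM, sq]

section Whitening

variable {S₁ S₂ : Matrix (Fin d) (Fin d) ℝ}

/-- The matrix `S₂^{-1/2} S₁ S₂^{-1/2}`, factored as `M Mᵀ` with `M = S₂^{-1/2} S₁^{1/2}`. -/
theorem whitening (h₁ : S₁.PosDef) (h₂ : S₂.PosDef) :
    let M := (CFC.sqrt S₂)⁻¹ * CFC.sqrt S₁
    M * Mᵀ = (CFC.sqrt S₂)⁻¹ * S₁ * (CFC.sqrt S₂)⁻¹ ∧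
    (M * Mᵀ).IsHermitian ∧ (M * Mᵀ).det = S₁.det / S₂.det ∧
    ∀ v, inner ℝ v (𝓛 (M * Mᵀ) v) =
      inner ℝ (𝓛 (CFC.sqrt S₂)⁻¹ v) (𝓛 S₁ (𝓛 (CFC.sqrt S₂)⁻¹ v)) := by
  intro M
  obtain ⟨a1, a2, -⟩ := sqrt_posDef h₁
  obtain ⟨b1, b2, b3⟩ := sqrt_posDef h₂
  have ha : (CFC.sqrt S₁)ᵀ = CFC.sqrt S₁ := by
    rw [← Matrix.conjTranspose_eq_transpose_of_trivial]; exact a2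
  have hb : ((CFC.sqrt S₂)⁻¹)ᵀ = (CFC.sqrt S₂)⁻¹ := by
    rw [← Matrix.conjTranspose_eq_transpose_of_trivial]; exact b2.inv
  have hM : M * Mᵀ = (CFC.sqrt S₂)⁻¹ * S₁ * (CFC.sqrt S₂)⁻¹ := by
    rw [Matrix.transpose_mul, ha, hb]
    conv_rhs => rw [← a1]
    simp only [M, Matrix.mul_assoc]
  refine ⟨hM, ?_, ?_, fun v => ?_⟩
  · rw [← Matrix.conjTranspose_eq_transpose_of_trivial]
    exact Matrix.isHermitian_mul_conjTranspose_self M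
  · rw [hM, Matrix.det_mul, Matrix.det_mul, Matrix.det_nonsing_inv, Ring.inverse_eq_inv']
    conv_rhs => rw [← b1, Matrix.det_mul]
    have := b3.ne_zero
    field_simp
  · rw [hM, toEuclideanCLM_mul_apply, toEuclideanCLM_mul_apply, inner_toEuclideanCLM_comm b2.inv]

theorem whitening_bounds (h₁ : S₁.PosDef) (h₂ : S₂.PosDef) {c C : ℝ}
    (hl : ∀ v : EuclideanSpace ℝ (Fin d), c * inner ℝ v (𝓛 S₂ v) ≤ inner ℝ v (𝓛 S₁ v))
    (hu : ∀ v : EuclideanSpace ℝ (Fin d), inner ℝ v (𝓛 S₁ v) ≤ C * inner ℝ v (𝓛 S₂ v)) :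
    let M := (CFC.sqrt S₂)⁻¹ * CFC.sqrt S₁
    (∀ v : EuclideanSpace ℝ (Fin d), c * ‖v‖ ^ 2 ≤ inner ℝ v (𝓛 (M * Mᵀ) v)) ∧
    ∀ v : EuclideanSpace ℝ (Fin d), inner ℝ v (𝓛 (M * Mᵀ) v) ≤ C * ‖v‖ ^ 2 := by
  intro M
  obtain ⟨-, -, -, hW⟩ := whitening h₁ h₂
  obtain ⟨-, -, b3⟩ := sqrt_posDef h₂
  have hn : ∀ v : EuclideanSpace ℝ (Fin d), inner ℝ (𝓛 (CFC.sqrt S₂)⁻¹ v)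
      (𝓛 S₂ (𝓛 (CFC.sqrt S₂)⁻¹ v)) = ‖v‖ ^ 2 := fun v => by
    rw [← localNorm_sq h₂, ← norm_sqrt_apply h₂, mul_inv_apply b3]
  refine ⟨fun v => ?_, fun v => ?_⟩
  · rw [hW, ← hn]; exact hl _
  · rw [hW, ← hn]; exact hu _

/-- Monotonicity of the determinant, in the scaled form; the lower bound only serves to keep the
eigenvalues positive. -/
theorem det_le_of_inner_le (h₁ : S₁.PosDef) (h₂ : S₂.PosDef) {c C : ℝ} (hc : 0 < c)
    (hl : ∀ v : EuclideanSpace ℝ (Fin d), c * inner ℝ v (𝓛 S₂ v) ≤ inner ℝ v (𝓛 S₁ v))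
    (hu : ∀ v : EuclideanSpace ℝ (Fin d), inner ℝ v (𝓛 S₁ v) ≤ C * inner ℝ v (𝓛 S₂ v)) :
    S₁.det ≤ C ^ d * S₂.det := by
  obtain ⟨-, hH, hdet, -⟩ := whitening h₁ h₂
  obtain ⟨k1, k2⟩ := whitening_bounds h₁ h₂ hl hu
  have h := (trace_sub_log_det_le (b := C - 1 - Real.log c) hH hc k1 k2 fun t h1 h2 => by
    linarith [Real.log_le_log hc h1]).2
  rwa [hdet, div_le_iff₀ h₂.det_pos] at h

/-- Normal distributions with comparable covariances are close in total variation. Twice the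
relative entropy is the squared distance of the means plus `∑ (t - 1 - log t)` over the eigenvalues
of the whitened covariance. -/
theorem multivariateGaussian_real_sub_le (h₁ : S₁.PosDef) (h₂ : S₂.PosDef)
    (m₁ m₂ : EuclideanSpace ℝ (Fin d)) {c C b κ : ℝ} (hc : 0 < c)
    (hl : ∀ v : EuclideanSpace ℝ (Fin d), c * inner ℝ v (𝓛 S₂ v) ≤ inner ℝ v (𝓛 S₁ v))
    (hu : ∀ v : EuclideanSpace ℝ (Fin d), inner ℝ v (𝓛 S₁ v) ≤ C * inner ℝ v (𝓛 S₂ v))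
    (hb : ∀ t, c ≤ t → t ≤ C → t - 1 - Real.log t ≤ b) (hκ : 0 < κ)
    (hle : localNorm S₂⁻¹ (m₁ - m₂) ^ 2 + d * b ≤ κ) {A : Set (EuclideanSpace ℝ (Fin d))}
    (hA : MeasurableSet A) :
    (multivariateGaussian m₁ S₁).real A - (multivariateGaussian m₂ S₂).real A ≤ 1 / 2 * √κ := by
  obtain ⟨-, hH, hdet, -⟩ := whitening h₁ h₂
  obtain ⟨k1, k2⟩ := whitening_bounds h₁ h₂ hl hu
  obtain ⟨-, -, a3⟩ := sqrt_posDef h₁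
  obtain ⟨-, -, b3⟩ := sqrt_posDef h₂
  have htr := (trace_sub_log_det_le hH hc k1 k2 hb).1
  set M := (CFC.sqrt S₂)⁻¹ * CFC.sqrt S₁ with hM
  have hMdet : IsUnit M.det := by
    rw [hM, Matrix.det_mul]
    exact (Matrix.isUnit_nonsing_inv_det _ b3).mul a3
  set a := 𝓛 (CFC.sqrt S₂)⁻¹ (m₁ - m₂) with ha
  -- both distributions are images of a common pair under `v ↦ m₂ + S₂^{1/2} v`
  have hm : Measurable fun v : EuclideanSpace ℝ (Fin d) => m₂ + 𝓛 (CFC.sqrt S₂) v := by fun_prop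
  have hm' : Measurable fun v : EuclideanSpace ℝ (Fin d) => a + 𝓛 M v := by fun_prop
  have e1 : multivariateGaussian m₁ S₁ =
      ((stdGaussian (EuclideanSpace ℝ (Fin d))).map fun v => a + 𝓛 M v).map
        fun v => m₂ + 𝓛 (CFC.sqrt S₂) v := by
    rw [multivariateGaussian, Measure.map_map hm hm']
    congr 1
    funext v
    simp only [Function.comp, map_add, ha, hM]
    rw [mul_inv_apply b3, toEuclideanCLM_mul_apply, mul_inv_apply b3]
    abel
  have e2 : multivariateGaussian m₂ S₂ =
      (stdGaussian (EuclideanSpace ℝ (Fin d))).map fun v => m₂ + 𝓛 (CFC.sqrt S₂) v := rfl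
  rw [e1, e2, map_measureReal_apply hm hA, map_measureReal_apply hm hA]
  refine measureReal_map_affine_stdGaussian_sub_le (EuclideanSpace.basisFun (Fin d) ℝ) a (𝓛 M)
    (𝓛 M⁻¹) (fun x => inv_mul_apply hMdet x) ?_ hκ (le_trans ?_ hle) (hm hA)
  · rw [det_toEuclideanCLM]; exact hMdet.ne_zero
  · rw [sum_norm_sq_adjoint, det_toEuclideanCLM, ha, norm_sqrt_inv_apply h₂, Fintype.card_fin]
    rw [Matrix.det_mul, Matrix.det_transpose, ← sq] at htr
    gcongr

end Whitening

end MirrorLangevin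

/-! ### Local norms of a self-concordant mirror function -/

namespace MirrorLangevin

variable {d : ℕ} {A B : Matrix (Fin d) (Fin d) ℝ} {K : Set (EuclideanSpace ℝ (Fin d))}
  {φ : EuclideanSpace ℝ (Fin d) → ℝ} {α : ℝ} {x z : EuclideanSpace ℝ (Fin d)}

local notation "𝓛" => Matrix.toEuclideanCLM (𝕜 := ℝ)

theorem localNorm_add_le (hA : A.PosDef) (u v : EuclideanSpace ℝ (Fin d)) :
    localNorm A (u + v) ≤ localNorm A u + localNorm A v := by
  simp only [← norm_sqrt_apply hA, map_add]
  exact norm_add_le _ _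

theorem localNorm_smul (A : Matrix (Fin d) (Fin d) ℝ) (c : ℝ) (u : EuclideanSpace ℝ (Fin d)) :
    localNorm A (c • u) = |c| * localNorm A u := by
  rw [localNorm, localNorm, map_smul, inner_smul_left, inner_smul_right, ← mul_assoc]
  simp only [conj_trivial]
  rw [Real.sqrt_mul (mul_self_nonneg c), Real.sqrt_mul_self_eq_abs]

theorem localNorm_neg (A : Matrix (Fin d) (Fin d) ℝ) (u : EuclideanSpace ℝ (Fin d)) :
    localNorm A (-u) = localNorm A u := by
  simp [localNorm]

theorem localNorm_inv_smul_sq (hA : A.PosDef) {c : ℝ} (hc : 0 < c)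
    (u : EuclideanSpace ℝ (Fin d)) :
    localNorm (c • A)⁻¹ u ^ 2 = localNorm A⁻¹ u ^ 2 / c := by
  have h : (c • A)⁻¹ = c⁻¹ • A⁻¹ := by
    have : Invertible c := invertibleOfNonzero hc.ne'
    rw [Matrix.inv_smul A c hA.isUnit_det, invOf_eq_inv]
  rw [localNorm_sq (hA.smul hc).inv, localNorm_sq hA.inv, h, map_smul]
  simp only [_root_.smul_apply, inner_smul_right]
  ring

/-- An inequality between quadratic forms is reversed by inversion. -/
theorem localNorm_inv_le_div (hA : A.PosDef) (hB : B.PosDef) {k : ℝ} (hk : 0 < k)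
    (h : ∀ v : EuclideanSpace ℝ (Fin d), k ^ 2 * inner ℝ v (𝓛 A v) ≤ inner ℝ v (𝓛 B v))
    (g : EuclideanSpace ℝ (Fin d)) : localNorm B⁻¹ g ≤ localNorm A⁻¹ g / k := by
  refine localNorm_inv_le hB (div_nonneg (localNorm_nonneg _ _) hk.le) fun v => ?_
  have h1 : k * localNorm A v ≤ localNorm B v := by
    refine abs_le_of_sq_le_sq' ?_ (localNorm_nonneg _ _) |>.2
    rw [mul_pow, localNorm_sq hA, localNorm_sq hB]
    exact h v
  calc inner ℝ g v ≤ localNorm A⁻¹ g * localNorm A v :=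
        (le_abs_self _).trans (abs_inner_le_localNorm hA g v)
    _ = localNorm A⁻¹ g / k * (k * localNorm A v) := by field_simp
    _ ≤ localNorm A⁻¹ g / k * localNorm B v := by
        gcongr
        exact div_nonneg (localNorm_nonneg _ _) hk.le

/-- The quadratic form of the Hessian matrix is the second derivative. -/
theorem inner_hess (ψ : EuclideanSpace ℝ (Fin d) → ℝ) (x u v : EuclideanSpace ℝ (Fin d)) :
    inner ℝ u (𝓛 (hess ψ x) v) = iteratedFDeriv ℝ 2 ψ x ![u, v] := by
  have hu : u = ∑ i, u i • EuclideanSpace.single i (1 : ℝ) := by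
    simpa using ((EuclideanSpace.basisFun (Fin d) ℝ).sum_repr u).symm
  have hv : v = ∑ i, v i • EuclideanSpace.single i (1 : ℝ) := by
    simpa using ((EuclideanSpace.basisFun (Fin d) ℝ).sum_repr v).symm
  rw [iteratedFDeriv_two_apply, Matrix.inner_toEuclideanCLM]
  conv_rhs =>
    simp only [Matrix.cons_val_zero, Matrix.cons_val_one]
    rw [hu, hv]
  simp only [map_sum, map_smul, _root_.sum_apply, _root_.smul_apply,
    smul_eq_mul, dotProduct, Matrix.mulVec, hess, Matrix.of_apply, iteratedFDeriv_two_apply,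
    Matrix.cons_val_zero, Matrix.cons_val_one, Finset.mul_sum]
  rw [Finset.sum_comm]
  exact Finset.sum_congr rfl fun i _ => Finset.sum_congr rfl fun j _ => by ring

theorem localNorm_hess (ψ : EuclideanSpace ℝ (Fin d) → ℝ) (x u : EuclideanSpace ℝ (Fin d)) :
    localNorm (hess ψ x) u = hessNorm ψ x u := by
  rw [localNorm, inner_hess, hessNorm]

theorem IsSelfConcordant.selfConcordantOn (h : IsSelfConcordant K φ α) :
    SelfConcordantOn (interior K) φ α where
  isOpen := isOpen_interior
  nonneg := h.nonneg
  diff := h.differentiable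
  strictConvex := h.strictConvex
  bound x hx u := by
    have h1 := h.bound x hx u
    rw [localNorm, inner_hess] at h1
    convert h1 using 3
    ext i : 1
    fin_cases i <;> rfl

theorem IsSelfConcordant.posDef (h : IsSelfConcordant K φ α) (hx : x ∈ interior K) :
    (hess φ x).PosDef := by
  refine posDef_of_inner_pos ?_ fun v hv => ?_
  · ext i j
    simp only [Matrix.conjTranspose_apply, star_trivial, hess, Matrix.of_apply]
    exact iteratedFDeriv_two_comm isOpen_interior h.differentiable hx _ _
  · rw [inner_hess]
    exact h.selfConcordantOn.hess_pos hx hv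

theorem IsSelfConcordant.differentiableAt (h : IsSelfConcordant K φ α) (hx : x ∈ interior K) :
    DifferentiableAt ℝ φ x :=
  h.selfConcordantOn.differentiableAt hx

theorem IsSelfConcordant.continuousOn_gradient (h : IsSelfConcordant K φ α) :
    ContinuousOn (gradient φ) (interior K) := by
  have h1 := (contDiffOn_two_of_differentiableOn_iteratedFDeriv isOpen_interior
    h.differentiable).continuousOn_fderiv_of_isOpen isOpen_interior (by norm_num)
  exact (InnerProductSpace.toDual ℝ _).symm.continuous.comp_continuousOn h1

theorem IsSelfConcordant.hess_compare (h : IsSelfConcordant K φ α) (hx : x ∈ interior K)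
    (hz : z ∈ interior K) (hr : α * localNorm (hess φ x) (z - x) < 1)
    (v : EuclideanSpace ℝ (Fin d)) :
    (1 - α * localNorm (hess φ x) (z - x)) ^ 2 * inner ℝ v (𝓛 (hess φ x) v) ≤
        inner ℝ v (𝓛 (hess φ z) v) ∧
      (1 - α * localNorm (hess φ x) (z - x)) ^ 2 * inner ℝ v (𝓛 (hess φ z) v) ≤
        inner ℝ v (𝓛 (hess φ x) v) := by
  simp only [localNorm_hess, inner_hess] at hr ⊢
  simpa using h.selfConcordantOn.hess_line_compare hx (w := z - x) (by simpa using hz)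
    (t := 1) (by simp) hr v

theorem IsSelfConcordant.localNorm_gradient_sub_le (h : IsSelfConcordant K φ α)
    (hx : x ∈ interior K) (hz : z ∈ interior K) (hr : α * localNorm (hess φ x) (z - x) < 1) :
    localNorm (hess φ x)⁻¹ (gradient φ z - gradient φ x) ≤
      localNorm (hess φ x) (z - x) / (1 - α * localNorm (hess φ x) (z - x)) := by
  refine localNorm_inv_le (h.posDef hx)
    (div_nonneg (localNorm_nonneg _ _) (by linarith)) fun v => ?_
  rw [inner_sub_left, inner_gradient_left, inner_gradient_left]
  simp only [localNorm_hess] at hr ⊢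
  have := h.selfConcordantOn.abs_fderiv_sub_le hx (w := z - x) (by simpa using hz) hr v
  rw [add_sub_cancel] at this
  exact (le_abs_self _).trans this

theorem IsSelfConcordant.localNorm_gradient_sub_sub_le (h : IsSelfConcordant K φ α)
    (hx : x ∈ interior K) (hz : z ∈ interior K) (hr : α * localNorm (hess φ x) (z - x) < 1) :
    localNorm (hess φ x)⁻¹ (gradient φ z - gradient φ x - 𝓛 (hess φ x) (z - x)) ≤
      2 * α * localNorm (hess φ x) (z - x) ^ 2 / (1 - α * localNorm (hess φ x) (z - x)) ^ 3 := by
  have hα := h.nonneg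
  have h0 : 0 < 1 - α * localNorm (hess φ x) (z - x) := by linarith
  refine localNorm_inv_le (h.posDef hx) (by positivity) fun v => ?_
  rw [inner_sub_left, inner_sub_left, inner_gradient_left, inner_gradient_left,
    inner_toEuclideanCLM_comm (h.posDef hx).isHermitian, inner_hess]
  simp only [localNorm_hess] at hr ⊢
  have := h.selfConcordantOn.abs_fderiv_sub_sub_le hx (w := z - x) (by simpa using hz) hr v
  rw [add_sub_cancel] at this
  exact (le_abs_self _).trans this

theorem IsSelfConcordant.le_inner_gradient_sub (h : IsSelfConcordant K φ α)
    (hx : x ∈ interior K) (hz : z ∈ interior K) :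
    localNorm (hess φ x) (z - x) ^ 2 / (1 + α * localNorm (hess φ x) (z - x)) ≤
      inner ℝ (gradient φ z - gradient φ x) (z - x) := by
  rw [inner_sub_left, inner_gradient_left, inner_gradient_left]
  simp only [localNorm_hess]
  have := h.selfConcordantOn.le_fderiv_sub hx (w := z - x) (by simpa using hz)
  rwa [add_sub_cancel] at this

theorem IsSelfConcordant.localNorm_inv_le_div (h : IsSelfConcordant K φ α) (hx : x ∈ interior K)
    (hz : z ∈ interior K) (hr : α * localNorm (hess φ x) (z - x) < 1)
    (g : EuclideanSpace ℝ (Fin d)) :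
    localNorm (hess φ z)⁻¹ g ≤
        localNorm (hess φ x)⁻¹ g / (1 - α * localNorm (hess φ x) (z - x)) ∧
      localNorm (hess φ x)⁻¹ g ≤
        localNorm (hess φ z)⁻¹ g / (1 - α * localNorm (hess φ x) (z - x)) :=
  ⟨MirrorLangevin.localNorm_inv_le_div (h.posDef hx) (h.posDef hz) (by linarith)
    (fun v => (h.hess_compare hx hz hr v).1) g,
  MirrorLangevin.localNorm_inv_le_div (h.posDef hz) (h.posDef hx) (by linarith)
    (fun v => (h.hess_compare hx hz hr v).2) g⟩

theorem IsRelLipschitz.nonneg {f : EuclideanSpace ℝ (Fin d) → ℝ} {β : ℝ}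
    (h : IsRelLipschitz K f φ β) (hx : x ∈ interior K) : 0 ≤ β :=
  (localNorm_nonneg _ _).trans (h.bound x hx)

/-- The continuity of `∇φ`, needed for the continuity of its inverse, comes from
self-concordance. -/
theorem IsSelfConcordant.gradient_convexConj (h : IsSelfConcordant K φ α) (hK : IsCompact K)
    (hKc : Convex ℝ K) (hL : IsLegendre K φ) (hx : x ∈ interior K) :
    Continuous (gradient (convexConj K φ)) ∧
    (∀ y, gradient (convexConj K φ) y ∈ interior K ∧
      gradient φ (gradient (convexConj K φ) y) = y) ∧
    ∀ x ∈ interior K, gradient (convexConj K φ) (gradient φ x) = x :=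
  MirrorLangevin.gradient_convexConj hK hKc ⟨x, hx⟩ hL h.continuousOn_gradient

end MirrorLangevin

/-! ### Proposals from nearby points -/

namespace MirrorLangevin

variable {d : ℕ} {K : Set (EuclideanSpace ℝ (Fin d))}
  {φ f : EuclideanSpace ℝ (Fin d) → ℝ} {α β h : ℝ} {x y : EuclideanSpace ℝ (Fin d)}

local notation "𝓛" => Matrix.toEuclideanCLM (𝕜 := ℝ)

theorem sub_one_sub_log_le {s t : ℝ} (hs : s ≤ 1 / 10) (h1 : (1 - s) ^ 2 ≤ t)
    (h2 : t ≤ ((1 - s) ^ 2)⁻¹) : t - 1 - Real.log t ≤ 5 * s ^ 2 := by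
  have hq : 0 < 1 - s := by linarith
  have hq2 : 0 < (1 - s) ^ 2 := by positivity
  have ht : 0 < t := hq2.trans_le h1
  have hlog := Real.one_sub_inv_le_log_of_pos ht
  -- `t + t⁻¹` is largest at the end points of the interval
  have hsum : t + t⁻¹ ≤ (1 - s) ^ 2 + ((1 - s) ^ 2)⁻¹ := by
    have h3 : 0 ≤ (t - (1 - s) ^ 2) * (((1 - s) ^ 2)⁻¹ - t) :=
      mul_nonneg (sub_nonneg.2 h1) (sub_nonneg.2 h2)
    have h4 : (t - (1 - s) ^ 2) * (((1 - s) ^ 2)⁻¹ - t) =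
        t * ((1 - s) ^ 2 + ((1 - s) ^ 2)⁻¹ - (t + t⁻¹)) := by
      field_simp
      ring
    rw [h4] at h3
    linarith [nonneg_of_mul_nonneg_right h3 ht]
  have hend : (1 - s) ^ 2 + ((1 - s) ^ 2)⁻¹ - 2 ≤ 5 * s ^ 2 := by
    have h5 : (1 - s) ^ 2 + ((1 - s) ^ 2)⁻¹ - 2 = s ^ 2 * (2 - s) ^ 2 / (1 - s) ^ 2 := by
      field_simp
      ring
    rw [h5, div_le_iff₀ hq2, mul_comm 5, mul_assoc]
    gcongr
    nlinarith
  linarith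

/-- The bound for the proposals before the application of `∇φ*`. -/
theorem multivariateGaussian_proposal_sub_le (hsc : IsSelfConcordant K φ α)
    (hlip : IsRelLipschitz K f φ β) (hh0 : 0 < h) (hh1 : h < 1) (hx : x ∈ interior K)
    (hy : y ∈ interior K) (hxy : localNorm (hess φ y) (x - y) ≤ √h / (10 * max 1 α))
    {A : Set (EuclideanSpace ℝ (Fin d))} (hA : MeasurableSet A) :
    (multivariateGaussian (gradient φ x - h • gradient f x) ((2 * h) • hess φ x)).real A -
      (multivariateGaussian (gradient φ y - h • gradient f y) ((2 * h) • hess φ y)).real A ≤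
    1 / 2 * √(h * d / 20 + 1 / 80 + 9 / 2 * h * β ^ 2) := by
  have hα := hsc.nonneg
  have hβ := hlip.nonneg hx
  set r := localNorm (hess φ y) (x - y) with hr
  have hr0 : 0 ≤ r := localNorm_nonneg _ _
  have hsq : √h ^ 2 = h := Real.sq_sqrt hh0.le
  have hsq1 : √h ≤ 1 := Real.sqrt_le_one.2 hh1.le
  have hsq0 : 0 ≤ √h := Real.sqrt_nonneg h
  have hmax : 1 ≤ max 1 α := le_max_left _ _
  have hmr : max 1 α * r ≤ √h / 10 := by
    rw [le_div_iff₀ (by positivity)] at hxy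
    linarith
  have hr1 : r ≤ √h / 10 := le_trans (by nlinarith) hmr
  have hs : α * r ≤ √h / 10 :=
    (mul_le_mul_of_nonneg_right (le_max_right 1 α) hr0).trans hmr
  have hs0 : 0 ≤ α * r := by positivity
  have hs1 : α * r ≤ 1 / 10 := by linarith
  have hs9 : 9 / 10 ≤ 1 - α * r := by linarith
  have h2h : 0 < 2 * h := by positivity
  have hcmp := hsc.hess_compare hy hx (by linarith)
  have hinv := (hsc.localNorm_inv_le_div hy hx (by linarith) (gradient f x)).2
  rw [← hr] at hcmp hinv
  refine multivariateGaussian_real_sub_le ((hsc.posDef hx).smul h2h) ((hsc.posDef hy).smul h2h)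
    _ _ (c := (1 - α * r) ^ 2) (C := ((1 - α * r) ^ 2)⁻¹) (b := h / 20) (by positivity)
    (fun v => ?_) (fun v => ?_) (fun t h1 h2 => ?_) (by positivity) ?_ hA
  · simp only [map_smul, _root_.smul_apply, inner_smul_right]
    nlinarith [(hcmp v).1]
  · simp only [map_smul, _root_.smul_apply, inner_smul_right]
    rw [inv_mul_eq_div, le_div_iff₀ (by positivity)]
    nlinarith [(hcmp v).2]
  · refine (sub_one_sub_log_le hs1 h1 h2).trans ?_
    nlinarith
  · rw [localNorm_inv_smul_sq (hsc.posDef hy) h2h]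
    -- the mirror map contributes `√h / 9` to the distance of the means, the drift the rest
    have hmean : localNorm (hess φ y)⁻¹
        (gradient φ x - h • gradient f x - (gradient φ y - h • gradient f y)) ≤
        √h / 9 + h * (19 / 9 * β) := by
      have e : gradient φ x - h • gradient f x - (gradient φ y - h • gradient f y) =
          (gradient φ x - gradient φ y) + (h • -gradient f x + h • gradient f y) := by
        module
      rw [e]
      have hinvPD := (hsc.posDef hy).inv
      refine (localNorm_add_le hinvPD _ _).trans (add_le_add ?_ ?_)
      · refine (hsc.localNorm_gradient_sub_le hy hx (by linarith)).trans ?_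
        rw [← hr, div_le_iff₀ (by linarith)]
        nlinarith
      · refine (localNorm_add_le hinvPD _ _).trans ?_
        rw [localNorm_smul, localNorm_smul, localNorm_neg, abs_of_pos hh0, ← mul_add]
        have h1 : localNorm (hess φ y)⁻¹ (gradient f x) ≤ 10 / 9 * β := by
          refine hinv.trans ?_
          rw [div_le_iff₀ (by linarith)]
          nlinarith [hlip.bound x hx]
        have h2 := hlip.bound y hy
        gcongr
        linarith
    have h3 : localNorm (hess φ y)⁻¹
        (gradient φ x - h • gradient f x - (gradient φ y - h • gradient f y)) ^ 2 ≤
        2 * (h / 81 + h ^ 2 * (361 / 81 * β ^ 2)) := by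
      refine (pow_le_pow_left₀ (localNorm_nonneg _ _) hmean 2).trans ?_
      nlinarith [sq_nonneg (√h / 9 - h * (19 / 9 * β))]
    have h4 : localNorm (hess φ y)⁻¹
        (gradient φ x - h • gradient f x - (gradient φ y - h • gradient f y)) ^ 2 / (2 * h) ≤
        1 / 81 + h * (361 / 81 * β ^ 2) := by
      rw [div_le_iff₀ h2h]
      linarith
    have h5 : 0 ≤ h * β ^ 2 := by positivity
    linarith

theorem tvDist_proposal_le (hK : IsCompact K) (hKc : Convex ℝ K) (hL : IsLegendre K φ)
    (hsc : IsSelfConcordant K φ α)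
    (hlip : IsRelLipschitz K f φ β) (hh0 : 0 < h) (hh1 : h < 1) (hx : x ∈ interior K)
    (hy : y ∈ interior K) (hxy : localNorm (hess φ y) (x - y) ≤ √h / (10 * max 1 α)) :
    tvDist (proposal K φ f h x) (proposal K φ f h y) ≤
      1 / 2 * √(h * d / 20 + 1 / 80 + 9 / 2 * h * β ^ 2) := by
  have hm := (hsc.gradient_convexConj hK hKc hL hx).1.measurable
  have : Nonempty {A : Set (EuclideanSpace ℝ (Fin d)) // MeasurableSet A} := ⟨⟨∅, .empty⟩⟩
  refine ciSup_le fun A => ?_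
  rw [proposal, proposal, map_measureReal_apply hm A.2, map_measureReal_apply hm A.2]
  exact multivariateGaussian_proposal_sub_le hsc hlip hh0 hh1 hx hy hxy (hm A.2)

end MirrorLangevin

/-! ### The acceptance probability -/

namespace MirrorLangevin

variable {d : ℕ} {K : Set (EuclideanSpace ℝ (Fin d))}
  {φ f : EuclideanSpace ℝ (Fin d) → ℝ} {α β lam h : ℝ} {x z : EuclideanSpace ℝ (Fin d)}

local notation "𝓛" => Matrix.toEuclideanCLM (𝕜 := ℝ)

/-- The normalizing constant of the target density is positive, since `f` is bounded below by an
affine function on the interior of `K`. -/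
theorem integral_exp_neg_pos (hK : IsCompact K) (hKc : Convex ℝ K) (hx : x ∈ interior K)
    (hd : DifferentiableOn ℝ f (interior K)) (hf : ConvexOn ℝ (interior K) f) :
    0 < ∫ y in K, Real.exp (-f y) := by
  have hfr : volume (K \ interior K) = 0 := by
    rw [← hK.isClosed.frontier_eq]
    exact hKc.addHaar_frontier volume
  have hae : (interior K : Set _) =ᵐ[volume] K :=
    (Filter.EventuallyLE.antisymm interior_subset.eventuallyLE
      (ae_le_set.2 hfr))
  rw [← setIntegral_congr_set hae]
  obtain ⟨R, hR⟩ := hK.isBounded.exists_norm_le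
  have hfin : volume (interior K) < ∞ := (measure_mono interior_subset).trans_lt hK.measure_lt_top
  have hbd : ∀ y ∈ interior K, ‖Real.exp (-f y)‖ ≤
      Real.exp (‖fderiv ℝ f x‖ * (R + ‖x‖) - f x) := fun y hy => by
    rw [Real.norm_eq_abs, abs_of_pos (Real.exp_pos _), Real.exp_le_exp]
    have h1 := hf.add_fderiv_le hx hy (hd.differentiableAt (isOpen_interior.mem_nhds hx))
    have h2 : ‖fderiv ℝ f x (y - x)‖ ≤ ‖fderiv ℝ f x‖ * (R + ‖x‖) :=
      ((fderiv ℝ f x).le_opNorm _).trans (by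
        gcongr
        exact (norm_sub_le _ _).trans (by gcongr; exact hR y (interior_subset hy)))
    have h3 := (abs_le.1 h2).1
    linarith
  have hint : IntegrableOn (fun y => Real.exp (-f y)) (interior K) :=
    IntegrableOn.of_bound hfin
      ((Real.continuous_exp.comp_continuousOn hd.continuousOn.neg).aestronglyMeasurable
        isOpen_interior.measurableSet) _
      ((ae_restrict_iff' isOpen_interior.measurableSet).2 (ae_of_all _ hbd))
  rw [setIntegral_pos_iff_support_of_nonneg_ae (ae_of_all _ fun y => (Real.exp_pos _).le) hint]
  have hsupp : (Function.support fun y => Real.exp (-f y)) = Set.univ :=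
    Set.eq_univ_of_forall fun y => (Real.exp_pos _).ne'
  rw [hsupp, Set.univ_inter]
  exact isOpen_interior.measure_pos _ ⟨x, hx⟩

theorem localNorm_inv_add_sq {A : Matrix (Fin d) (Fin d) ℝ} (hA : A.PosDef)
    (u v : EuclideanSpace ℝ (Fin d)) :
    localNorm A⁻¹ (u + v) ^ 2 =
      localNorm A⁻¹ u ^ 2 + 2 * inner ℝ v (𝓛 A⁻¹ u) + localNorm A⁻¹ v ^ 2 := by
  rw [localNorm_sq hA.inv, localNorm_sq hA.inv, localNorm_sq hA.inv, map_add, inner_add_left,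
    inner_add_right, inner_add_right, ← inner_toEuclideanCLM_comm hA.inv.isHermitian u v,
    real_inner_comm v]
  ring

theorem abs_inner_inv_le {A : Matrix (Fin d) (Fin d) ℝ} (hA : A.PosDef)
    (g u : EuclideanSpace ℝ (Fin d)) :
    |inner ℝ g (𝓛 A⁻¹ u)| ≤ localNorm A⁻¹ g * localNorm A⁻¹ u := by
  refine (abs_inner_le_localNorm hA g _).trans (le_of_eq ?_)
  rw [localNorm.eq_1 A, mul_inv_apply hA.isUnit_det, real_inner_comm, localNorm.eq_1 A⁻¹ u]

/-- Convexity bounds the increment of `f` at `z`, relative smoothness bounds it at `x`; the average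
of the two bounds pairs with the cross terms of the proposal densities. -/
theorem sub_ge_of_relSmooth (hsc : IsSelfConcordant K φ α) (hsm : IsRelSmooth K f φ lam)
    (hx : x ∈ interior K) (hz : z ∈ interior K) :
    -(1 / 2) * (inner ℝ (gradient f x) (z - x) + inner ℝ (gradient f z) (z - x)) -
      lam / 2 * inner ℝ (gradient φ z - gradient φ x) (z - x) ≤ f x - f z := by
  have dfx := hsm.differentiable.differentiableAt (isOpen_interior.mem_nhds hx)
  have dfz := hsm.differentiable.differentiableAt (isOpen_interior.mem_nhds hz)
  have dφx := hsc.differentiableAt hx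
  have dφz := hsc.differentiableAt hz
  have h1 := hsm.convex.add_fderiv_le hz hx dfz
  have h2 := hsm.rel.add_fderiv_le hx hz ((dφx.const_mul lam).sub dfx)
  have h3 := hsc.strictConvex.convexOn.add_fderiv_le hz hx dφz
  rw [fderiv_fun_sub (dφx.const_mul lam) dfx, fderiv_const_mul dφx] at h2
  simp only [_root_.sub_apply, _root_.smul_apply, smul_eq_mul] at h2
  rw [← neg_sub z x, map_neg] at h1 h3
  rw [inner_sub_left, inner_gradient_left, inner_gradient_left, inner_gradient_left,
    inner_gradient_left]
  have h4 := mul_le_mul_of_nonneg_left h3 hsm.nonneg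
  linarith

/-- A lower bound for the exponent of the acceptance ratio. The terms are the drift, the change of
the norm of `∇φ(z) - ∇φ(x)` between `x` and `z`, the relative smoothness of `f`, and the
linearization errors of the mirror map at `x` and at `z`. -/
theorem acceptance_exponent_ge (hsc : IsSelfConcordant K φ α) (hsm : IsRelSmooth K f φ lam)
    (hlip : IsRelLipschitz K f φ β) (hh0 : 0 < h) (hx : x ∈ interior K) (hz : z ∈ interior K)
    {r ρ : ℝ} (hr : localNorm (hess φ x) (z - x) ≤ r) (hαr : α * r ≤ 1 / 100)
    (hρ : localNorm (hess φ x)⁻¹ (gradient φ z - gradient φ x) ≤ ρ) :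
    -(h * β ^ 2 / 4 + ρ ^ 2 / (4 * h) * (21 / 10 * (α * r)) + lam / 2 * (ρ * r) +
        11 / 5 * (α * β) * r ^ 2) ≤
      f x - f z +
        localNorm (hess φ x)⁻¹ (gradient φ z - gradient φ x + h • gradient f x) ^ 2 / (4 * h) -
        localNorm (hess φ z)⁻¹ (gradient φ x - gradient φ z + h • gradient f z) ^ 2 / (4 * h) := by
  have hα := hsc.nonneg
  have hβ := hlip.nonneg hx
  have hlam := hsm.nonneg
  have hHx := hsc.posDef hx
  have hHz := hsc.posDef hz
  set r₀ := localNorm (hess φ x) (z - x) with hr₀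
  have hr₀0 : 0 ≤ r₀ := localNorm_nonneg _ _
  have hr0 : 0 ≤ r := hr₀0.trans hr
  have ht0 : 0 ≤ α * r₀ := by positivity
  have htr : α * r₀ ≤ α * r := by gcongr
  have ht : α * r₀ ≤ 1 / 100 := htr.trans hαr
  have hq : 99 / 100 ≤ 1 - α * r₀ := by linarith
  set D := gradient φ z - gradient φ x with hD
  have hD' : gradient φ x - gradient φ z = -D := by rw [hD, neg_sub]
  -- the dual norms of `D` at `x` and `z`
  have hDz : localNorm (hess φ z)⁻¹ (-D) ^ 2 ≤
      localNorm (hess φ x)⁻¹ D ^ 2 + ρ ^ 2 * (21 / 10 * (α * r)) := by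
    have h1 := (hsc.localNorm_inv_le_div hx hz (by linarith) D).1
    rw [← hr₀, le_div_iff₀ (by linarith)] at h1
    have h2 : (localNorm (hess φ z)⁻¹ D * (1 - α * r₀)) ^ 2 ≤ localNorm (hess φ x)⁻¹ D ^ 2 :=
      pow_le_pow_left₀ (mul_nonneg (localNorm_nonneg _ _) (by linarith)) h1 2
    have h3 : localNorm (hess φ z)⁻¹ D ^ 2 ≤
        localNorm (hess φ x)⁻¹ D ^ 2 * (1 + 21 / 10 * (α * r₀)) := by
      have h4 : 1 ≤ (1 - α * r₀) ^ 2 * (1 + 21 / 10 * (α * r₀)) := by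
        nlinarith [mul_nonneg ht0 ht0, mul_nonneg (mul_nonneg ht0 ht0) ht0]
      calc localNorm (hess φ z)⁻¹ D ^ 2
          ≤ localNorm (hess φ z)⁻¹ D ^ 2 * ((1 - α * r₀) ^ 2 * (1 + 21 / 10 * (α * r₀))) :=
            le_mul_of_one_le_right (sq_nonneg _) h4
        _ = (localNorm (hess φ z)⁻¹ D * (1 - α * r₀)) ^ 2 * (1 + 21 / 10 * (α * r₀)) := by ring
        _ ≤ _ := by gcongr
    have h5 : localNorm (hess φ x)⁻¹ D ^ 2 ≤ ρ ^ 2 :=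
      pow_le_pow_left₀ (localNorm_nonneg _ _) hρ 2
    rw [localNorm_neg]
    have h6 : localNorm (hess φ x)⁻¹ D ^ 2 * (21 / 10 * (α * r₀)) ≤
        ρ ^ 2 * (21 / 10 * (α * r)) := by gcongr
    linarith
  -- the linearizations of the mirror map at `x` and `z`
  have hEx : |inner ℝ (gradient f x) (𝓛 (hess φ x)⁻¹ D) - inner ℝ (gradient f x) (z - x)| ≤
      β * (21 / 10 * (α * r ^ 2)) := by
    have h1 : inner ℝ (gradient f x) (𝓛 (hess φ x)⁻¹ D) - inner ℝ (gradient f x) (z - x) =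
        inner ℝ (gradient f x) (𝓛 (hess φ x)⁻¹ (D - 𝓛 (hess φ x) (z - x))) := by
      rw [map_sub _ D, inv_mul_apply hHx.isUnit_det, inner_sub_right _ _ (z - x)]
    rw [h1]
    refine (abs_inner_inv_le hHx _ _).trans
      (mul_le_mul (hlip.bound x hx) ?_ (localNorm_nonneg _ _) hβ)
    refine (hsc.localNorm_gradient_sub_sub_le hx hz (by linarith)).trans ?_
    rw [← hr₀, div_le_iff₀ (by positivity)]
    have h2 : (99 / 100 : ℝ) ^ 3 ≤ (1 - α * r₀) ^ 3 := by gcongr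
    calc 2 * α * r₀ ^ 2 ≤ 2 * α * r ^ 2 := by gcongr
      _ ≤ 21 / 10 * (α * r ^ 2) * (99 / 100) ^ 3 := by nlinarith [mul_nonneg hα (sq_nonneg r)]
      _ ≤ _ := by gcongr
  have hEz : |inner ℝ (gradient f z) (𝓛 (hess φ z)⁻¹ (-D)) - inner ℝ (gradient f z) (x - z)| ≤
      β * (23 / 10 * (α * r ^ 2)) := by
    have h1 : inner ℝ (gradient f z) (𝓛 (hess φ z)⁻¹ (-D)) - inner ℝ (gradient f z) (x - z) =
        inner ℝ (gradient f z) (𝓛 (hess φ z)⁻¹ (-D - 𝓛 (hess φ z) (x - z))) := by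
      rw [map_sub _ (-D), inv_mul_apply hHz.isUnit_det, inner_sub_right _ _ (x - z)]
    rw [h1]
    have hrz : localNorm (hess φ z) (x - z) ≤ 100 / 99 * r := by
      have h2 := (hsc.hess_compare hx hz (by linarith) (z - x)).2
      rw [← hr₀, ← localNorm_sq hHx, ← localNorm_sq hHz, ← mul_pow, ← hr₀] at h2
      have h3 := (abs_le_of_sq_le_sq' h2 hr₀0).2
      rw [← localNorm_neg, neg_sub]
      nlinarith [localNorm_nonneg (hess φ z) (z - x)]
    have hrz0 := localNorm_nonneg (hess φ z) (x - z)
    have hαz : α * localNorm (hess φ z) (x - z) ≤ 1 / 99 := by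
      calc α * localNorm (hess φ z) (x - z) ≤ α * (100 / 99 * r) := by gcongr
        _ = 100 / 99 * (α * r) := by ring
        _ ≤ 1 / 99 := by linarith
    refine (abs_inner_inv_le hHz _ _).trans
      (mul_le_mul (hlip.bound z hz) ?_ (localNorm_nonneg _ _) hβ)
    have h4 := hsc.localNorm_gradient_sub_sub_le hz hx (by linarith)
    rw [hD'] at h4
    refine h4.trans ?_
    have h5 : 98 / 99 ≤ 1 - α * localNorm (hess φ z) (x - z) := by linarith
    rw [div_le_iff₀ (by positivity)]
    have h6 : (98 / 99 : ℝ) ^ 3 ≤ (1 - α * localNorm (hess φ z) (x - z)) ^ 3 := by gcongr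
    calc 2 * α * localNorm (hess φ z) (x - z) ^ 2 ≤ 2 * α * (100 / 99 * r) ^ 2 := by gcongr
      _ ≤ 23 / 10 * (α * r ^ 2) * (98 / 99) ^ 3 := by nlinarith [mul_nonneg hα (sq_nonneg r)]
      _ ≤ _ := by gcongr
  have hEx' := (abs_le.1 hEx).1
  have hEz' := (abs_le.1 hEz).2
  have hf := sub_ge_of_relSmooth hsc hsm hx hz
  have hDδ : inner ℝ D (z - x) ≤ ρ * r :=
    ((le_abs_self _).trans (abs_inner_le_localNorm hHx D (z - x))).trans
      (mul_le_mul hρ hr hr₀0 ((localNorm_nonneg _ _).trans hρ))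
  have hlD := mul_le_mul_of_nonneg_left hDδ (by positivity : 0 ≤ lam / 2)
  have hgz : localNorm (hess φ z)⁻¹ (h • gradient f z) ^ 2 ≤ h ^ 2 * β ^ 2 := by
    rw [localNorm_smul, abs_of_pos hh0, mul_pow]
    have := hlip.bound z hz
    have := localNorm_nonneg (hess φ z)⁻¹ (gradient f z)
    gcongr
  rw [hD', localNorm_inv_add_sq hHx, localNorm_inv_add_sq hHz, inner_smul_left, inner_smul_left,
    conj_trivial]
  have hsub : inner ℝ (gradient f z) (x - z) = -inner ℝ (gradient f z) (z - x) := by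
    rw [← inner_neg_right, neg_sub]
  rw [hsub] at hEz'
  have hgx := sq_nonneg (localNorm (hess φ x)⁻¹ (h • gradient f x))
  have key : (localNorm (hess φ x)⁻¹ D ^ 2 + 2 * (h * inner ℝ (gradient f x) (𝓛 (hess φ x)⁻¹ D)) +
        localNorm (hess φ x)⁻¹ (h • gradient f x) ^ 2) / (4 * h) -
      (localNorm (hess φ z)⁻¹ (-D) ^ 2 +
        2 * (h * inner ℝ (gradient f z) (𝓛 (hess φ z)⁻¹ (-D))) +
        localNorm (hess φ z)⁻¹ (h • gradient f z) ^ 2) / (4 * h) ≥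
      -(ρ ^ 2 / (4 * h) * (21 / 10 * (α * r))) - h * β ^ 2 / 4 +
        1 / 2 * (inner ℝ (gradient f x) (𝓛 (hess φ x)⁻¹ D) -
          inner ℝ (gradient f z) (𝓛 (hess φ z)⁻¹ (-D))) := by
    rw [← sub_div, ge_iff_le, le_div_iff₀ (by positivity)]
    have e : ρ ^ 2 / (4 * h) * (21 / 10 * (α * r)) * (4 * h) = ρ ^ 2 * (21 / 10 * (α * r)) := by
      field_simp
    linarith
  linarith

theorem pow_le_det_ratio {a b q : ℝ} (ha : 0 < a) (hb : 0 < b) (hq : 0 ≤ q)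
    (h : q ^ 2 * b ≤ a) : q ^ 3 ≤ a * √a / (b * √b) := by
  have h1 : q * √b ≤ √a := by
    refine abs_le_of_sq_le_sq' ?_ (Real.sqrt_nonneg _) |>.2
    rwa [mul_pow, Real.sq_sqrt hb.le, Real.sq_sqrt ha.le]
  rw [le_div_iff₀ (by positivity)]
  calc q ^ 3 * (b * √b) = (q ^ 2 * b) * (q * √b) := by ring
    _ ≤ a * √a := by gcongr

theorem acceptance_ratio_eq (hK : IsCompact K) (hKc : Convex ℝ K) (hsc : IsSelfConcordant K φ α)
    (hsm : IsRelSmooth K f φ lam) (hh0 : 0 < h) (hx : x ∈ interior K) (hz : z ∈ interior K) :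
    targetDensity K f z * proposalDensity φ f h z x /
      (targetDensity K f x * proposalDensity φ f h x z) =
    (hess φ x).det * √(hess φ x).det / ((hess φ z).det * √(hess φ z).det) *
      Real.exp (f x - f z +
        localNorm (hess φ x)⁻¹ (gradient φ z - gradient φ x + h • gradient f x) ^ 2 / (4 * h) -
        localNorm (hess φ z)⁻¹ (gradient φ x - gradient φ z + h • gradient f z) ^ 2 / (4 * h)) := by
  have hZ := integral_exp_neg_pos hK hKc hx hsm.differentiable hsm.convex
  have hc : 0 < (4 * h * Real.pi) ^ ((d : ℝ) / 2) := by positivity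
  have ha := (hsc.posDef hx).det_pos
  have hb := (hsc.posDef hz).det_pos
  rw [targetDensity, Set.indicator_of_mem (interior_subset hz),
    Set.indicator_of_mem (interior_subset hx), proposalDensity, proposalDensity]
  have hsa : 0 < √(hess φ x).det := Real.sqrt_pos.2 ha
  have hsb : 0 < √(hess φ z).det := Real.sqrt_pos.2 hb
  generalize localNorm (hess φ x)⁻¹ (gradient φ z - gradient φ x + h • gradient f x) ^ 2 /
    (4 * h) = w₁
  generalize localNorm (hess φ z)⁻¹ (gradient φ x - gradient φ z + h • gradient f z) ^ 2 /
    (4 * h) = w₂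
  generalize (4 * h * Real.pi) ^ ((d : ℝ) / 2) = c at *
  generalize ∫ y in K, Real.exp (-f y) = Z at *
  simp only [Real.exp_sub, Real.exp_add, Real.exp_neg]
  field_simp

/-- The acceptance probability is close to `1` for proposals close to `x`. -/
theorem le_acceptProb (hK : IsCompact K) (hKc : Convex ℝ K) (hsc : IsSelfConcordant K φ α)
    (hsm : IsRelSmooth K f φ lam)
    (hlip : IsRelLipschitz K f φ β) (hh0 : 0 < h) (hx : x ∈ interior K) (hz : z ∈ interior K)
    {r ρ : ℝ} (hr : localNorm (hess φ x) (z - x) ≤ r) (hαr : α * r ≤ 1 / 100)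
    (hρ : localNorm (hess φ x)⁻¹ (gradient φ z - gradient φ x) ≤ ρ) :
    1 - (3 * d * (α * r) + h * β ^ 2 / 4 + ρ ^ 2 / (4 * h) * (21 / 10 * (α * r)) +
      lam / 2 * (ρ * r) + 11 / 5 * (α * β) * r ^ 2) ≤ acceptProb K φ f h x z := by
  have hα := hsc.nonneg
  have hβ := hlip.nonneg hx
  have hlam := hsm.nonneg
  have hexp := acceptance_exponent_ge hsc hsm hlip hh0 hx hz hr hαr hρ
  have hr0 := (localNorm_nonneg _ _).trans hr
  have hρ0 := (localNorm_nonneg _ _).trans hρ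
  rw [acceptProb, acceptance_ratio_eq hK hKc hsc hsm hh0 hx hz]
  set E := h * β ^ 2 / 4 + ρ ^ 2 / (4 * h) * (21 / 10 * (α * r)) + lam / 2 * (ρ * r) +
    11 / 5 * (α * β) * r ^ 2 with hE
  have hE0 : 0 ≤ E := by positivity
  have hp0 : 0 ≤ 3 * d * (α * r) := by positivity
  refine le_min (by linarith) ?_
  have ha := (hsc.posDef hx).det_pos
  have hb := (hsc.posDef hz).det_pos
  set r₀ := localNorm (hess φ x) (z - x) with hr₀
  have hr₀0 : 0 ≤ r₀ := localNorm_nonneg _ _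
  have htr : α * r₀ ≤ α * r := by gcongr
  have ht0 : 0 ≤ α * r₀ := by positivity
  have hq : 0 < 1 - α * r₀ := by linarith
  -- the determinants
  have hdet : (1 - α * r₀) ^ (3 * d) ≤
      (hess φ x).det * √(hess φ x).det / ((hess φ z).det * √(hess φ z).det) := by
    have h1 := hsc.hess_compare hx hz (by linarith)
    rw [← hr₀] at h1
    have h2 := det_le_of_inner_le (hsc.posDef hz) (hsc.posDef hx)
      (c := (1 - α * r₀) ^ 2) (C := ((1 - α * r₀) ^ 2)⁻¹) (by positivity) (fun v => (h1 v).1)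
      fun v => by
        rw [inv_mul_eq_div, le_div_iff₀ (by positivity), mul_comm]
        exact (h1 v).2
    rw [inv_pow, inv_mul_eq_div, le_div_iff₀ (by positivity), mul_comm, ← pow_mul, mul_comm 2 d,
      pow_mul] at h2
    rw [mul_comm 3 d, pow_mul]
    exact pow_le_det_ratio ha hb (by positivity) h2
  have hbern : 1 - 3 * d * (α * r) ≤ (1 - α * r₀) ^ (3 * d) := by
    have h1 := one_add_mul_le_pow (a := -(α * r₀)) (by linarith) (3 * d)
    rw [← sub_eq_add_neg] at h1
    refine le_trans ?_ h1
    push_cast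
    nlinarith [mul_le_mul_of_nonneg_left htr (by positivity : (0 : ℝ) ≤ 3 * d)]
  have hexp1 : 1 - E ≤ Real.exp (f x - f z +
        localNorm (hess φ x)⁻¹ (gradient φ z - gradient φ x + h • gradient f x) ^ 2 / (4 * h) -
        localNorm (hess φ z)⁻¹ (gradient φ x - gradient φ z + h • gradient f z) ^ 2 / (4 * h)) := by
    refine le_trans ?_ (Real.add_one_le_exp _)
    linarith
  rcases le_total E 1 with hE1 | hE1
  · calc 1 - (3 * d * (α * r) + h * β ^ 2 / 4 + ρ ^ 2 / (4 * h) * (21 / 10 * (α * r)) +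
          lam / 2 * (ρ * r) + 11 / 5 * (α * β) * r ^ 2)
        ≤ (1 - 3 * d * (α * r)) * (1 - E) := by nlinarith [mul_nonneg hp0 hE0]
      _ ≤ (1 - α * r₀) ^ (3 * d) * (1 - E) := by
          gcongr
      _ ≤ _ := mul_le_mul hdet hexp1 (by linarith) (by positivity)
  · refine le_trans (b := 0) (by linarith) (by positivity)

end MirrorLangevin

/-! ### The step size -/

namespace MirrorLangevin

open scoped MatrixOrder

variable {d : ℕ} {K : Set (EuclideanSpace ℝ (Fin d))}
  {φ f : EuclideanSpace ℝ (Fin d) → ℝ} {α β lam h ε : ℝ} {x z : EuclideanSpace ℝ (Fin d)}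

local notation "𝓛" => Matrix.toEuclideanCLM (𝕜 := ℝ)

theorem mul_le_of_ofReal_le_extDiv {c t : ℝ} (hc : 0 ≤ c) (hh : 0 ≤ h)
    (hle : ENNReal.ofReal h ≤ extDiv c t) : h * t ≤ c := by
  have h1 := ENNReal.mul_le_of_le_div hle
  rwa [← ENNReal.ofReal_mul hh, ENNReal.ofReal_le_ofReal_iff hc] at h1

theorem two_lt_log_eight_div (h0 : 0 < ε) (h1 : ε < 1) : 2 < Real.log (8 / ε) := by
  have h2 : Real.log 8 = 3 * Real.log 2 := by
    rw [show (8 : ℝ) = 2 ^ 3 by norm_num, Real.log_pow]; norm_num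
  have h3 : Real.log 8 ≤ Real.log (8 / ε) := by
    refine Real.log_le_log (by norm_num) ?_
    rw [le_div_iff₀ h0]
    linarith
  linarith [Real.log_two_gt_d9]

theorem constN_bounds (h0 : 0 < ε) (h1 : ε < 1) :
    7 ≤ constN ε ∧ 1 + 2 * Real.log (8 / ε) ≤ constN ε := by
  have h2 := two_lt_log_eight_div h0 h1
  have h3 : 2 ≤ √(2 * Real.log (8 / ε)) := Real.le_sqrt_of_sq_le (by linarith)
  constructor <;> rw [constN] <;> linarith

/-- The constraints on the step size that control the acceptance probability, in terms of the
radius `κ = √(h d N_ε)`. -/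
theorem stepBound_consequences (h0 : 0 < ε) (h1 : ε < 1)
    (hh0 : 0 < h) (hh : h ≤ stepBound ε d α β lam) :
    α * d * √(h * d * constN ε) * constN ε ≤ ε / 350 ∧
      (lam / 2 + α * β) * (h * d * constN ε) ≤ ε / 96 ∧ h * β ^ 2 ≤ ε / 4 := by
  obtain ⟨hN, -⟩ := constN_bounds h0 h1
  have hN0 : 0 < constN ε := by linarith
  rw [stepBound] at hh
  have hle := (ENNReal.ofReal_le_iff_le_toReal
    (ne_top_of_le_ne_top ENNReal.one_ne_top (min_le_left _ _))).2 hh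
  simp only [le_min_iff] at hle
  obtain ⟨-, k1, k2, -, -, k5⟩ := hle
  have e1 : constC₁ ε = (ε / 24) ^ 2 / (6 * constN ε) ^ 3 := by
    rw [constC₁, mul_pow, ← Real.rpow_natCast ((ε / 24) ^ (2 / 3 : ℝ)),
      ← Real.rpow_mul (by positivity)]
    norm_num
    ring
  have m1 := mul_le_of_ofReal_le_extDiv (by rw [e1]; positivity) hh0.le k1
  have m2 := mul_le_of_ofReal_le_extDiv (by rw [constC₂]; positivity) hh0.le k2
  have m5 := mul_le_of_ofReal_le_extDiv h0.le hh0.le k5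
  rw [e1, le_div_iff₀ (by positivity)] at m1
  rw [constC₂, mul_one_div, le_div_iff₀ (by positivity)] at m2
  refine ⟨?_, by linarith, by linarith⟩
  refine abs_le_of_sq_le_sq' ?_ (by positivity) |>.2
  rw [mul_pow, mul_pow, Real.sq_sqrt (by positivity)]
  nlinarith [sq_nonneg ε]

/-- The loss of the acceptance probability on the event that the noise is not too large. -/
theorem loss_le {κ N : ℝ} (hα : 0 ≤ α) (hlam : 0 ≤ lam) (hh0 : 0 < h)
    (hκ : 0 ≤ κ) (hN : 7 ≤ N) (hκN : κ ^ 2 = h * d * N)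
    (k1 : α * d * κ * N ≤ ε / 350) (k2 : (lam / 2 + α * β) * (h * d * N) ≤ ε / 96)
    (k3 : h * β ^ 2 ≤ ε / 4) :
    3 * d * (α * (9 / 4 * κ)) + h * β ^ 2 / 4 +
      (11 / 5 * κ) ^ 2 / (4 * h) * (21 / 10 * (α * (9 / 4 * κ))) +
      lam / 2 * (11 / 5 * κ * (9 / 4 * κ)) + 11 / 5 * (α * β) * (9 / 4 * κ) ^ 2 ≤ 3 / 8 * ε := by
  have e1 : (11 / 5 * κ) ^ 2 / (4 * h) * (21 / 10 * (α * (9 / 4 * κ))) =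
      121 / 100 * (189 / 40) * (α * d * κ * N) := by
    rw [mul_pow, hκN]
    field_simp
    ring
  have e2 : 3 * d * (α * (9 / 4 * κ)) = 27 / 4 * (α * d * κ) := by ring
  have h1 : 7 * (α * d * κ) ≤ α * d * κ * N := by
    rw [mul_comm]
    gcongr
  have e3 : lam / 2 * (11 / 5 * κ * (9 / 4 * κ)) = 99 / 20 * (lam / 2 * (h * d * N)) := by
    rw [← hκN]; ring
  have e4 : 11 / 5 * (α * β) * (9 / 4 * κ) ^ 2 = 891 / 80 * (α * β * (h * d * N)) := by
    rw [← hκN]; ring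
  have h2 : 0 ≤ lam / 2 * (h * d * N) := by positivity
  have h3 : 0 ≤ h * β ^ 2 := by positivity
  rw [e1, e2, e3, e4]
  linarith

/-- The distance travelled by a proposal whose noise is not too large. -/
theorem proposal_step_le (hsc : IsSelfConcordant K φ α) (hlip : IsRelLipschitz K f φ β)
    (hh0 : 0 < h) (hx : x ∈ interior K) (hz : z ∈ interior K) {N : ℝ} (hN : 7 ≤ N)
    (h1 : ε < 1) (k1 : α * d * √(h * d * N) * N ≤ ε / 350) (k3 : h * β ^ 2 ≤ ε / 4)
    {ξ : EuclideanSpace ℝ (Fin d)} (hξ : ‖ξ‖ ^ 2 ≤ 2 * d * N)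
    (hzξ : gradient φ z =
      gradient φ x - h • gradient f x + 𝓛 (CFC.sqrt ((2 * h) • hess φ x)) ξ) :
    localNorm (hess φ x) (z - x) ≤ 9 / 4 * √(h * d * N) ∧ α * (9 / 4 * √(h * d * N)) ≤ 1 / 100 ∧
      localNorm (hess φ x)⁻¹ (gradient φ z - gradient φ x) ≤ 11 / 5 * √(h * d * N) := by
  have hα := hsc.nonneg
  have hβ := hlip.nonneg hx
  rcases Nat.eq_zero_or_pos d with rfl | hd
  · -- in dimension zero the noise does not dominate the drift, but every norm vanishes
    have e0 : ∀ (A : Matrix (Fin 0) (Fin 0) ℝ) (u : EuclideanSpace ℝ (Fin 0)),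
        localNorm A u = 0 := fun A u => by
      rw [Subsingleton.elim u 0]; simp [localNorm]
    simp [e0]
  have hHx := hsc.posDef hx
  have hd1 : (1 : ℝ) ≤ d := by exact_mod_cast hd
  have hκ := Real.sqrt_nonneg (h * d * N)
  have hκN : √(h * d * N) ^ 2 = h * d * N := Real.sq_sqrt (by positivity)
  set κ := √(h * d * N)
  have hακ : α * κ ≤ 1 / 2450 := by
    have h2 : α * κ * 7 ≤ α * κ * (d * N) := by
      gcongr
      nlinarith
    nlinarith
  have hρ : localNorm (hess φ x)⁻¹ (gradient φ z - gradient φ x) ≤ 11 / 5 * κ := by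
    have e : gradient φ z - gradient φ x =
        h • -gradient f x + 𝓛 (CFC.sqrt ((2 * h) • hess φ x)) ξ := by
      rw [hzξ]; module
    rw [e]
    refine (localNorm_add_le hHx.inv _ _).trans ?_
    have h3 : h * β ≤ 1 / 5 * κ := by
      refine abs_le_of_sq_le_sq' ?_ (by positivity) |>.2
      rw [mul_pow, mul_pow, hκN]
      -- `(h β)² ≤ h ε / 4`, whereas `κ² ≥ 7 h`
      have h5 : h * 7 ≤ h * (d * N) := by
        gcongr
        nlinarith
      nlinarith
    have h4 : localNorm (hess φ x)⁻¹ (h • -gradient f x) ≤ 1 / 5 * κ := by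
      rw [localNorm_smul, abs_of_pos hh0, localNorm_neg]
      exact (mul_le_mul_of_nonneg_left (hlip.bound x hx) hh0.le).trans h3
    have h6 : localNorm (hess φ x)⁻¹ (𝓛 (CFC.sqrt ((2 * h) • hess φ x)) ξ) ≤ 2 * κ := by
      have h2h : 0 < 2 * h := by positivity
      have hS := hHx.smul h2h
      have e2 := localNorm_inv_smul_sq hHx h2h (𝓛 (CFC.sqrt ((2 * h) • hess φ x)) ξ)
      rw [← norm_sqrt_inv_apply hS, inv_mul_apply (sqrt_posDef hS).2.2,
        eq_div_iff h2h.ne'] at e2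
      refine abs_le_of_sq_le_sq' ?_ (by positivity) |>.2
      rw [← e2, mul_pow, hκN]
      nlinarith
    linarith
  refine ⟨?_, by linarith, hρ⟩
  set r := localNorm (hess φ x) (z - x) with hr
  have hr0 : 0 ≤ r := localNorm_nonneg _ _
  have h7 := hsc.le_inner_gradient_sub hx hz
  rw [← hr, div_le_iff₀ (by positivity)] at h7
  have h8 : inner ℝ (gradient φ z - gradient φ x) (z - x) ≤ 11 / 5 * κ * r :=
    ((le_abs_self _).trans (abs_inner_le_localNorm hHx _ _)).trans (by rw [← hr]; gcongr)
  rcases hr0.eq_or_lt with h9 | h9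
  · rw [← h9]; positivity
  · have h10 : r * r ≤ (11 / 5 * κ * (1 + α * r)) * r := by
      calc r * r = r ^ 2 := (sq r).symm
        _ ≤ _ := h7
        _ ≤ 11 / 5 * κ * r * (1 + α * r) := by gcongr
        _ = _ := by ring
    have h11 := le_of_mul_le_mul_right h10 h9
    nlinarith [mul_le_mul_of_nonneg_right hακ hr0]

/-! ### Rejections -/

/-- The Chernoff bound gives `exp (-d N_ε / 2) 2 ^ (d / 2)`, where `N_ε ≥ 1 + 2 log (8 / ε)`. -/
theorem stdGaussian_real_lt_norm_sq_le (h0 : 0 < ε) (h1 : ε < 1) (d : ℕ) :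
    (stdGaussian (EuclideanSpace ℝ (Fin d))).real {ξ | 2 * d * constN ε < ‖ξ‖ ^ 2} ≤ ε / 8 := by
  rcases Nat.eq_zero_or_pos d with rfl | hd
  · have : {ξ : EuclideanSpace ℝ (Fin 0) | 2 * ((0 : ℕ) : ℝ) * constN ε < ‖ξ‖ ^ 2} = ∅ := by
      ext ξ
      simp [Subsingleton.elim ξ 0]
    rw [this]
    simp only [measureReal_empty]
    positivity
  have hd1 : (1 : ℝ) ≤ d := by exact_mod_cast hd
  have hN := (constN_bounds h0 h1).2
  have hlog := two_lt_log_eight_div h0 h1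
  have hsub : {ξ : EuclideanSpace ℝ (Fin d) | 2 * d * constN ε < ‖ξ‖ ^ 2} ⊆
      {ξ | 2 * d * constN ε ≤ ‖ξ‖ ^ 2} := by
    intro ξ hξ
    rw [Set.mem_ofPred_eq] at hξ ⊢
    exact hξ.le
  refine (measureReal_mono hsub).trans ((stdGaussian_real_le_norm_sq (2 * d * constN ε)).trans ?_)
  rw [finrank_euclideanSpace_fin, Real.rpow_def_of_pos two_pos, ← Real.exp_add]
  have e : ε / 8 = Real.exp (-Real.log (8 / ε)) := by
    rw [← Real.log_inv, Real.exp_log (by positivity), inv_div]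
  rw [e, Real.exp_le_exp]
  have h2 := Real.log_two_lt_d9
  nlinarith

/-- A Metropolis kernel is as close to its proposal as the probability of rejection is small. -/
theorem tvDist_withDensity_add_dirac_le {Ω : Type*} [MeasurableSpace Ω] (P : Measure Ω)
    [IsProbabilityMeasure P] (a : Ω → ℝ≥0∞) (ha : ∀ z, a z ≤ 1) (x : Ω) {δ : ℝ} (hδ : 0 ≤ δ)
    (h : 1 ≤ ENNReal.ofReal δ + ∫⁻ z, a z ∂P) :
    tvDist (P.withDensity a + (1 - ∫⁻ z, a z ∂P) • Measure.dirac x) P ≤ δ := by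
  have : Nonempty {A : Set Ω // MeasurableSet A} := ⟨⟨∅, .empty⟩⟩
  refine ciSup_le fun A => ?_
  have h1 : (P.withDensity a + (1 - ∫⁻ z, a z ∂P) • Measure.dirac x) A ≤
      P A + ENNReal.ofReal δ := by
    rw [Measure.add_apply, Measure.smul_apply, withDensity_apply a A.2, smul_eq_mul]
    refine add_le_add ?_ ?_
    · exact (lintegral_mono fun z => ha z).trans (by simp)
    · calc (1 - ∫⁻ z, a z ∂P) * Measure.dirac x (A : Set Ω) ≤ ENNReal.ofReal δ * 1 :=
            mul_le_mul' (tsub_le_iff_right.2 h) prob_le_one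
        _ = ENNReal.ofReal δ := mul_one _
  have h2 := ENNReal.toReal_mono (by finiteness) h1
  rw [ENNReal.toReal_add (by finiteness) (by finiteness), ENNReal.toReal_ofReal hδ] at h2
  rw [measureReal_def, measureReal_def]
  linarith

theorem tvDist_metropolis_le (hK : IsCompact K) (hKc : Convex ℝ K) (hL : IsLegendre K φ)
    (hsc : IsSelfConcordant K φ α) (hsm : IsRelSmooth K f φ lam) (hlip : IsRelLipschitz K f φ β)
    (h0 : 0 < ε) (h1 : ε < 1) (hh0 : 0 < h) (hh : h ≤ stepBound ε d α β lam)
    (hx : x ∈ interior K) :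
    tvDist (metropolis K φ f h x) (proposal K φ f h x) ≤ ε / 2 := by
  obtain ⟨hcont, hinv, -⟩ := hsc.gradient_convexConj hK hKc hL hx
  obtain ⟨k1, k2, k3⟩ := stepBound_consequences h0 h1 hh0 hh
  obtain ⟨hN, -⟩ := constN_bounds h0 h1
  set S := (2 * h) • hess φ x with hS
  set m := gradient φ x - h • gradient f x with hm
  set G : EuclideanSpace ℝ (Fin d) → EuclideanSpace ℝ (Fin d) := fun ξ =>
    gradient (convexConj K φ) (m + 𝓛 (CFC.sqrt S) ξ) with hG
  have hPD : S.PosDef := (hsc.posDef hx).smul (by positivity)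
  have hGc : Continuous G := hcont.comp (by fun_prop)
  have hGi : Function.Injective G := fun ξ ξ' hξ => by
    have h2 := congrArg (gradient φ) hξ
    rw [(hinv _).2, (hinv _).2, add_right_inj] at h2
    rw [← inv_mul_apply (sqrt_posDef hPD).2.2 ξ, h2, inv_mul_apply (sqrt_posDef hPD).2.2]
  have hemb : MeasurableEmbedding G := hGc.measurableEmbedding hGi
  have hP : proposal K φ f h x = (stdGaussian (EuclideanSpace ℝ (Fin d))).map G := by
    rw [proposal, multivariateGaussian, Measure.map_map hcont.measurable (by fun_prop)]
    rfl
  have : IsProbabilityMeasure (proposal K φ f h x) := by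
    rw [hP]
    exact Measure.isProbabilityMeasure_map hGc.aemeasurable
  refine tvDist_withDensity_add_dirac_le _ _ (fun z => ?_) x (by positivity) ?_
  · rw [← ENNReal.ofReal_one]
    exact ENNReal.ofReal_le_ofReal (min_le_left _ _)
  -- along an embedding the change of variables needs no measurability of the acceptance probability
  rw [hP, hemb.lintegral_map]
  set B : Set (EuclideanSpace ℝ (Fin d)) := {ξ | 2 * d * constN ε < ‖ξ‖ ^ 2} with hB
  have hBm : MeasurableSet B := (isOpen_lt continuous_const (by fun_prop)).measurableSet
  have hacc : ∀ ξ ∈ Bᶜ, ENNReal.ofReal (1 - 3 / 8 * ε) ≤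
      ENNReal.ofReal (acceptProb K φ f h x (G ξ)) := fun ξ hξ => by
    refine ENNReal.ofReal_le_ofReal ?_
    obtain ⟨s1, s2, s3⟩ := proposal_step_le hsc hlip hh0 hx (hinv _).1 hN h1 k1 k3
      (not_lt.1 hξ) (hinv _).2
    refine le_trans ?_ (le_acceptProb hK hKc hsc hsm hlip hh0 hx (hinv _).1 s1 s2 s3)
    have := loss_le hsc.nonneg hsm.nonneg hh0 (Real.sqrt_nonneg _) hN
      (Real.sq_sqrt (by positivity)) k1 k2 k3
    linarith
  have hbad : stdGaussian (EuclideanSpace ℝ (Fin d)) B ≤ ENNReal.ofReal (ε / 8) := by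
    rw [← ofReal_measureReal]
    exact ENNReal.ofReal_le_ofReal (stdGaussian_real_lt_norm_sq_le h0 h1 d)
  have hgood : 1 ≤ ENNReal.ofReal (ε / 8) + stdGaussian (EuclideanSpace ℝ (Fin d)) Bᶜ := by
    rw [← prob_add_prob_compl (μ := stdGaussian (EuclideanSpace ℝ (Fin d))) hBm]
    gcongr
  calc (1 : ℝ≥0∞) ≤ ENNReal.ofReal (ε / 8) + stdGaussian (EuclideanSpace ℝ (Fin d)) Bᶜ := hgood
    _ = ENNReal.ofReal (ε / 8) + (ENNReal.ofReal (3 / 8 * ε) + ENNReal.ofReal (1 - 3 / 8 * ε)) *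
          stdGaussian (EuclideanSpace ℝ (Fin d)) Bᶜ := by
        rw [← ENNReal.ofReal_add (by positivity) (by linarith)]
        simp
    _ ≤ ENNReal.ofReal (ε / 8) + (ENNReal.ofReal (3 / 8 * ε) + ENNReal.ofReal (1 - 3 / 8 * ε) *
          stdGaussian (EuclideanSpace ℝ (Fin d)) Bᶜ) := by
        rw [add_mul]
        gcongr
        exact mul_le_of_le_one_right' prob_le_one
    _ = ENNReal.ofReal (ε / 2) + ENNReal.ofReal (1 - 3 / 8 * ε) *
          stdGaussian (EuclideanSpace ℝ (Fin d)) Bᶜ := by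
        rw [← add_assoc, ← ENNReal.ofReal_add (by positivity) (by positivity)]
        congr 2
        ring
    _ ≤ _ := by
        gcongr
        rw [← setLIntegral_const]
        exact (setLIntegral_mono' hBm.compl hacc).trans (setLIntegral_le_lintegral _ _)

end MirrorLangevin

theorem mainTheorem7 (d : ℕ) (K : Set (EuclideanSpace ℝ (Fin d)))
    (hK_compact : IsCompact K) (hK_convex : Convex ℝ K)
    (φ f : EuclideanSpace ℝ (Fin d) → ℝ) (α β μ lam : ℝ)
    (h_legendre : MirrorLangevin.IsLegendre K φ)
    (h_selfConcordant : MirrorLangevin.IsSelfConcordant K φ α)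
    (h_relConvex : MirrorLangevin.IsRelConvex K f φ μ)
    (h_relSmooth : MirrorLangevin.IsRelSmooth K f φ lam)
    (h_relLipschitz : MirrorLangevin.IsRelLipschitz K f φ β) :
    (∀ h : ℝ, 0 < h → h < 1 → ∀ x ∈ interior K, ∀ y ∈ interior K,
      MirrorLangevin.localNorm (MirrorLangevin.hess φ y) (x - y) ≤ √h / (10 * max 1 α) →
      MirrorLangevin.tvDist (MirrorLangevin.proposal K φ f h x)
          (MirrorLangevin.proposal K φ f h y) ≤
        1 / 2 * √(h * d / 20 + 1 / 80 + 9 / 2 * h * β ^ 2)) ∧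
    (∀ ε : ℝ, 0 < ε → ε < 1 → ∀ h : ℝ, 0 < h → h ≤ MirrorLangevin.stepBound ε d α β lam →
      ∀ x ∈ interior K,
      MirrorLangevin.tvDist (MirrorLangevin.metropolis K φ f h x)
          (MirrorLangevin.proposal K φ f h x) ≤ ε / 2) :=
  ⟨fun _ hh0 hh1 _ hx _ hy hxy => MirrorLangevin.tvDist_proposal_le hK_compact hK_convex
      h_legendre h_selfConcordant h_relLipschitz hh0 hh1 hx hy hxy,
    fun _ h0 h1 _ hh0 hh _ hx => MirrorLangevin.tvDist_metropolis_le hK_compact hK_convex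
      h_legendre h_selfConcordant h_relSmooth h_relLipschitz h0 h1 hh0 hh hx⟩
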